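/- Let $d\ge 1$, $j\in\{1,\dots,d\}$, and let $\alpha=(\alpha_1,\dots,\alpha_d)\in\mathbb R^d$ satisfy $\alpha_j>-3/2$ and $\alpha_i>-1$ for $i\ne j$. Put $|\alpha|=\alpha_1+\dots+\alpha_d$, let $e_j$ be the $j$th coordinate vector, and on $\mathbb R^d_+=(0,\infty)^d$ let $$d\mu_\alpha(x)=\Big(\prod_{i=1}^d x_i^{2\alpha_i+1}\Big)\,dx .$$ For $\beta\in(-1,\infty)^d$, $t>0$ and $x,y\in\mathbb R^d_+$ let $$G_t^{\beta,\ell}(x,y)=(\sinh 2t)^{-d}\exp\Big(-\tfrac12\coth(2t)\big(\|x\|^2+\|y\|^2\big)\Big)\prod_{i=1}^d (x_iy_i)^{-\beta_i}I_{\beta_i}\Big(\frac{x_iy_i}{\sinh 2t}\Big),$$ where $\|\cdot\|$ is the Euclidean norm and $I_\nu$ is the modified Bessel function of the first kind. The modified Laguerre semigroup of convolution type $\{\widetilde T_t^{\alpha,\ell,j}\}_{t\ge0}$ is given by $\widetilde T_0^{\alpha,\ell,j}=\mathrm{Id}$ and $$\widetilde T_t^{\alpha,\ell,j}f(x)=e^{-2t}\int_{\mathbb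 R^d_+}x_jy_j\,G_t^{\alpha+e_j,\ell}(x,y)f(y)\,d\mu_\alpha(y),\qquad x\in\mathbb R^d_+,\ t>0,$$ for $f\in L^1(\mu_\alpha)+L^\infty(\mu_\alpha)$ (real- or complex-valued). A family $\{T_t\}_{t\ge0}$ of linear operators mapping $L^1(\mu)+L^\infty(\mu)$ into the measurable functions, with $T_0=\mathrm{Id}$, is a symmetric diffusion semigroup if (i) for every $1\le p\le\infty$ each $T_t$ is a contraction on $L^p(\mu)$ and $\{T_t\}$ is a semigroup there; (ii) each $T_t$ is self-adjoint on $L^2(\mu)$; (iii) $T_tf\to f$ in $L^2(\mu)$ as $t\to0^+$ for every $f\in L^2(\mu)$. It is submarkovian if moreover $T_tf\ge0$ whenever $f\ge0$, and $T_t\mathbf 1\le\mathbf 1$, for all $t\ge 0$; it is Markovian if moreover $T_tf\ge 0$ whenever $f\ge 0$, and $T_t\mathbf 1=\mathbf 1$, for all $t\ge 0$. The family is called $L^p$-contractive if $\|T_tf\|_p\le\|f\|_p$ for all $1\le p\le\infty$, $t\ge0$ and $f\in L^2(\mu)\cap L^p(\mu)$. $\|\cdot\|_{p\to p}$ denotes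 the operator norm on $L^p(\mu_\alpha)$. Then the integral defining $\widetilde T_t^{\alpha,\ell,j}f(x)$ converges absolutely for all $t>0$, $f\in L^1(\mu_\alpha)+L^\infty(\mu_\alpha)$ and $x\in\mathbb R^d_+$, and the following holds. 1. If $\alpha_j\ge-1/2$, then $\{\widetilde T_t^{\alpha,\ell,j}\}$ is a submarkovian, but not Markovian, symmetric diffusion semigroup on $(\mathbb R^d_+,\mu_\alpha)$, and for all $1\le p\le\infty$ the operators map $L^p(\mu_\alpha)$ into itself with $$\|\widetilde T_t^{\alpha,\ell,j}\|_{p\to p}\le e^{-2t}(\cosh 2t)^{-(|\alpha|+d)},\qquad t>0.$$ 2. If $\alpha_j\in(-3/2,-1/2)$, then $\{\widetilde T_t^{\alpha,\ell,j}\}$ is not $L^p$-contractive, but there is a constant $c=c(\alpha)>1$ such that for all $1\le p\le\infty$ the operators map $L^p(\mu_\alpha)$ into itself with $$\|\widetilde T_t^{\alpha,\ell,j}\|_{p\to p}\le c\,e^{-2t}(\cosh 2t)^{-(|\alpha|+d)},\qquad t>0.$$ -/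

import Mathlib

open MeasureTheory Filter Topology
open scoped ENNReal ComplexOrder

namespace LaguerreSemigroup

noncomputable section

/-! ### Symmetric diffusion semigroups -/

/-- Membership in `L¹(μ) + L^∞(μ)`. -/
def MemL1AddLinf {X 𝕜 : Type*} [MeasurableSpace X] [RCLike 𝕜] (μ : Measure X)
    (f : X → 𝕜) : Prop :=
  ∃ g h : X → 𝕜, MemLp g 1 μ ∧ MemLp h ∞ μ ∧ f =ᵐ[μ] g + h

/-- `T` is (modulo null sets) a linear operator from `L¹(μ) + L^∞(μ)` to the space of
(almost everywhere) measurable functions. -/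
structure IsLinearOperator {X 𝕜 : Type*} [MeasurableSpace X] [RCLike 𝕜] (μ : Measure X)
    (T : (X → 𝕜) → X → 𝕜) : Prop where
  measurable : ∀ f, MemL1AddLinf μ f → AEStronglyMeasurable (T f) μ
  congr_ae : ∀ f g, MemL1AddLinf μ f → f =ᵐ[μ] g → T f =ᵐ[μ] T g
  map_add : ∀ f g, MemL1AddLinf μ f → MemL1AddLinf μ g → T (f + g) =ᵐ[μ] T f + T g
  map_smul : ∀ (c : 𝕜) f, MemL1AddLinf μ f → T (c • f) =ᵐ[μ] c • T f

/-- `T` maps `L^p(μ)` into itself. -/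
def MapsLp {X 𝕜 : Type*} [MeasurableSpace X] [RCLike 𝕜] (μ : Measure X) (p : ℝ≥0∞)
    (T : (X → 𝕜) → X → 𝕜) : Prop :=
  ∀ f, MemLp f p μ → MemLp (T f) p μ

/-- The operator norm `‖T‖_{p → p}` on `L^p(μ)`, with value `∞` if `T` is unbounded. -/
def lpOpNorm {X 𝕜 : Type*} [MeasurableSpace X] [RCLike 𝕜] (μ : Measure X) (p : ℝ≥0∞)
    (T : (X → 𝕜) → X → 𝕜) : ℝ≥0∞ :=
  sInf {C : ℝ≥0∞ | ∀ f, MemLp f p μ → eLpNorm (T f) p μ ≤ C * eLpNorm f p μ}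

/-- A symmetric diffusion semigroup `{T_t}_{t ≥ 0}` on `L¹(μ) + L^∞(μ)`; the values of `T t` for
negative `t` play no role. -/
structure IsSymmetricDiffusionSemigroup {X 𝕜 : Type*} [MeasurableSpace X] [RCLike 𝕜]
    (μ : Measure X) (T : ℝ → (X → 𝕜) → X → 𝕜) : Prop where
  linear : ∀ t, 0 ≤ t → IsLinearOperator μ (T t)
  zero : ∀ f, MemL1AddLinf μ f → T 0 f =ᵐ[μ] f
  contraction : ∀ p : ℝ≥0∞, 1 ≤ p → ∀ t, 0 ≤ t → ∀ f, MemLp f p μ →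
    MemLp (T t f) p μ ∧ eLpNorm (T t f) p μ ≤ eLpNorm f p μ
  semigroup : ∀ p : ℝ≥0∞, 1 ≤ p → ∀ s t, 0 ≤ s → 0 ≤ t → ∀ f, MemLp f p μ →
    T (s + t) f =ᵐ[μ] T s (T t f)
  selfAdjoint : ∀ t, 0 ≤ t → ∀ f g, MemLp f 2 μ → MemLp g 2 μ →
    ∫ x, T t f x * star (g x) ∂μ = ∫ x, f x * star (T t g x) ∂μ
  continuous : ∀ f, MemLp f 2 μ →
    Tendsto (fun t => eLpNorm (T t f - f) 2 μ) (𝓝[>] (0 : ℝ)) (𝓝 0)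

/-- Positivity: `T_t f ≥ 0` whenever `f ≥ 0`. -/
def IsPositive {X 𝕜 : Type*} [MeasurableSpace X] [RCLike 𝕜] (μ : Measure X)
    (T : ℝ → (X → 𝕜) → X → 𝕜) : Prop :=
  ∀ t, 0 ≤ t → ∀ f, MemL1AddLinf μ f → (∀ᵐ x ∂μ, 0 ≤ f x) → ∀ᵐ x ∂μ, 0 ≤ T t f x

/-- A Markovian symmetric diffusion semigroup: positive and conservative. -/
structure IsMarkovian {X 𝕜 : Type*} [MeasurableSpace X] [RCLike 𝕜] (μ : Measure X)
    (T : ℝ → (X → 𝕜) → X → 𝕜) : Prop where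
  diffusion : IsSymmetricDiffusionSemigroup μ T
  positive : IsPositive μ T
  conservative : ∀ t, 0 ≤ t → ∀ᵐ x ∂μ, T t (fun _ => 1) x = 1

/-- A submarkovian symmetric diffusion semigroup: positive with `T_t 1 ≤ 1`. -/
structure IsSubmarkovian {X 𝕜 : Type*} [MeasurableSpace X] [RCLike 𝕜] (μ : Measure X)
    (T : ℝ → (X → 𝕜) → X → 𝕜) : Prop where
  diffusion : IsSymmetricDiffusionSemigroup μ T
  positive : IsPositive μ T
  map_one_le : ∀ t, 0 ≤ t → ∀ᵐ x ∂μ, T t (fun _ => 1) x ≤ 1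

/-- `L^p`-contractivity (for all `1 ≤ p ≤ ∞` simultaneously):
`‖T_t f‖_p ≤ ‖f‖_p` for all `f ∈ L² ∩ L^p` and `t ≥ 0`. -/
def IsLpContractive {X 𝕜 : Type*} [MeasurableSpace X] [RCLike 𝕜] (μ : Measure X)
    (T : ℝ → (X → 𝕜) → X → 𝕜) : Prop :=
  ∀ p : ℝ≥0∞, 1 ≤ p → ∀ t, 0 ≤ t → ∀ f, MemLp f 2 μ → MemLp f p μ →
    eLpNorm (T t f) p μ ≤ eLpNorm f p μ

/-! ### Laguerre semigroups of convolution type -/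

/-- The modified Bessel function of the first kind `I_ν(z)`, for `ν > -1` and `z > 0`. -/
def besselI (ν z : ℝ) : ℝ :=
  ∑' k : ℕ, (z / 2) ^ (2 * (k : ℝ) + ν) / ((k.factorial : ℝ) * Real.Gamma ((k : ℝ) + ν + 1))

/-- The measure `dμ_α(x) = (∏ x_i ^ (2 α_i + 1)) dx` on the orthant `(0,∞)^d`, regarded as a
measure on `ℝ^d` that vanishes off the orthant. -/
def muAlpha {d : ℕ} (α : Fin d → ℝ) : Measure (Fin d → ℝ) :=
  (volume.restrict {x | ∀ i, 0 < x i}).withDensity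
    (fun x => ENNReal.ofReal (∏ i, x i ^ (2 * α i + 1)))

/-- The heat kernel `G_t^{α,ℓ}(x,y)` of the Laguerre operator of convolution type. -/
def heatKernel {d : ℕ} (α : Fin d → ℝ) (t : ℝ) (x y : Fin d → ℝ) : ℝ :=
  (Real.sinh (2 * t))⁻¹ ^ d *
    Real.exp (-(1 / 2) * (Real.cosh (2 * t) / Real.sinh (2 * t)) *
      ((∑ i, x i ^ 2) + ∑ i, y i ^ 2)) *
    ∏ i, (x i * y i) ^ (-α i) * besselI (α i) (x i * y i / Real.sinh (2 * t))

/-- The kernel `e^{-2t} x_j y_j G_t^{α+e_j,ℓ}(x,y)` of the modified semigroup. -/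
def modifiedKernel {d : ℕ} (α : Fin d → ℝ) (j : Fin d) (t : ℝ) (x y : Fin d → ℝ) : ℝ :=
  Real.exp (-2 * t) * (x j * y j * heatKernel (α + Pi.single j 1) t x y)

/-- The modified semigroup
`T̃_t^{α,ℓ,j} f(x) = e^{-2t} ∫ x_j y_j G_t^{α+e_j,ℓ}(x,y) f(y) dμ_α(y)`, `t > 0`, with `T̃_0 = Id`. -/
def modifiedSemigroup {𝕜 : Type*} [RCLike 𝕜] {d : ℕ} (α : Fin d → ℝ) (j : Fin d) (t : ℝ)
    (f : (Fin d → ℝ) → 𝕜) (x : Fin d → ℝ) : 𝕜 :=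
  if t = 0 then f x
  else ∫ y, modifiedKernel α j t x y • f y ∂(muAlpha α)

end

end LaguerreSemigroup

/-!
Up to the factor `e^{-2t}`, the kernel of the modified semigroup is a tensor product. The factors in
the coordinates `i ≠ j` are Bessel heat kernels, and the factor in the coordinate `j` is `|x y|`
times the Bessel heat kernel of order `ν = α_j + 1`, integrated against `y ^ (2α_j + 1) dy`.
Chapman–Kolmogorov is Weber's second exponential integral, a consequence of the power series of
`I_ν` and the Gamma integral. The mass of a Bessel heat kernel is elementary and at most
`(cosh 2t)^{-(α_i + 1)}`. In the coordinate `j` there is the additional factor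
`E[(1 - W)^{ν - 1/2}; W < 1]`, with `W` Gamma distributed of shape `1/2`. It is at most `1` if
`ν ≥ 1/2`; if `ν < 1/2`, it is bounded, but exceeds `1` by a fixed amount on a set of points `x`
that scales with `√t`, which rules out contractivity on `L^∞` for small `t`. By Schur's test the
bounds on the mass are the bounds on the operator norms. If `ν ≥ 1/2`, the kernels are
subprobability densities that concentrate at the diagonal as `t → 0`, so `T_t f → f` weakly, and by
contractivity on `L²` also strongly.
-/

namespace LaguerreSemigroup

open scoped NNReal

/-! ### Integral operators with symmetric kernels -/

section Kernel

variable {X 𝕜 : Type*} [MeasurableSpace X] [RCLike 𝕜] {μ : Measure X}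

namespace MemL1AddLinf

variable {f g : X → 𝕜}

theorem aestronglyMeasurable (hf : MemL1AddLinf μ f) : AEStronglyMeasurable f μ := by
  obtain ⟨g, h, hg, hh, hfgh⟩ := hf
  exact (hg.1.add hh.1).congr hfgh.symm

theorem congr (hf : MemL1AddLinf μ f) (hfg : f =ᵐ[μ] g) : MemL1AddLinf μ g := by
  obtain ⟨a, b, ha, hb, hfab⟩ := hf
  exact ⟨a, b, ha, hb, hfg.symm.trans hfab⟩

theorem of_memLp_top (hf : MemLp f ∞ μ) : MemL1AddLinf μ f :=
  ⟨0, f, MemLp.zero, hf, by rw [zero_add]⟩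

theorem of_memLp {p : ℝ≥0∞} (hp : 1 ≤ p) (hf : MemLp f p μ) : MemL1AddLinf μ f := by
  obtain rfl | hp_top := eq_or_ne p ∞
  · exact of_memLp_top hf
  obtain ⟨g, hgm, hfg⟩ := hf.1
  have hg : MemLp g p μ := hf.ae_eq hfg
  refine congr ?_ hfg.symm
  set s : Set X := {x | 1 ≤ ‖g x‖₊}
  have hs : MeasurableSet s := measurableSet_le measurable_const hgm.measurable.nnnorm
  have hμs : μ s ≠ ∞ :=
    (hg.meas_ge_lt_top (zero_lt_one.trans_le hp).ne' hp_top one_ne_zero).ne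
  refine ⟨s.indicator g, sᶜ.indicator g, ?_, ?_, by rw [Set.indicator_self_add_compl]⟩
  · exact (hg.indicator hs).mono_exponent_of_measure_support_ne_top
      (fun x hx => Set.indicator_of_notMem hx g) hμs hp
  · refine memLp_top_of_bound (hgm.indicator hs.compl).aestronglyMeasurable 1
      (Eventually.of_forall fun x => ?_)
    rw [norm_indicator_eq_indicator_norm]
    refine Set.indicator_apply_le' (fun hx => ?_) fun _ => zero_le_one
    exact le_of_not_ge (show ¬ 1 ≤ ‖g x‖₊ from hx)

end MemL1AddLinf

namespace IsLinearOperator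

variable {S T : (X → 𝕜) → X → 𝕜}

theorem congr (hS : IsLinearOperator μ S) (h : ∀ f, T f =ᵐ[μ] S f) : IsLinearOperator μ T where
  measurable f hf := (hS.measurable f hf).congr (h f).symm
  congr_ae f g hf hfg := (h f).trans ((hS.congr_ae f g hf hfg).trans (h g).symm)
  map_add f g hf hg := (h _).trans ((hS.map_add f g hf hg).trans ((h f).add (h g)).symm)
  map_smul c f hf := (h _).trans ((hS.map_smul c f hf).trans ((h f).const_smul c).symm)

theorem id : IsLinearOperator μ (fun f : X → 𝕜 => f) where
  measurable _ hf := hf.aestronglyMeasurable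
  congr_ae _ _ _ hfg := hfg
  map_add _ _ _ _ := EventuallyEq.rfl
  map_smul _ _ _ := EventuallyEq.rfl

end IsLinearOperator

theorem rpow_lintegral_le {g : X → ℝ≥0∞} (hg : AEMeasurable g μ) {p : ℝ} (hp : 1 ≤ p) :
    (∫⁻ x, g x ∂μ) ^ p ≤ μ Set.univ ^ (p - 1) * ∫⁻ x, g x ^ p ∂μ := by
  have hp0 : 0 < p := zero_lt_one.trans_le hp
  have h := eLpNorm'_le_eLpNorm'_mul_rpow_measure_univ zero_lt_one hp hg.aestronglyMeasurable
  simp only [eLpNorm'_eq_lintegral_enorm, enorm_eq_self, ENNReal.rpow_one, div_one] at h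
  calc (∫⁻ x, g x ∂μ) ^ p
      ≤ ((∫⁻ x, g x ^ p ∂μ) ^ (1 / p) * μ Set.univ ^ (1 - 1 / p)) ^ p := by gcongr
    _ = μ Set.univ ^ (p - 1) * ∫⁻ x, g x ^ p ∂μ := by
        rw [ENNReal.mul_rpow_of_nonneg _ _ hp0.le, ← ENNReal.rpow_mul, ← ENNReal.rpow_mul,
          one_div_mul_cancel hp0.ne', ENNReal.rpow_one, mul_comm]
        congr 2
        field_simp

/-- The integral operator `f ↦ ∫ K(·, y) f(y) dμ(y)` with the real kernel `K`. -/
noncomputable def kernelOp (μ : Measure X) (K : X → X → ℝ) (f : X → 𝕜) (x : X) : 𝕜 :=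
  ∫ y, K x y • f y ∂μ

/-- The kernels to which Schur's test is applied: nonnegative, symmetric and measurable, with
`∫ K(x, y) dμ(y) ≤ C` for every `x`. Boundedness of each `K(x, ·)` lets the operator act on `L¹`
pointwise rather than almost everywhere. -/
structure IsSymmKernel (μ : Measure X) (K : X → X → ℝ) (C : ℝ≥0) : Prop where
  measurable : Measurable (Function.uncurry K)
  nonneg : ∀ x y, 0 ≤ K x y
  symm : ∀ x y, K x y = K y x
  bounded : ∀ x, ∃ M, ∀ y, K x y ≤ M
  lintegral_le : ∀ x, ∫⁻ y, ENNReal.ofReal (K x y) ∂μ ≤ C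

variable {K : X → X → ℝ} {C : ℝ≥0}

theorem kernelOp_congr_ae {f g : X → 𝕜} (hfg : f =ᵐ[μ] g) : kernelOp μ K f = kernelOp μ K g := by
  funext x
  refine integral_congr_ae ?_
  filter_upwards [hfg] with y hy
  rw [hy]

theorem kernelOp_smul (c : 𝕜) (f : X → 𝕜) : kernelOp μ K (c • f) = c • kernelOp μ K f := by
  funext x
  simp only [kernelOp, Pi.smul_apply, smul_comm _ c, integral_smul]

theorem kernelOp_ofReal (f : X → ℝ) (x : X) :
    kernelOp μ K (fun y => (f y : 𝕜)) x = ((kernelOp μ K f x : ℝ) : 𝕜) := by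
  simp only [kernelOp, ← integral_ofReal, smul_eq_mul, RCLike.ofReal_mul,
    RCLike.real_smul_eq_coe_mul]

theorem kernelOp_one (x : X) :
    kernelOp μ K (fun _ => (1 : 𝕜)) x = ((∫ y, K x y ∂μ : ℝ) : 𝕜) := by
  simpa [kernelOp] using kernelOp_ofReal (𝕜 := 𝕜) (μ := μ) (K := K) (fun _ => 1) x

theorem kernelOp_nonneg (hK : ∀ x y, 0 ≤ K x y) {f : X → 𝕜} (hf : ∀ᵐ x ∂μ, 0 ≤ f x) (x : X) :
    0 ≤ kernelOp μ K f x :=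
  integral_nonneg_of_ae (hf.mono fun y hy => smul_nonneg (hK x y) hy)

theorem enorm_kernelOp_le (hK : ∀ x y, 0 ≤ K x y) (f : X → 𝕜) (x : X) :
    ‖kernelOp μ K f x‖ₑ ≤ ∫⁻ y, ENNReal.ofReal (K x y) * ‖f y‖ₑ ∂μ := by
  refine (enorm_integral_le_lintegral_enorm _).trans_eq (lintegral_congr fun y => ?_)
  rw [enorm_smul, Real.enorm_of_nonneg (hK x y)]

namespace IsSymmKernel

theorem mono (hK : IsSymmKernel μ K C) {D : ℝ≥0} (hCD : C ≤ D) : IsSymmKernel μ K D where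
  __ := hK
  lintegral_le x := (hK.lintegral_le x).trans (ENNReal.coe_le_coe.2 hCD)

theorem const_mul (hK : IsSymmKernel μ K C) {c : ℝ} (hc : 0 ≤ c) {D : ℝ≥0}
    (hD : c * C = D) : IsSymmKernel μ (fun x y => c * K x y) D where
  measurable := hK.measurable.const_mul c
  nonneg x y := mul_nonneg hc (hK.nonneg x y)
  symm x y := by rw [hK.symm]
  bounded x := by
    obtain ⟨M, hM⟩ := hK.bounded x
    exact ⟨c * M, fun y => mul_le_mul_of_nonneg_left (hM y) hc⟩
  lintegral_le x := by
    simp_rw [ENNReal.ofReal_mul hc]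
    rw [lintegral_const_mul' _ _ ENNReal.ofReal_ne_top, ← ENNReal.ofReal_coe_nnreal, ← hD,
      ENNReal.ofReal_mul hc, ENNReal.ofReal_coe_nnreal]
    gcongr
    exact hK.lintegral_le x

theorem measurable_right (hK : IsSymmKernel μ K C) (x : X) : Measurable (K x) :=
  hK.measurable.comp measurable_prodMk_left

theorem measurable_left (hK : IsSymmKernel μ K C) (y : X) : Measurable fun x => K x y :=
  hK.measurable.comp measurable_prodMk_right

theorem integrable_right (hK : IsSymmKernel μ K C) (x : X) : Integrable (K x) μ := by
  refine ⟨(hK.measurable_right x).aestronglyMeasurable, ?_⟩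
  rw [hasFiniteIntegral_iff_ofReal (Eventually.of_forall (hK.nonneg x))]
  exact (hK.lintegral_le x).trans_lt ENNReal.coe_lt_top

theorem memLp_top_right (hK : IsSymmKernel μ K C) (x : X) : MemLp (K x) ∞ μ := by
  obtain ⟨M, hM⟩ := hK.bounded x
  refine memLp_top_of_bound (hK.measurable_right x).aestronglyMeasurable M
    (Eventually.of_forall fun y => ?_)
  rw [Real.norm_of_nonneg (hK.nonneg x y)]
  exact hM y

theorem integral_le (hK : IsSymmKernel μ K C) (x : X) : ∫ y, K x y ∂μ ≤ C := by
  rw [integral_eq_lintegral_of_nonneg_ae (Eventually.of_forall (hK.nonneg x))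
    (hK.measurable_right x).aestronglyMeasurable]
  exact ENNReal.toReal_le_coe_of_le_coe (hK.lintegral_le x)

theorem integrable (hK : IsSymmKernel μ K C) {f : X → 𝕜} (hf : MemL1AddLinf μ f) (x : X) :
    Integrable (fun y => K x y • f y) μ := by
  obtain ⟨a, b, ha, hb, hfab⟩ := hf
  have hKa : Integrable (K x • a) μ :=
    (memLp_one_iff_integrable.1 ha).smul_of_top_right (hK.memLp_top_right x)
  have hKb : Integrable (K x • b) μ := (hK.integrable_right x).smul_of_top_left hb
  refine (hKa.add hKb).congr ?_
  filter_upwards [hfab] with y hy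
  rw [hy]
  exact (smul_add (K x y) (a y) (b y)).symm

theorem kernelOp_add (hK : IsSymmKernel μ K C) {f g : X → 𝕜} (hf : MemL1AddLinf μ f)
    (hg : MemL1AddLinf μ g) : kernelOp μ K (f + g) = kernelOp μ K f + kernelOp μ K g := by
  funext x
  simp only [kernelOp, Pi.add_apply, smul_add]
  exact integral_add (hK.integrable hf x) (hK.integrable hg x)

theorem kernelOp_sub (hK : IsSymmKernel μ K C) {f g : X → 𝕜} (hf : MemL1AddLinf μ f)
    (hg : MemL1AddLinf μ g) : kernelOp μ K (f - g) = kernelOp μ K f - kernelOp μ K g := by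
  funext x
  simp only [kernelOp, Pi.sub_apply, smul_sub]
  exact integral_sub (hK.integrable hf x) (hK.integrable hg x)

theorem kernelOp_one_le (hK : IsSymmKernel μ K C) (hC : C ≤ 1) (x : X) :
    kernelOp μ K (fun _ => (1 : 𝕜)) x ≤ 1 := by
  rw [kernelOp_one, ← RCLike.ofReal_one, RCLike.ofReal_le_ofReal]
  exact (hK.integral_le x).trans (by exact_mod_cast hC)

theorem aestronglyMeasurable_kernelOp [SFinite μ] (hK : IsSymmKernel μ K C) {f : X → 𝕜}
    (hf : AEStronglyMeasurable f μ) : AEStronglyMeasurable (kernelOp μ K f) μ := by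
  rw [kernelOp_congr_ae hf.ae_eq_mk]
  exact ((hK.measurable.stronglyMeasurable.smul
    (hf.stronglyMeasurable_mk.comp_measurable measurable_snd)).integral_prod_right'
      (ν := μ)).aestronglyMeasurable

theorem isLinearOperator [SFinite μ] (hK : IsSymmKernel μ K C) :
    IsLinearOperator μ (kernelOp (𝕜 := 𝕜) μ K) where
  measurable f hf := hK.aestronglyMeasurable_kernelOp hf.aestronglyMeasurable
  congr_ae f g _ hfg := by rw [kernelOp_congr_ae hfg]
  map_add f g hf hg := by rw [hK.kernelOp_add hf hg]
  map_smul c f _ := by rw [kernelOp_smul]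

/-! ### Schur's test -/

theorem lintegral_lintegral_mul_le [SFinite μ] (hK : IsSymmKernel μ K C) {g : X → ℝ≥0∞}
    (hg : Measurable g) :
    ∫⁻ x, ∫⁻ y, ENNReal.ofReal (K x y) * g y ∂μ ∂μ ≤ C * ∫⁻ y, g y ∂μ := by
  have hm : Measurable fun z : X × X => ENNReal.ofReal (K z.1 z.2) * g z.2 :=
    hK.measurable.ennreal_ofReal.mul (hg.comp measurable_snd)
  rw [lintegral_lintegral_swap hm.aemeasurable, ← lintegral_const_mul _ hg]
  refine lintegral_mono fun y => ?_
  rw [lintegral_mul_const _ (hK.measurable_left y).ennreal_ofReal]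
  simp_rw [hK.symm _ y]
  gcongr
  exact hK.lintegral_le y

theorem rpow_lintegral_mul_le (hK : IsSymmKernel μ K C) {g : X → ℝ≥0∞} (hg : Measurable g)
    {p : ℝ} (hp : 1 ≤ p) (x : X) :
    (∫⁻ y, ENNReal.ofReal (K x y) * g y ∂μ) ^ p ≤
      C ^ (p - 1) * ∫⁻ y, ENNReal.ofReal (K x y) * g y ^ p ∂μ := by
  set ν := μ.withDensity fun y => ENNReal.ofReal (K x y) with hν
  have hKx : Measurable fun y => ENNReal.ofReal (K x y) := (hK.measurable_right x).ennreal_ofReal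
  have lintegral_ν {h : X → ℝ≥0∞} (hh : Measurable h) :
      ∫⁻ y, ENNReal.ofReal (K x y) * h y ∂μ = ∫⁻ y, h y ∂ν :=
    (lintegral_withDensity_eq_lintegral_mul _ hKx hh).symm
  have hν_univ : ν Set.univ ≤ C := by
    rw [hν, withDensity_apply _ .univ, Measure.restrict_univ]
    exact hK.lintegral_le x
  rw [lintegral_ν hg, lintegral_ν (hg.pow_const p)]
  refine (rpow_lintegral_le hg.aemeasurable hp).trans ?_
  gcongr

theorem eLpNorm_top_kernelOp_le (hK : IsSymmKernel μ K C) (f : X → 𝕜) :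
    eLpNorm (kernelOp μ K f) ∞ μ ≤ C * eLpNorm f ∞ μ := by
  rw [eLpNorm_exponent_top, eLpNorm_exponent_top]
  refine essSup_le_of_ae_le _ (Eventually.of_forall fun x => ?_)
  calc ‖kernelOp μ K f x‖ₑ
      ≤ ∫⁻ y, ENNReal.ofReal (K x y) * ‖f y‖ₑ ∂μ := enorm_kernelOp_le hK.nonneg f x
    _ ≤ ∫⁻ y, ENNReal.ofReal (K x y) * eLpNormEssSup f μ ∂μ := by
        refine lintegral_mono_ae ((ae_le_eLpNormEssSup (f := f)).mono fun y hy => ?_)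
        gcongr
    _ ≤ C * eLpNormEssSup f μ := by
        rw [lintegral_mul_const _ (hK.measurable_right x).ennreal_ofReal]
        gcongr
        exact hK.lintegral_le x

theorem lintegral_enorm_kernelOp_rpow_le [SFinite μ] (hK : IsSymmKernel μ K C) {p : ℝ}
    (hp : 1 ≤ p) {f : X → 𝕜} (hf : StronglyMeasurable f) :
    ∫⁻ x, ‖kernelOp μ K f x‖ₑ ^ p ∂μ ≤ (C : ℝ≥0∞) ^ p * ∫⁻ x, ‖f x‖ₑ ^ p ∂μ :=
  have hfm : Measurable fun y => ‖f y‖ₑ := hf.enorm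
  calc ∫⁻ x, ‖kernelOp μ K f x‖ₑ ^ p ∂μ
      ≤ ∫⁻ x, (C : ℝ≥0∞) ^ (p - 1) * ∫⁻ y, ENNReal.ofReal (K x y) * ‖f y‖ₑ ^ p ∂μ ∂μ := by
        refine lintegral_mono fun x => le_trans ?_ (hK.rpow_lintegral_mul_le hfm hp x)
        gcongr
        exact enorm_kernelOp_le hK.nonneg f x
    _ ≤ (C : ℝ≥0∞) ^ (p - 1) * (C * ∫⁻ y, ‖f y‖ₑ ^ p ∂μ) := by
        rw [lintegral_const_mul' _ _
          (ENNReal.rpow_ne_top_of_nonneg (sub_nonneg.2 hp) ENNReal.coe_ne_top)]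
        gcongr
        exact hK.lintegral_lintegral_mul_le (hfm.pow_const _)
    _ = (C : ℝ≥0∞) ^ p * ∫⁻ x, ‖f x‖ₑ ^ p ∂μ := by
        rw [← mul_assoc]
        congr 1
        nth_rewrite 2 [← ENNReal.rpow_one (C : ℝ≥0∞)]
        rw [← ENNReal.rpow_add_of_nonneg _ _ (sub_nonneg.2 hp) zero_le_one, sub_add_cancel]

theorem eLpNorm_kernelOp_le [SFinite μ] (hK : IsSymmKernel μ K C) {p : ℝ≥0∞} (hp : 1 ≤ p)
    {f : X → 𝕜} (hf : AEStronglyMeasurable f μ) :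
    eLpNorm (kernelOp μ K f) p μ ≤ C * eLpNorm f p μ := by
  obtain rfl | hp_top := eq_or_ne p ∞
  · exact hK.eLpNorm_top_kernelOp_le f
  rw [kernelOp_congr_ae hf.ae_eq_mk, eLpNorm_congr_ae hf.ae_eq_mk]
  have hp1 : 1 ≤ p.toReal := by simpa using ENNReal.toReal_mono hp_top hp
  have hp0 : 0 < p.toReal := zero_lt_one.trans_le hp1
  simp only [eLpNorm_eq_lintegral_rpow_enorm_toReal (zero_lt_one.trans_le hp).ne' hp_top]
  calc (∫⁻ x, ‖kernelOp μ K (hf.mk f) x‖ₑ ^ p.toReal ∂μ) ^ (1 / p.toReal)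
      ≤ ((C : ℝ≥0∞) ^ p.toReal * ∫⁻ x, ‖hf.mk f x‖ₑ ^ p.toReal ∂μ) ^ (1 / p.toReal) := by
        gcongr
        exact hK.lintegral_enorm_kernelOp_rpow_le hp1 hf.stronglyMeasurable_mk
    _ = C * (∫⁻ x, ‖hf.mk f x‖ₑ ^ p.toReal ∂μ) ^ (1 / p.toReal) := by
        rw [ENNReal.mul_rpow_of_nonneg _ _ (one_div_nonneg.2 hp0.le), ← ENNReal.rpow_mul,
          mul_one_div_cancel hp0.ne', ENNReal.rpow_one]

theorem memLp_kernelOp [SFinite μ] (hK : IsSymmKernel μ K C) {p : ℝ≥0∞} (hp : 1 ≤ p)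
    {f : X → 𝕜} (hf : MemLp f p μ) : MemLp (kernelOp μ K f) p μ :=
  ⟨hK.aestronglyMeasurable_kernelOp hf.1, (hK.eLpNorm_kernelOp_le hp hf.1).trans_lt
    (ENNReal.mul_lt_top ENNReal.coe_lt_top hf.2)⟩

end IsSymmKernel

end Kernel

section KernelSemigroup

variable {X 𝕜 : Type*} [MeasurableSpace X] [RCLike 𝕜] {μ : Measure X} {K : X → X → ℝ} {C : ℝ≥0}

namespace IsSymmKernel

theorem integrable_prod [SFinite μ] (hK : IsSymmKernel μ K C) {f g : X → 𝕜} (hf : MemLp f 2 μ)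
    (hg : MemLp g 2 μ) :
    Integrable (fun z : X × X => K z.1 z.2 • f z.2 * star (g z.1)) (μ.prod μ) := by
  have hm : AEStronglyMeasurable (fun z : X × X => K z.1 z.2 • f z.2 * star (g z.1)) (μ.prod μ) :=
    (hK.measurable.aestronglyMeasurable.smul hf.1.comp_snd).mul
      (continuous_star.comp_aestronglyMeasurable hg.1.comp_fst)
  refine (integrable_prod_iff hm).2 ⟨Eventually.of_forall fun x => ?_, ?_⟩
  · exact (hK.integrable (.of_memLp one_le_two hf) x).mul_const (star (g x))
  · refine ((hK.memLp_kernelOp one_le_two hf.norm).integrable_mul hg.norm).congr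
      (Eventually.of_forall fun x => ?_)
    simp only [kernelOp, Pi.mul_apply, norm_mul, norm_smul, norm_star, smul_eq_mul,
      integral_mul_const, Real.norm_of_nonneg (hK.nonneg x _)]

theorem integral_kernelOp_mul_star [SFinite μ] (hK : IsSymmKernel μ K C) {f g : X → 𝕜}
    (hf : MemLp f 2 μ) (hg : MemLp g 2 μ) :
    ∫ x, kernelOp μ K f x * star (g x) ∂μ = ∫ x, f x * star (kernelOp μ K g x) ∂μ :=
  calc ∫ x, kernelOp μ K f x * star (g x) ∂μ
      = ∫ x, ∫ y, K x y • f y * star (g x) ∂μ ∂μ := by simp only [kernelOp, integral_mul_const]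
    _ = ∫ y, ∫ x, K x y • f y * star (g x) ∂μ ∂μ :=
        integral_integral_swap (hK.integrable_prod hf hg)
    _ = ∫ x, f x * star (kernelOp μ K g x) ∂μ := by
        simp only [kernelOp, RCLike.star_def, ← integral_conj, ← integral_const_mul,
          RCLike.conj_smul, mul_smul_comm, smul_mul_assoc, hK.symm _]

section Comp

variable {K₁ K₂ : X → X → ℝ} {C₁ C₂ : ℝ≥0}

theorem integrable_mul (hK₁ : IsSymmKernel μ K₁ C₁) (hK₂ : IsSymmKernel μ K₂ C₂) (x z : X) :
    Integrable (fun y => K₁ x y * K₂ y z) μ := by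
  have hz : (fun y => K₂ y z) = K₂ z := funext fun y => hK₂.symm y z
  exact (hK₁.integrable_right x).smul_of_top_left (hz ▸ hK₂.memLp_top_right z)

theorem integral_mul_of_lintegral_eq (hK : IsSymmKernel μ K C) (hK₁ : IsSymmKernel μ K₁ C₁)
    (hK₂ : IsSymmKernel μ K₂ C₂)
    {x z : X} (hcomp : ∫⁻ y, ENNReal.ofReal (K₁ x y) * ENNReal.ofReal (K₂ y z) ∂μ =
      ENNReal.ofReal (K x z)) : ∫ y, K₁ x y * K₂ y z ∂μ = K x z := by
  rw [integral_eq_lintegral_of_nonneg_ae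
    (Eventually.of_forall fun y => mul_nonneg (hK₁.nonneg _ _) (hK₂.nonneg _ _))
    ((hK₁.measurable_right x).mul (hK₂.measurable_left z)).aestronglyMeasurable]
  simp_rw [ENNReal.ofReal_mul (hK₁.nonneg x _), hcomp, ENNReal.toReal_ofReal (hK.nonneg x z)]

theorem kernelOp_kernelOp [SFinite μ] (hK : IsSymmKernel μ K C) (hK₁ : IsSymmKernel μ K₁ C₁)
    (hK₂ : IsSymmKernel μ K₂ C₂)
    (hcomp : ∀ x z, ∫⁻ y, ENNReal.ofReal (K₁ x y) * ENNReal.ofReal (K₂ y z) ∂μ =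
      ENNReal.ofReal (K x z)) {f : X → 𝕜} (hf : MemL1AddLinf μ f) :
    kernelOp μ K₁ (kernelOp μ K₂ f) = kernelOp μ K f := by
  have hcomp' x z : ∫ y, K₁ x y * K₂ y z ∂μ = K x z :=
    integral_mul_of_lintegral_eq hK hK₁ hK₂ (hcomp x z)
  funext x
  have hint : Integrable (fun w : X × X => (K₁ x w.1 * K₂ w.1 w.2) • f w.2) (μ.prod μ) := by
    have hm : AEStronglyMeasurable (fun w : X × X => (K₁ x w.1 * K₂ w.1 w.2) • f w.2) (μ.prod μ) :=
      (((hK₁.measurable_right x).comp measurable_fst).mul hK₂.measurable).aestronglyMeasurable.smul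
        hf.aestronglyMeasurable.comp_snd
    refine (integrable_prod_iff' hm).2 ⟨Eventually.of_forall fun z => ?_, ?_⟩
    · exact (hK₁.integrable_mul hK₂ x z).smul_const (f z)
    · refine (hK.integrable hf x).norm.congr (Eventually.of_forall fun z => ?_)
      simp only [norm_smul, integral_mul_const, Real.norm_of_nonneg (hK.nonneg x z), hcomp',
        Real.norm_of_nonneg (mul_nonneg (hK₁.nonneg x _) (hK₂.nonneg _ z))]
  calc kernelOp μ K₁ (kernelOp μ K₂ f) x
      = ∫ y, ∫ z, (K₁ x y * K₂ y z) • f z ∂μ ∂μ := by simp only [kernelOp, mul_smul, integral_smul]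
    _ = ∫ z, ∫ y, (K₁ x y * K₂ y z) • f z ∂μ ∂μ := integral_integral_swap hint
    _ = kernelOp μ K f x := by simp only [kernelOp, integral_smul_const, hcomp']

end Comp

theorem setLIntegral_le_of_eLpNorm_top_le (hK : IsSymmKernel μ K C) {s : Set X}
    (hs : MeasurableSet s)
    (h : eLpNorm (kernelOp μ K (s.indicator fun _ => (1 : 𝕜))) ∞ μ ≤ 1) :
    ∀ᵐ x ∂μ, ∫⁻ y in s, ENNReal.ofReal (K x y) ∂μ ≤ 1 := by
  rw [eLpNorm_exponent_top] at h
  filter_upwards [ae_le_eLpNormEssSup (f := kernelOp μ K (s.indicator fun _ => (1 : 𝕜)))] with x hx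
  have hKs : kernelOp μ K (s.indicator fun _ => (1 : 𝕜)) x =
      ((∫ y in s, K x y ∂μ : ℝ) : 𝕜) := by
    rw [← kernelOp_one, kernelOp, kernelOp, ← integral_indicator hs]
    simp only [Set.indicator_smul_apply]
  rw [← ofReal_integral_eq_lintegral_ofReal (hK.integrable_right x).integrableOn
    (Eventually.of_forall (hK.nonneg x)), ← Real.enorm_of_nonneg (integral_nonneg (hK.nonneg x)),
    ← ofReal_norm, ← norm_algebraMap' 𝕜, ofReal_norm, RCLike.algebraMap_eq_ofReal, ← hKs]
  exact hx.trans h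

/-- The function `1` need not be in `L²`, so an `L^∞` contraction bound on `L² ∩ L^∞` is tested on
the indicators of an exhausting sequence of sets of finite measure. -/
theorem lintegral_le_one_of_contractive [SigmaFinite μ] (hK : IsSymmKernel μ K C)
    (hcontr : ∀ f : X → 𝕜, MemLp f 2 μ → MemLp f ∞ μ →
      eLpNorm (kernelOp μ K f) ∞ μ ≤ eLpNorm f ∞ μ) :
    ∀ᵐ x ∂μ, ∫⁻ y, ENNReal.ofReal (K x y) ∂μ ≤ 1 := by
  have hA n : MeasurableSet (spanningSets μ n) := measurableSet_spanningSets μ n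
  have hμA n : μ (spanningSets μ n) ≠ ∞ := (measure_spanningSets_lt_top μ n).ne
  have h n : ∀ᵐ x ∂μ, ∫⁻ y in spanningSets μ n, ENNReal.ofReal (K x y) ∂μ ≤ 1 := by
    refine hK.setLIntegral_le_of_eLpNorm_top_le (𝕜 := 𝕜) (hA n) ((hcontr _
      (memLp_indicator_const 2 (hA n) 1 (.inr (hμA n)))
      (memLp_indicator_const ∞ (hA n) 1 (.inr (hμA n)))).trans ?_)
    refine (eLpNorm_indicator_le _).trans ?_
    rw [eLpNorm_exponent_top]
    exact essSup_le_of_ae_le _ (Eventually.of_forall fun _ => enorm_one.le)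
  filter_upwards [ae_all_iff.2 h] with x hx
  rw [← setLIntegral_univ, ← iUnion_spanningSets μ,
    setLIntegral_iUnion_of_directed _ (monotone_spanningSets μ).directed_le]
  exact iSup_le hx

end IsSymmKernel

/-! ### Semigroups of integral operators -/

variable {k : ℝ → X → X → ℝ} {T : ℝ → (X → 𝕜) → X → 𝕜}

theorem isSymmetricDiffusionSemigroup_of_kernel [SFinite μ]
    (hk : ∀ t, 0 < t → IsSymmKernel μ (k t) 1)
    (hcomp : ∀ s t, 0 < s → 0 < t → ∀ x z,
      ∫⁻ y, ENNReal.ofReal (k s x y) * ENNReal.ofReal (k t y z) ∂μ = ENNReal.ofReal (k (s + t) x z))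
    (hcont : ∀ f : X → 𝕜, MemLp f 2 μ →
      Tendsto (fun t => eLpNorm (kernelOp μ (k t) f - f) 2 μ) (𝓝[>] 0) (𝓝 0))
    (hT0 : ∀ f, T 0 f = f) (hT : ∀ t, 0 < t → ∀ f, T t f =ᵐ[μ] kernelOp μ (k t) f) :
    IsSymmetricDiffusionSemigroup μ T where
  linear t ht := by
    obtain rfl | ht := ht.eq_or_lt
    · exact IsLinearOperator.id.congr fun f => by rw [hT0]
    · exact (hk t ht).isLinearOperator.congr (hT t ht)
  zero f _ := by rw [hT0]
  contraction p hp t ht f hf := by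
    obtain rfl | ht := ht.eq_or_lt
    · rw [hT0]
      exact ⟨hf, le_rfl⟩
    · rw [memLp_congr_ae (hT t ht f), eLpNorm_congr_ae (hT t ht f)]
      exact ⟨(hk t ht).memLp_kernelOp hp hf, by simpa using (hk t ht).eLpNorm_kernelOp_le hp hf.1⟩
  semigroup p hp s t hs ht f hf := by
    obtain rfl | hs := hs.eq_or_lt
    · rw [zero_add, hT0]
    obtain rfl | ht := ht.eq_or_lt
    · rw [add_zero, hT0]
    have hst := add_pos hs ht
    calc T (s + t) f =ᵐ[μ] kernelOp μ (k (s + t)) f := hT _ hst f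
      _ = kernelOp μ (k s) (kernelOp μ (k t) f) := ((hk _ hst).kernelOp_kernelOp (hk s hs) (hk t ht)
          (hcomp s t hs ht) (.of_memLp hp hf)).symm
      _ = kernelOp μ (k s) (T t f) := (kernelOp_congr_ae (hT t ht f)).symm
      _ =ᵐ[μ] T s (T t f) := (hT s hs _).symm
  selfAdjoint t ht f g hf hg := by
    obtain rfl | ht := ht.eq_or_lt
    · rw [hT0, hT0]
    calc ∫ x, T t f x * star (g x) ∂μ
        = ∫ x, kernelOp μ (k t) f x * star (g x) ∂μ :=
          integral_congr_ae ((hT t ht f).mono fun x hx => by simp only [hx])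
      _ = ∫ x, f x * star (kernelOp μ (k t) g x) ∂μ := (hk t ht).integral_kernelOp_mul_star hf hg
      _ = ∫ x, f x * star (T t g x) ∂μ :=
          integral_congr_ae ((hT t ht g).mono fun x hx => by simp only [hx])
  continuous f hf := (hcont f hf).congr' <| by
    filter_upwards [self_mem_nhdsWithin] with t ht
    exact eLpNorm_congr_ae ((hT t ht f).symm.sub EventuallyEq.rfl)

theorem isSubmarkovian_of_kernel [SFinite μ] (hk : ∀ t, 0 < t → IsSymmKernel μ (k t) 1)
    (hcomp : ∀ s t, 0 < s → 0 < t → ∀ x z,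
      ∫⁻ y, ENNReal.ofReal (k s x y) * ENNReal.ofReal (k t y z) ∂μ = ENNReal.ofReal (k (s + t) x z))
    (hcont : ∀ f : X → 𝕜, MemLp f 2 μ →
      Tendsto (fun t => eLpNorm (kernelOp μ (k t) f - f) 2 μ) (𝓝[>] 0) (𝓝 0))
    (hT0 : ∀ f, T 0 f = f) (hT : ∀ t, 0 < t → ∀ f, T t f =ᵐ[μ] kernelOp μ (k t) f) :
    IsSubmarkovian μ T where
  diffusion := isSymmetricDiffusionSemigroup_of_kernel hk hcomp hcont hT0 hT
  positive t ht f _ hf := by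
    obtain rfl | ht := ht.eq_or_lt
    · rwa [hT0]
    · filter_upwards [hT t ht f] with x hx
      rw [hx]
      exact kernelOp_nonneg (hk t ht).nonneg hf x
  map_one_le t ht := by
    obtain rfl | ht := ht.eq_or_lt
    · simp only [hT0, le_refl, eventually_true]
    · filter_upwards [hT t ht fun _ => 1] with x hx
      rw [hx]
      exact (hk t ht).kernelOp_one_le le_rfl x

end KernelSemigroup

/-! ### The Bessel series -/

section Series

/-- The entire function `F_ν(z) = ∑ z ^ k / (k! Γ(k + ν + 1))`, so that
`I_ν(z) = (z / 2) ^ ν F_ν((z / 2) ^ 2)`; unlike `I_ν` it has no singularity at the origin. -/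
noncomputable def besselSeries (ν z : ℝ) : ℝ :=
  ∑' k : ℕ, z ^ k / (k.factorial * Real.Gamma (k + ν + 1))

variable {ν : ℝ}

theorem gamma_nat_add_pos (hν : -1 < ν) (k : ℕ) : 0 < Real.Gamma (k + ν + 1) :=
  Real.Gamma_pos_of_pos (by linarith [k.cast_nonneg (α := ℝ)])

theorem summable_pow_div_gamma (hν : -1 < ν) {w : ℝ} (hw : 0 ≤ w) :
    Summable fun k : ℕ => w ^ k / Real.Gamma (k + ν + 1) := by
  refine summable_of_ratio_norm_eventually_le (r := 1 / 2) (by norm_num) ?_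
  filter_upwards [eventually_ge_atTop (⌈2 * w⌉₊ + 1)] with k hk
  have hk' : 2 * w + 1 ≤ k := (add_le_add_left (Nat.le_ceil _) 1).trans (by exact_mod_cast hk)
  have hpos : 0 < (k : ℝ) + ν + 1 := by linarith
  have hG := gamma_nat_add_pos hν k
  have hG_succ : Real.Gamma ((k + 1 : ℕ) + ν + 1) = (k + ν + 1) * Real.Gamma (k + ν + 1) := by
    rw [← Real.Gamma_add_one hpos.ne', Nat.cast_add_one]
    ring_nf
  rw [hG_succ, Real.norm_of_nonneg (by positivity), Real.norm_of_nonneg (by positivity), pow_succ',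
    mul_div_mul_comm]
  refine mul_le_mul_of_nonneg_right ?_ (by positivity)
  rw [div_le_iff₀ hpos]
  linarith

theorem besselSeries_term_nonneg (hν : -1 < ν) {z : ℝ} (hz : 0 ≤ z) (k : ℕ) :
    0 ≤ z ^ k / (k.factorial * Real.Gamma (k + ν + 1)) := by
  have := gamma_nat_add_pos hν k
  positivity

theorem summable_besselSeries (hν : -1 < ν) {z : ℝ} (hz : 0 ≤ z) :
    Summable fun k : ℕ => z ^ k / (k.factorial * Real.Gamma (k + ν + 1)) := by
  refine (summable_pow_div_gamma hν hz).of_nonneg_of_le (besselSeries_term_nonneg hν hz) fun k => ?_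
  have := gamma_nat_add_pos hν k
  gcongr
  exact le_mul_of_one_le_left this.le (by exact_mod_cast k.factorial_pos)

theorem besselSeries_nonneg (hν : -1 < ν) {z : ℝ} (hz : 0 ≤ z) : 0 ≤ besselSeries ν z :=
  tsum_nonneg (besselSeries_term_nonneg hν hz)

theorem ofReal_besselSeries (hν : -1 < ν) {z : ℝ} (hz : 0 ≤ z) :
    ENNReal.ofReal (besselSeries ν z) =
      ∑' k : ℕ, ENNReal.ofReal (z ^ k / (k.factorial * Real.Gamma (k + ν + 1))) :=
  ENNReal.ofReal_tsum_of_nonneg (besselSeries_term_nonneg hν hz) (summable_besselSeries hν hz)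

theorem measurable_besselSeries_sq (hν : -1 < ν) :
    Measurable fun z : ℝ => besselSeries ν (z ^ 2) := by
  have h z : besselSeries ν (z ^ 2) = (∑' k : ℕ, ENNReal.ofReal
      ((z ^ 2) ^ k / (k.factorial * Real.Gamma (k + ν + 1)))).toReal := by
    rw [← ofReal_besselSeries hν (sq_nonneg z),
      ENNReal.toReal_ofReal (besselSeries_nonneg hν (sq_nonneg z))]
  simp only [h]
  exact (Measurable.tsum fun k => by fun_prop).ennreal_toReal

theorem besselI_eq (ν : ℝ) {z : ℝ} (hz : 0 < z) :
    besselI ν z = (z / 2) ^ ν * besselSeries ν ((z / 2) ^ 2) := by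
  rw [besselI, besselSeries, ← tsum_mul_left]
  congr 1
  funext k
  rw [Real.rpow_add (by positivity), ← pow_mul, ← Real.rpow_natCast]
  push_cast
  ring

theorem besselSeries_mul_exp_le (hν : -1 < ν) {w b : ℝ} (hw : 0 ≤ w) (hb : 0 < b) (y : ℝ) :
    besselSeries ν (w * y ^ 2) * Real.exp (-b * y ^ 2) ≤
      ∑' k : ℕ, (w / b) ^ k / Real.Gamma (k + ν + 1) := by
  have hz : 0 ≤ w * y ^ 2 := by positivity
  rw [besselSeries, ← tsum_mul_right]
  refine Summable.tsum_le_tsum (fun k => ?_) ((summable_besselSeries hν hz).mul_right _)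
    (summable_pow_div_gamma hν (by positivity))
  have hG := gamma_nat_add_pos hν k
  calc (w * y ^ 2) ^ k / (k.factorial * Real.Gamma (k + ν + 1)) * Real.exp (-b * y ^ 2)
      = (w / b) ^ k / Real.Gamma (k + ν + 1) *
        ((b * y ^ 2) ^ k / k.factorial * Real.exp (-b * y ^ 2)) := by
        rw [mul_pow, mul_pow, div_pow]
        field_simp
    _ ≤ (w / b) ^ k / Real.Gamma (k + ν + 1) *
        (Real.exp (b * y ^ 2) * Real.exp (-b * y ^ 2)) := by
        gcongr
        exact Real.pow_div_factorial_le_exp _ (by positivity) k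
    _ = (w / b) ^ k / Real.Gamma (k + ν + 1) := by
        rw [← Real.exp_add, neg_mul, add_neg_cancel, Real.exp_zero, mul_one]

theorem gamma_add_nat_eq {x : ℝ} (hx : 0 < x) (n : ℕ) :
    Real.Gamma (x + n) = n.factorial * Ring.choose (x + n - 1) n * Real.Gamma x := by
  rw [← Ring.multichoose_eq, ← nsmul_eq_mul, Ring.factorial_nsmul_multichoose_eq_ascPochhammer,
    Polynomial.ascPochhammer_smeval_eq_eval]
  induction n with
  | zero => simp only [Nat.cast_zero, add_zero, ascPochhammer_zero, Polynomial.eval_one, one_mul]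
  | succ n ih =>
    rw [Nat.cast_succ, ← add_assoc, Real.Gamma_add_one (by positivity), ih, ascPochhammer_succ_eval]
    ring

/-- The Chu–Vandermonde identity for `(k + (l + c - 1)).choose l`. -/
theorem gamma_add_add_div_eq_sum (k l : ℕ) {c : ℝ} (hc : 0 < c) :
    Real.Gamma (k + l + c) / (Real.Gamma (k + c) * Real.Gamma (l + c)) =
      ∑ m ∈ Finset.range (l + 1), k.choose m * l.choose m * (m.factorial / Real.Gamma (m + c)) := by
  have hG (n : ℕ) : 0 < Real.Gamma (n + c) := Real.Gamma_pos_of_pos (by positivity)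
  have hkl : Real.Gamma (k + l + c) =
      l.factorial * Ring.choose (k + (l + c - 1) : ℝ) l * Real.Gamma (k + c) := by
    rw [← add_sub_assoc, ← add_assoc, add_right_comm, gamma_add_nat_eq (by positivity)]
  rw [hkl, Ring.add_choose_eq l (Commute.all _ _), Finset.Nat.sum_antidiagonal_eq_sum_range_succ_mk,
    mul_comm (Real.Gamma (k + c)), mul_div_mul_right _ _ (hG k).ne', Finset.mul_sum, Finset.sum_div]
  refine Finset.sum_congr rfl fun m hm => ?_
  have hml : m ≤ l := Nat.lt_succ_iff.1 (Finset.mem_range.1 hm)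
  have hl : Real.Gamma (l + c) =
      (l - m).factorial * Ring.choose (l + c - 1 : ℝ) (l - m) * Real.Gamma (m + c) := by
    have h := gamma_add_nat_eq (x := m + c) (by positivity) (l - m)
    rwa [Nat.cast_sub hml, add_right_comm, add_sub_cancel] at h
  have hGl := hl ▸ (hG l).ne'
  have hfac : (l.choose m * m.factorial * (l - m).factorial : ℝ) = l.factorial := by
    exact_mod_cast Nat.choose_mul_factorial_mul_factorial hml
  rw [hl, Ring.choose_natCast, ← hfac]
  have := (hG m).ne'
  have : Ring.choose (l + c - 1 : ℝ) (l - m) ≠ 0 := by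
    rintro h
    simp only [h, mul_zero, zero_mul, ne_eq, not_true_eq_false] at hGl
  field_simp

theorem tsum_ofReal_pow_div_factorial {u : ℝ} (hu : 0 ≤ u) :
    ∑' k : ℕ, ENNReal.ofReal (u ^ k / k.factorial) = ENNReal.ofReal (Real.exp u) := by
  rw [← ENNReal.ofReal_tsum_of_nonneg (fun k => by positivity) (Real.summable_pow_div_factorial u),
    Real.exp_eq_exp_ℝ, NormedSpace.exp_eq_tsum_div]

theorem tsum_ofReal_pow_div_factorial_mul_choose {u : ℝ} (hu : 0 ≤ u) (m : ℕ) :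
    ∑' k : ℕ, ENNReal.ofReal (u ^ k / k.factorial * k.choose m) =
      ENNReal.ofReal (u ^ m / m.factorial * Real.exp u) := by
  have h_lt : ∑ k ∈ Finset.range m, ENNReal.ofReal (u ^ k / k.factorial * k.choose m) = 0 :=
    Finset.sum_eq_zero fun k hk => by
      rw [Nat.choose_eq_zero_of_lt (Finset.mem_range.1 hk), Nat.cast_zero, mul_zero,
        ENNReal.ofReal_zero]
  have h_shift (k : ℕ) : u ^ (k + m) / (k + m).factorial * (k + m).choose m =
      u ^ m / m.factorial * (u ^ k / k.factorial) := by
    rw [Nat.add_choose, Nat.cast_div (Nat.factorial_mul_factorial_dvd_factorial_add k m)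
      (by positivity), Nat.cast_mul, pow_add]
    field_simp
  rw [← Summable.sum_add_tsum_nat_add' (k := m) ENNReal.summable, h_lt, zero_add,
    ENNReal.ofReal_mul (by positivity), ← tsum_ofReal_pow_div_factorial hu, ← ENNReal.tsum_mul_left]
  simp only [h_shift, ENNReal.ofReal_mul (show 0 ≤ u ^ m / m.factorial by positivity)]

theorem ofReal_mul_gamma_div_eq_tsum {u v c : ℝ} (hu : 0 ≤ u) (hv : 0 ≤ v) (hc : 0 < c)
    (k l : ℕ) :
    ENNReal.ofReal (u ^ k / k.factorial * (v ^ l / l.factorial) *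
        (Real.Gamma (k + l + c) / (Real.Gamma (k + c) * Real.Gamma (l + c)))) =
      ∑' m : ℕ, ENNReal.ofReal (u ^ k / k.factorial * k.choose m) *
        ENNReal.ofReal (v ^ l / l.factorial * l.choose m) *
          ENNReal.ofReal (m.factorial / Real.Gamma (m + c)) := by
  have hG (m : ℕ) : 0 < Real.Gamma (m + c) := Real.Gamma_pos_of_pos (by positivity)
  rw [tsum_eq_sum (s := Finset.range (l + 1)) fun m hm => by
      rw [Nat.choose_eq_zero_of_lt (n := l) (by simpa using hm), Nat.cast_zero, mul_zero,
        ENNReal.ofReal_zero, mul_zero, zero_mul],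
    gamma_add_add_div_eq_sum k l hc, Finset.mul_sum,
    ENNReal.ofReal_sum_of_nonneg fun m _ => by have := hG m; positivity]
  refine Finset.sum_congr rfl fun m _ => ?_
  rw [← ENNReal.ofReal_mul (by positivity), ← ENNReal.ofReal_mul (by positivity)]
  ring_nf

theorem tsum_tsum_gamma_eq {u v : ℝ} (hν : -1 < ν) (hu : 0 ≤ u) (hv : 0 ≤ v) :
    ∑' k : ℕ, ∑' l : ℕ, ENNReal.ofReal (u ^ k / k.factorial * (v ^ l / l.factorial) *
      (Real.Gamma (k + l + (ν + 1)) / (Real.Gamma (k + (ν + 1)) * Real.Gamma (l + (ν + 1))))) =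
      ENNReal.ofReal (Real.exp (u + v) * besselSeries ν (u * v)) := by
  have hc : 0 < ν + 1 := by linarith
  let a (k m : ℕ) := ENNReal.ofReal (u ^ k / k.factorial * k.choose m)
  let b (l m : ℕ) := ENNReal.ofReal (v ^ l / l.factorial * l.choose m)
  let g (m : ℕ) := ENNReal.ofReal (m.factorial / Real.Gamma (m + (ν + 1)))
  have h_term (m : ℕ) : (∑' k, a k m) * (∑' l, b l m) * g m = ENNReal.ofReal (Real.exp (u + v)) *
      ENNReal.ofReal ((u * v) ^ m / (m.factorial * Real.Gamma (m + ν + 1))) := by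
    have hG := gamma_nat_add_pos hν m
    simp only [a, b, g, tsum_ofReal_pow_div_factorial_mul_choose hu,
      tsum_ofReal_pow_div_factorial_mul_choose hv, ← add_assoc]
    rw [← ENNReal.ofReal_mul (by positivity), ← ENNReal.ofReal_mul (by positivity),
      ← ENNReal.ofReal_mul (by positivity), Real.exp_add, mul_pow]
    congr 1
    field_simp
  calc _ = ∑' k, ∑' l, ∑' m, a k m * b l m * g m := by
        simp only [ofReal_mul_gamma_div_eq_tsum hu hv hc, a, b, g]
    _ = ∑' k, ∑' m, ∑' l, a k m * b l m * g m := tsum_congr fun k => ENNReal.tsum_comm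
    _ = ∑' m, ∑' k, ∑' l, a k m * b l m * g m := ENNReal.tsum_comm
    _ = ∑' m, (∑' k, a k m) * (∑' l, b l m) * g m := by
        simp only [ENNReal.tsum_mul_right, ENNReal.tsum_mul_left]
    _ = ENNReal.ofReal (Real.exp (u + v) * besselSeries ν (u * v)) := by
        simp only [h_term, ENNReal.tsum_mul_left]
        rw [← ofReal_besselSeries hν (by positivity), ENNReal.ofReal_mul (by positivity)]

end Series

/-! ### Bessel kernels on the half-line -/

section HalfLine

/-- The measure `y ^ (2a + 1) dy` on `(0, ∞)`, the one-dimensional factor of `muAlpha`. -/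
noncomputable def halfMeasure (a : ℝ) : Measure ℝ :=
  (volume.restrict (Set.Ioi 0)).withDensity fun y => ENNReal.ofReal (y ^ (2 * a + 1))

theorem lintegral_halfMeasure (a : ℝ) (f : ℝ → ℝ≥0∞) :
    ∫⁻ y, f y ∂halfMeasure a = ∫⁻ y in Set.Ioi 0, ENNReal.ofReal (y ^ (2 * a + 1)) * f y :=
  lintegral_withDensity_eq_lintegral_mul_non_measurable _ (by fun_prop)
    (Eventually.of_forall fun _ => ENNReal.ofReal_lt_top) f

instance (a : ℝ) : SigmaFinite (halfMeasure a) :=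
  inferInstanceAs (SigmaFinite (Measure.withDensity _ fun y => ENNReal.ofReal (y ^ (2 * a + 1))))

theorem halfMeasure_ae_pos (a : ℝ) : ∀ᵐ y ∂halfMeasure a, 0 < y :=
  (withDensity_absolutelyContinuous _ _).ae_le (ae_restrict_mem measurableSet_Ioi)

variable {ν : ℝ}

theorem lintegral_pow_mul_exp {b : ℝ} (hν : -1 < ν) (hb : 0 < b) (k : ℕ) :
    ∫⁻ y, ENNReal.ofReal (y ^ (2 * k) * Real.exp (-b * y ^ 2)) ∂halfMeasure ν =
      ENNReal.ofReal (1 / 2 * b ^ (-(k + ν + 1)) * Real.Gamma (k + ν + 1)) := by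
  have hs : -1 < 2 * (k : ℝ) + (2 * ν + 1) := by linarith [k.cast_nonneg (α := ℝ)]
  have h_integrand : ∀ y ∈ Set.Ioi (0 : ℝ), ENNReal.ofReal (y ^ (2 * ν + 1)) *
      ENNReal.ofReal (y ^ (2 * k) * Real.exp (-b * y ^ 2)) =
      ENNReal.ofReal (y ^ (2 * (k : ℝ) + (2 * ν + 1)) * Real.exp (-b * y ^ (2 : ℝ))) := by
    intro y (hy : 0 < y)
    rw [← ENNReal.ofReal_mul (by positivity), Real.rpow_add hy (2 * (k : ℝ)), Real.rpow_two,
      show (2 * k : ℝ) = (2 * k : ℕ) by push_cast; rfl, Real.rpow_natCast]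
    ring_nf
  rw [lintegral_halfMeasure, setLIntegral_congr_fun measurableSet_Ioi h_integrand,
    ← ofReal_integral_eq_lintegral_ofReal
      (integrableOn_rpow_mul_exp_neg_mul_rpow hs two_pos hb),
    integral_rpow_mul_exp_neg_mul_rpow two_pos hs hb]
  · ring_nf
  · filter_upwards [ae_restrict_mem measurableSet_Ioi] with y (hy : 0 < y)
    rw [Pi.zero_apply]
    positivity

theorem ofReal_besselSeries_mul_sq {w : ℝ} (hν : -1 < ν) (hw : 0 ≤ w) (y : ℝ) :
    ENNReal.ofReal (besselSeries ν (w * y ^ 2)) =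
      ∑' k : ℕ, ENNReal.ofReal (w ^ k / (k.factorial * Real.Gamma (k + ν + 1))) *
        ENNReal.ofReal (y ^ (2 * k)) := by
  rw [ofReal_besselSeries hν (by positivity)]
  refine tsum_congr fun k => ?_
  rw [← ENNReal.ofReal_mul (besselSeries_term_nonneg hν hw k), mul_pow, ← pow_mul,
    div_mul_eq_mul_div]

theorem lintegral_besselSeries_mul_exp {w b : ℝ} (hν : -1 < ν) (hw : 0 ≤ w) (hb : 0 < b) :
    ∫⁻ y, ENNReal.ofReal (besselSeries ν (w * y ^ 2) * Real.exp (-b * y ^ 2)) ∂halfMeasure ν =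
      ENNReal.ofReal (1 / 2 * b ^ (-(ν + 1)) * Real.exp (w / b)) := by
  have h_expand (y : ℝ) :
      ENNReal.ofReal (besselSeries ν (w * y ^ 2) * Real.exp (-b * y ^ 2)) =
        ∑' k : ℕ, ENNReal.ofReal (w ^ k / (k.factorial * Real.Gamma (k + ν + 1))) *
          ENNReal.ofReal (y ^ (2 * k) * Real.exp (-b * y ^ 2)) := by
    rw [ENNReal.ofReal_mul (besselSeries_nonneg hν (by positivity)),
      ofReal_besselSeries_mul_sq hν hw, ← ENNReal.tsum_mul_right]
    simp only [mul_assoc, ENNReal.ofReal_mul (Even.pow_nonneg (even_two_mul _) y)]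
  have h_term (k : ℕ) : ENNReal.ofReal (w ^ k / (k.factorial * Real.Gamma (k + ν + 1))) *
      ENNReal.ofReal (1 / 2 * b ^ (-(k + ν + 1)) * Real.Gamma (k + ν + 1)) =
      ENNReal.ofReal (1 / 2 * b ^ (-(ν + 1))) * ENNReal.ofReal ((w / b) ^ k / k.factorial) := by
    have hG := gamma_nat_add_pos hν k
    rw [← ENNReal.ofReal_mul (by positivity), ← ENNReal.ofReal_mul (by positivity),
      show -((k : ℝ) + ν + 1) = -(ν + 1) - k by ring, Real.rpow_sub hb, Real.rpow_natCast, div_pow]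
    congr 1
    field_simp
  simp only [h_expand]
  rw [lintegral_tsum fun k => by fun_prop]
  simp only [fun k : ℕ => lintegral_const_mul (μ := halfMeasure ν)
    (ENNReal.ofReal (w ^ k / (k.factorial * Real.Gamma (k + ν + 1))))
    (f := fun y => ENNReal.ofReal (y ^ (2 * k) * Real.exp (-b * y ^ 2))) (by fun_prop),
    lintegral_pow_mul_exp hν hb, h_term]
  rw [ENNReal.tsum_mul_left, tsum_ofReal_pow_div_factorial (by positivity),
    ← ENNReal.ofReal_mul (by positivity)]

theorem ofReal_besselSeries_mul_besselSeries_mul_exp {w w' : ℝ} (hν : -1 < ν) (hw : 0 ≤ w)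
    (hw' : 0 ≤ w') (b y : ℝ) :
    ENNReal.ofReal (besselSeries ν (w * y ^ 2) * besselSeries ν (w' * y ^ 2) *
        Real.exp (-b * y ^ 2)) =
      ∑' k : ℕ, ∑' l : ℕ, ENNReal.ofReal (w ^ k / (k.factorial * Real.Gamma (k + ν + 1)) *
          (w' ^ l / (l.factorial * Real.Gamma (l + ν + 1)))) *
        ENNReal.ofReal (y ^ (2 * (k + l)) * Real.exp (-b * y ^ 2)) := by
  have hF := besselSeries_nonneg hν (z := w * y ^ 2) (by positivity)
  have hF' := besselSeries_nonneg hν (z := w' * y ^ 2) (by positivity)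
  rw [ENNReal.ofReal_mul (by positivity), ENNReal.ofReal_mul hF, ofReal_besselSeries_mul_sq hν hw,
    ofReal_besselSeries_mul_sq hν hw', ← ENNReal.tsum_mul_right, ← ENNReal.tsum_mul_right]
  refine tsum_congr fun k => ?_
  rw [← ENNReal.tsum_mul_left, ← ENNReal.tsum_mul_right]
  refine tsum_congr fun l => ?_
  rw [ENNReal.ofReal_mul (besselSeries_term_nonneg hν hw k),
    ENNReal.ofReal_mul (Even.pow_nonneg (even_two_mul _) y), mul_add 2 k l, pow_add,
    ENNReal.ofReal_mul (Even.pow_nonneg (even_two_mul _) y)]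
  ring

theorem ofReal_mul_lintegral_pow_mul_exp {w w' b : ℝ} (hν : -1 < ν) (hw : 0 ≤ w) (hw' : 0 ≤ w')
    (hb : 0 < b) (k l : ℕ) :
    ENNReal.ofReal (w ^ k / (k.factorial * Real.Gamma (k + ν + 1)) *
        (w' ^ l / (l.factorial * Real.Gamma (l + ν + 1)))) *
      ∫⁻ y, ENNReal.ofReal (y ^ (2 * (k + l)) * Real.exp (-b * y ^ 2)) ∂halfMeasure ν =
    ENNReal.ofReal (1 / 2 * b ^ (-(ν + 1))) *
      ENNReal.ofReal ((w / b) ^ k / k.factorial * ((w' / b) ^ l / l.factorial) *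
        (Real.Gamma (k + l + (ν + 1)) /
          (Real.Gamma (k + (ν + 1)) * Real.Gamma (l + (ν + 1))))) := by
  have hk := gamma_nat_add_pos hν k
  have hl := gamma_nat_add_pos hν l
  rw [lintegral_pow_mul_exp hν hb, ← ENNReal.ofReal_mul (by positivity),
    ← ENNReal.ofReal_mul (by positivity),
    show -(((k + l : ℕ) : ℝ) + ν + 1) = -(ν + 1) - (k + l : ℕ) by ring, Real.rpow_sub hb,
    Real.rpow_natCast, pow_add, div_pow, div_pow]
  push_cast
  simp only [add_assoc] at hk hl ⊢
  congr 1
  field_simp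

/-- Weber's second exponential integral. -/
theorem lintegral_besselSeries_mul_besselSeries {w w' b : ℝ} (hν : -1 < ν) (hw : 0 ≤ w)
    (hw' : 0 ≤ w') (hb : 0 < b) :
    ∫⁻ y, ENNReal.ofReal (besselSeries ν (w * y ^ 2) * besselSeries ν (w' * y ^ 2) *
        Real.exp (-b * y ^ 2)) ∂halfMeasure ν =
      ENNReal.ofReal (1 / 2 * b ^ (-(ν + 1)) *
        (Real.exp (w / b + w' / b) * besselSeries ν (w / b * (w' / b)))) := by
  simp only [ofReal_besselSeries_mul_besselSeries_mul_exp hν hw hw']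
  rw [lintegral_tsum fun k => (Measurable.tsum fun l => by fun_prop).aemeasurable,
    ENNReal.ofReal_mul (by positivity), ← tsum_tsum_gamma_eq hν (by positivity) (by positivity),
    ← ENNReal.tsum_mul_left]
  refine tsum_congr fun k => ?_
  rw [lintegral_tsum fun l => by fun_prop, ← ENNReal.tsum_mul_left]
  refine tsum_congr fun l => ?_
  rw [lintegral_const_mul _ (by fun_prop), ofReal_mul_lintegral_pow_mul_exp hν hw hw' hb]

/-- The two-parameter family of kernels `2 p ^ (ν + 1) exp (-c (x² + y²)) F_ν ((p x y)²)`, where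
`F_ν` is the Bessel series. It contains the one-dimensional heat kernels and is closed under
composition; being even in `x` and `y`, it needs no cut-off to the half-line. -/
noncomputable def besselKernel (ν p c x y : ℝ) : ℝ :=
  2 * p ^ (ν + 1) * Real.exp (-c * (x ^ 2 + y ^ 2)) * besselSeries ν ((p * x * y) ^ 2)

variable {p c : ℝ}

theorem besselKernel_symm (ν p c x y : ℝ) : besselKernel ν p c x y = besselKernel ν p c y x := by
  rw [besselKernel, besselKernel, add_comm (x ^ 2), mul_right_comm p]

theorem besselKernel_nonneg (hν : -1 < ν) (hp : 0 < p) (x y : ℝ) :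
    0 ≤ besselKernel ν p c x y := by
  have := besselSeries_nonneg hν (sq_nonneg (p * x * y))
  rw [besselKernel]
  positivity

theorem measurable_besselKernel (hν : -1 < ν) (p c : ℝ) :
    Measurable (Function.uncurry (besselKernel ν p c)) :=
  Measurable.mul (by fun_prop) ((measurable_besselSeries_sq hν).comp
    (f := fun q : ℝ × ℝ => p * q.1 * q.2) (by fun_prop))

theorem one_add_abs_mul_exp_le {b : ℝ} (hb : 0 < b) (y : ℝ) :
    (1 + |y|) * Real.exp (-b * y ^ 2) ≤ Real.exp (1 / (4 * b)) :=
  calc (1 + |y|) * Real.exp (-b * y ^ 2) ≤ Real.exp |y| * Real.exp (-b * y ^ 2) := by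
        gcongr
        linarith [Real.add_one_le_exp |y|]
    _ = Real.exp (1 / (4 * b) - (2 * b * |y| - 1) ^ 2 / (4 * b)) := by
        rw [← Real.exp_add, ← sq_abs y]
        congr 1
        field_simp
        ring
    _ ≤ Real.exp (1 / (4 * b)) := Real.exp_le_exp.2 (sub_le_self _ (by positivity))

theorem exists_mul_besselKernel_le (hν : -1 < ν) (hp : 0 < p) (hc : 0 < c) (x : ℝ) :
    ∃ M, ∀ y, (1 + |y|) * besselKernel ν p c x y ≤ M := by
  have hw : 0 ≤ (p * x) ^ 2 := sq_nonneg _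
  refine ⟨2 * p ^ (ν + 1) * Real.exp (-c * x ^ 2) *
    ((∑' k : ℕ, ((p * x) ^ 2 / (c / 2)) ^ k / Real.Gamma (k + ν + 1)) *
      Real.exp (1 / (4 * (c / 2)))), fun y => ?_⟩
  calc (1 + |y|) * besselKernel ν p c x y
      = 2 * p ^ (ν + 1) * Real.exp (-c * x ^ 2) *
        (besselSeries ν ((p * x) ^ 2 * y ^ 2) * Real.exp (-(c / 2) * y ^ 2) *
          ((1 + |y|) * Real.exp (-(c / 2) * y ^ 2))) := by
        rw [besselKernel, mul_pow _ y, show -c * (x ^ 2 + y ^ 2) =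
          -c * x ^ 2 + (-(c / 2) * y ^ 2 + -(c / 2) * y ^ 2) by ring, Real.exp_add, Real.exp_add]
        ring
    _ ≤ _ := by
        have := besselSeries_nonneg hν (z := (p * x) ^ 2 * y ^ 2) (by positivity)
        gcongr
        · exact (by positivity : (0:ℝ) ≤ _).trans (besselSeries_mul_exp_le hν hw (half_pos hc) y)
        · exact besselSeries_mul_exp_le hν hw (half_pos hc) y
        · exact one_add_abs_mul_exp_le (half_pos hc) y

theorem lintegral_besselKernel_mul_exp {l : ℝ} (hν : -1 < ν) (hp : 0 < p) (hb : 0 < c + l)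
    (x : ℝ) :
    ∫⁻ y, ENNReal.ofReal (besselKernel ν p c x y * Real.exp (-l * y ^ 2)) ∂halfMeasure ν =
      ENNReal.ofReal ((p / (c + l)) ^ (ν + 1) * Real.exp (-(c - p ^ 2 / (c + l)) * x ^ 2)) := by
  have h_factor (y : ℝ) : ENNReal.ofReal (besselKernel ν p c x y * Real.exp (-l * y ^ 2)) =
      ENNReal.ofReal (2 * p ^ (ν + 1) * Real.exp (-c * x ^ 2)) *
        ENNReal.ofReal (besselSeries ν ((p * x) ^ 2 * y ^ 2) * Real.exp (-(c + l) * y ^ 2)) := by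
    rw [← ENNReal.ofReal_mul (by positivity), besselKernel, mul_pow _ y,
      show -c * (x ^ 2 + y ^ 2) = -c * x ^ 2 + -c * y ^ 2 by ring, neg_add, add_mul, Real.exp_add,
      Real.exp_add]
    ring_nf
  simp only [h_factor]
  rw [lintegral_const_mul' _ _ ENNReal.ofReal_ne_top,
    lintegral_besselSeries_mul_exp hν (sq_nonneg _) hb, ← ENNReal.ofReal_mul (by positivity)]
  congr 1
  rw [Real.div_rpow hp.le hb.le, Real.rpow_neg hb.le,
    show -(c - p ^ 2 / (c + l)) * x ^ 2 = -c * x ^ 2 + (p * x) ^ 2 / (c + l) by ring, Real.exp_add]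
  ring

theorem lintegral_besselKernel_mul_besselKernel {p' c' p₂ c₂ : ℝ} (hν : -1 < ν) (hp : 0 < p)
    (hp' : 0 < p') (hb : 0 < c + c') (hp₂ : p₂ = p * p' / (c + c'))
    (hc₂ : c₂ = c - p ^ 2 / (c + c')) (hc₂' : c₂ = c' - p' ^ 2 / (c + c')) (x z : ℝ) :
    ∫⁻ y, ENNReal.ofReal (besselKernel ν p c x y) * ENNReal.ofReal (besselKernel ν p' c' y z)
        ∂halfMeasure ν = ENNReal.ofReal (besselKernel ν p₂ c₂ x z) := by
  have h_factor (y : ℝ) : ENNReal.ofReal (besselKernel ν p c x y) *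
      ENNReal.ofReal (besselKernel ν p' c' y z) =
      ENNReal.ofReal (4 * p ^ (ν + 1) * p' ^ (ν + 1) * Real.exp (-c * x ^ 2 + -c' * z ^ 2)) *
        ENNReal.ofReal (besselSeries ν ((p * x) ^ 2 * y ^ 2) *
          besselSeries ν ((p' * z) ^ 2 * y ^ 2) * Real.exp (-(c + c') * y ^ 2)) := by
    rw [← ENNReal.ofReal_mul (besselKernel_nonneg hν hp x y), ← ENNReal.ofReal_mul (by positivity),
      besselKernel, besselKernel, mul_right_comm p' y z, mul_pow _ y, mul_pow _ y]
    congr 1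
    have h_exp : Real.exp (-c * (x ^ 2 + y ^ 2)) * Real.exp (-c' * (y ^ 2 + z ^ 2)) =
        Real.exp (-c * x ^ 2 + -c' * z ^ 2) * Real.exp (-(c + c') * y ^ 2) := by
      rw [← Real.exp_add, ← Real.exp_add]
      ring_nf
    linear_combination 4 * p ^ (ν + 1) * p' ^ (ν + 1) * besselSeries ν ((p * x) ^ 2 * y ^ 2) *
      besselSeries ν ((p' * z) ^ 2 * y ^ 2) * h_exp
  simp only [h_factor]
  rw [lintegral_const_mul' _ _ ENNReal.ofReal_ne_top, lintegral_besselSeries_mul_besselSeries hν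
    (sq_nonneg _) (sq_nonneg _) hb, ← ENNReal.ofReal_mul (by positivity)]
  have h_exp : Real.exp (-c₂ * (x ^ 2 + z ^ 2)) = Real.exp (-c * x ^ 2 + -c' * z ^ 2) *
      Real.exp ((p * x) ^ 2 / (c + c') + (p' * z) ^ 2 / (c + c')) := by
    rw [← Real.exp_add, mul_add]
    nth_rw 1 [hc₂]
    rw [hc₂']
    ring_nf
  have h_arg : (p₂ * x * z) ^ 2 = (p * x) ^ 2 / (c + c') * ((p' * z) ^ 2 / (c + c')) := by
    rw [hp₂]
    ring
  rw [besselKernel, h_exp, h_arg, hp₂, Real.div_rpow (by positivity) hb.le,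
    Real.mul_rpow hp.le hp'.le, Real.rpow_neg hb.le]
  ring_nf

/-- The one-dimensional factor of the heat kernel `G_t` with respect to `halfMeasure ν`. -/
noncomputable def halfKernel (ν t : ℝ) : ℝ → ℝ → ℝ :=
  besselKernel ν (1 / (2 * Real.sinh (2 * t))) (Real.cosh (2 * t) / (2 * Real.sinh (2 * t)))

variable {t : ℝ}

theorem sinh_two_mul_pos (ht : 0 < t) : 0 < Real.sinh (2 * t) :=
  Real.sinh_pos_iff.2 (by linarith)

theorem halfKernel_symm (ν t x y : ℝ) : halfKernel ν t x y = halfKernel ν t y x :=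
  besselKernel_symm ..

theorem halfKernel_nonneg (hν : -1 < ν) (ht : 0 < t) (x y : ℝ) : 0 ≤ halfKernel ν t x y :=
  besselKernel_nonneg hν (by have := sinh_two_mul_pos ht; positivity) x y

theorem measurable_halfKernel (hν : -1 < ν) (t : ℝ) :
    Measurable (Function.uncurry (halfKernel ν t)) :=
  measurable_besselKernel hν _ _

theorem exists_mul_halfKernel_le (hν : -1 < ν) (ht : 0 < t) (x : ℝ) :
    ∃ M, ∀ y, (1 + |y|) * halfKernel ν t x y ≤ M := by
  have := sinh_two_mul_pos ht
  have := Real.cosh_pos (2 * t)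
  exact exists_mul_besselKernel_le hν (by positivity) (by positivity) x

theorem lintegral_halfKernel_mul_exp {l : ℝ} (hν : -1 < ν) (ht : 0 < t) (hl : 0 ≤ l) (x : ℝ) :
    ∫⁻ y, ENNReal.ofReal (halfKernel ν t x y * Real.exp (-l * y ^ 2)) ∂halfMeasure ν =
      ENNReal.ofReal ((Real.cosh (2 * t) + 2 * l * Real.sinh (2 * t)) ^ (-(ν + 1)) *
        Real.exp (-(1 / 2) * x ^ 2 * ((Real.sinh (2 * t) + 2 * l * Real.cosh (2 * t)) /
          (Real.cosh (2 * t) + 2 * l * Real.sinh (2 * t))))) := by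
  have hS := sinh_two_mul_pos ht
  have hC := Real.cosh_pos (2 * t)
  have h_sq := Real.cosh_sq (2 * t)
  rw [halfKernel, lintegral_besselKernel_mul_exp hν (by positivity) (by positivity)]
  set S := Real.sinh (2 * t)
  set C := Real.cosh (2 * t)
  have hD : 0 < C + 2 * l * S := by positivity
  have h_base : 1 / (2 * S) / (C / (2 * S) + l) = (C + 2 * l * S)⁻¹ := by
    field_simp
  have h_exp : -(C / (2 * S) - (1 / (2 * S)) ^ 2 / (C / (2 * S) + l)) * x ^ 2 =
      -(1 / 2) * x ^ 2 * ((S + 2 * l * C) / (C + 2 * l * S)) := by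
    field_simp
    linear_combination -x ^ 2 * h_sq
  rw [h_base, h_exp, Real.inv_rpow hD.le, Real.rpow_neg hD.le]

theorem lintegral_halfKernel (hν : -1 < ν) (ht : 0 < t) (x : ℝ) :
    ∫⁻ y, ENNReal.ofReal (halfKernel ν t x y) ∂halfMeasure ν =
      ENNReal.ofReal (Real.cosh (2 * t) ^ (-(ν + 1)) *
        Real.exp (-(1 / 2) * x ^ 2 * (Real.sinh (2 * t) / Real.cosh (2 * t)))) := by
  simpa only [neg_zero, zero_mul, Real.exp_zero, mul_one, mul_zero, add_zero] using
    lintegral_halfKernel_mul_exp hν ht le_rfl x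

theorem lintegral_halfKernel_mul_halfKernel {s : ℝ} (hν : -1 < ν) (hs : 0 < s) (ht : 0 < t)
    (x z : ℝ) :
    ∫⁻ y, ENNReal.ofReal (halfKernel ν s x y) * ENNReal.ofReal (halfKernel ν t y z)
      ∂halfMeasure ν = ENNReal.ofReal (halfKernel ν (s + t) x z) := by
  have hS := sinh_two_mul_pos hs
  have hT := sinh_two_mul_pos ht
  have hCs := Real.cosh_pos (2 * s)
  have hCt := Real.cosh_pos (2 * t)
  have hs_sq := Real.cosh_sq (2 * s)
  have ht_sq := Real.cosh_sq (2 * t)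
  refine lintegral_besselKernel_mul_besselKernel hν (by positivity) (by positivity) (by positivity)
    ?_ ?_ ?_ x z <;> rw [mul_add] <;> simp only [Real.sinh_add, Real.cosh_add] <;>
    generalize Real.sinh (2 * s) = S at * <;> generalize Real.sinh (2 * t) = T at * <;>
    generalize Real.cosh (2 * s) = Cs at * <;> generalize Real.cosh (2 * t) = Ct at *
  · field_simp
    ring
  · field_simp
    linear_combination -T * (S * Ct + Cs * T) * hs_sq
  · field_simp
    linear_combination -S * (S * Ct + Cs * T) * ht_sq

end HalfLine

/-! ### Gamma distributions and the mass profile -/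

section MassProfile

open ProbabilityTheory

theorem lintegral_rpow_mul_exp_neg_mul {a r : ℝ} (ha : 0 < a) (hr : 0 < r) :
    ∫⁻ w in Set.Ioi 0, ENNReal.ofReal (w ^ (a - 1) * Real.exp (-(r * w))) =
      ENNReal.ofReal ((1 / r) ^ a * Real.Gamma a) := by
  have h_int : IntegrableOn (fun w => w ^ (a - 1) * Real.exp (-(r * w))) (Set.Ioi 0) := by
    simpa only [Real.rpow_one, neg_mul] using
      integrableOn_rpow_mul_exp_neg_mul_rpow (s := a - 1) (by linarith) one_pos hr
  rw [← ofReal_integral_eq_lintegral_ofReal h_int, Real.integral_rpow_mul_exp_neg_mul_Ioi ha hr]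
  filter_upwards [ae_restrict_mem measurableSet_Ioi] with w (hw : 0 < w)
  rw [Pi.zero_apply]
  positivity

theorem gammaMeasure_eq_withDensity (a r : ℝ) :
    gammaMeasure a r = (volume.restrict (Set.Ioi 0)).withDensity fun w =>
      ENNReal.ofReal (r ^ a / Real.Gamma a * (w ^ (a - 1) * Real.exp (-(r * w)))) := by
  have h_indicator : gammaPDF a r = (Set.Ici 0).indicator fun w =>
      ENNReal.ofReal (r ^ a / Real.Gamma a * (w ^ (a - 1) * Real.exp (-(r * w)))) := by
    funext w
    by_cases hw : 0 ≤ w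
    · rw [Set.indicator_of_mem (Set.mem_Ici.2 hw), gammaPDF_of_nonneg hw, mul_assoc]
    · rw [Set.indicator_of_notMem (by simpa using hw), gammaPDF_of_neg (not_le.1 hw)]
  rw [gammaMeasure, h_indicator, withDensity_indicator measurableSet_Ici,
    Measure.restrict_congr_set Ioi_ae_eq_Ici]

theorem lintegral_pow_gammaMeasure {a r : ℝ} (ha : 0 < a) (hr : 0 < r) (k : ℕ) :
    ∫⁻ w, ENNReal.ofReal (w ^ k) ∂gammaMeasure a r =
      ENNReal.ofReal (Real.Gamma (a + k) / (r ^ k * Real.Gamma a)) := by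
  have hG := Real.Gamma_pos_of_pos ha
  have h_integrand : ∀ w ∈ Set.Ioi (0 : ℝ),
      ENNReal.ofReal (r ^ a / Real.Gamma a * (w ^ (a - 1) * Real.exp (-(r * w)))) *
        ENNReal.ofReal (w ^ k) = ENNReal.ofReal (r ^ a / Real.Gamma a) *
          ENNReal.ofReal (w ^ (a + k - 1) * Real.exp (-(r * w))) := by
    intro w (hw : 0 < w)
    rw [← ENNReal.ofReal_mul (by positivity), ← ENNReal.ofReal_mul (by positivity),
      add_sub_right_comm, Real.rpow_add hw, Real.rpow_natCast]
    ring_nf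
  rw [gammaMeasure_eq_withDensity, lintegral_withDensity_eq_lintegral_mul_non_measurable _
      (by fun_prop) (Eventually.of_forall fun _ => ENNReal.ofReal_lt_top)]
  simp only [Pi.mul_apply]
  rw [setLIntegral_congr_fun measurableSet_Ioi h_integrand,
    lintegral_const_mul' _ _ ENNReal.ofReal_ne_top,
    lintegral_rpow_mul_exp_neg_mul (by positivity) hr, ← ENNReal.ofReal_mul (by positivity),
    Real.rpow_add (by positivity), Real.rpow_natCast, one_div, Real.inv_rpow hr.le, inv_pow]
  congr 1
  field_simp

/-- The truncated negative moment `E[(1 - W) ^ (ν - 1/2); W < 1]` of a `Gamma(1/2, u)` variable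
`W`. Up to an elementary factor it is the total mass of the modified kernel, with `u`
proportional to `x ^ 2`. -/
noncomputable def massProfile (ν u : ℝ) : ℝ≥0∞ :=
  ∫⁻ w in Set.Iio 1, ENNReal.ofReal ((1 - w) ^ (ν - 1 / 2)) ∂gammaMeasure (1 / 2) u

theorem massProfile_eq (ν u : ℝ) :
    massProfile ν u = ∫⁻ w in Set.Ioo 0 1,
      ENNReal.ofReal (u ^ (1 / 2 : ℝ) / Real.Gamma (1 / 2) *
        (w ^ (1 / 2 - 1 : ℝ) * Real.exp (-(u * w)))) * ENNReal.ofReal ((1 - w) ^ (ν - 1 / 2)) := by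
  rw [massProfile, gammaMeasure_eq_withDensity,
    setLIntegral_withDensity_eq_setLIntegral_mul_non_measurable _ (by fun_prop) _ measurableSet_Iio
      (Eventually.of_forall fun _ => ENNReal.ofReal_lt_top),
    Measure.restrict_restrict measurableSet_Iio, Set.inter_comm, Set.Ioi_inter_Iio]
  rfl

theorem gammaMeasure_ae_pos (a r : ℝ) : ∀ᵐ w ∂gammaMeasure a r, 0 < w := by
  rw [gammaMeasure_eq_withDensity]
  exact (withDensity_absolutelyContinuous _ _).ae_le (ae_restrict_mem measurableSet_Ioi)

variable {ν u : ℝ}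

theorem massProfile_le_one (hν : 1 / 2 ≤ ν) (hu : 0 < u) : massProfile ν u ≤ 1 := by
  have := isProbabilityMeasure_gammaMeasure one_half_pos hu
  calc massProfile ν u ≤ ∫⁻ _ in Set.Iio 1, 1 ∂gammaMeasure (1 / 2) u := by
        refine lintegral_mono_ae ?_
        filter_upwards [ae_restrict_mem measurableSet_Iio,
          ae_restrict_of_ae (gammaMeasure_ae_pos (1 / 2) u)] with w (hw1 : w < 1) hw0
        exact ENNReal.ofReal_le_one.2
          (Real.rpow_le_one (by linarith) (by linarith) (by linarith))
    _ ≤ 1 := (setLIntegral_le_lintegral _ _).trans_eq (by rw [lintegral_one, measure_univ])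

theorem gammaPDF_one_half_le (hu : 0 < u) {w : ℝ} (hw : 1 / 2 < w) :
    gammaPDF (1 / 2) u w ≤ 2 := by
  have hw0 : 0 < w := one_half_pos.trans hw
  have h_sqrt : √(u * w) * Real.exp (-(u * w)) ≤ 1 := by
    rw [Real.exp_neg, ← div_eq_mul_inv, div_le_one (Real.exp_pos _), Real.sqrt_le_iff]
    exact ⟨(Real.exp_pos _).le, by
      nlinarith [Real.add_one_le_exp (u * w), mul_pos hu hw0, sq_nonneg (Real.exp (u * w))]⟩
  have h_pi : 1 ≤ √Real.pi := Real.one_le_sqrt.2 (by linarith [Real.pi_gt_three])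
  rw [gammaPDF_of_nonneg hw0.le, ENNReal.ofReal_le_ofNat]
  calc u ^ (1 / 2 : ℝ) / Real.Gamma (1 / 2) * w ^ (1 / 2 - 1 : ℝ) * Real.exp (-(u * w))
      = √(u * w) * Real.exp (-(u * w)) / (w * √Real.pi) := by
        rw [Real.Gamma_one_half_eq, Real.rpow_sub_one hw0.ne', ← Real.sqrt_eq_rpow,
          ← Real.sqrt_eq_rpow, Real.sqrt_mul hu.le]
        field_simp
    _ ≤ 1 / (1 / 2 * 1) := by gcongr
    _ = 2 := by norm_num

theorem lintegral_one_sub_rpow_ne_top (hν : -(1 / 2) < ν) :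
    ∫⁻ w in Set.Ioo (1 / 2) 1, ENNReal.ofReal ((1 - w) ^ (ν - 1 / 2)) ≠ ∞ := by
  have h_int : IntervalIntegrable (fun w : ℝ => w ^ (ν - 1 / 2)) volume (1 / 2) 0 :=
    intervalIntegral.intervalIntegrable_rpow' (by linarith)
  have h_refl := h_int.comp_sub_left 1
  rw [sub_zero, sub_half, intervalIntegrable_iff_integrableOn_Ioo_of_le (by norm_num)] at h_refl
  exact h_refl.lintegral_lt_top.ne

theorem exists_massProfile_le (hν : -(1 / 2) < ν) :
    ∃ M : ℝ≥0, ∀ u, 0 < u → massProfile ν u ≤ M := by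
  set J := ∫⁻ w in Set.Ioo (1 / 2) 1, ENNReal.ofReal ((1 - w) ^ (ν - 1 / 2))
  have hJ : J ≠ ∞ := lintegral_one_sub_rpow_ne_top hν
  set A : ℝ := (1 / 2) ^ (-|ν - 1 / 2|)
  refine ⟨A.toNNReal + 2 * J.toNNReal, fun u hu => ?_⟩
  have := isProbabilityMeasure_gammaMeasure one_half_pos hu
  have h_near_zero : ∫⁻ w in Set.Iic (1 / 2), ENNReal.ofReal ((1 - w) ^ (ν - 1 / 2))
      ∂gammaMeasure (1 / 2) u ≤ ENNReal.ofReal A := by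
    calc _ ≤ ∫⁻ _ in Set.Iic (1 / 2), ENNReal.ofReal A ∂gammaMeasure (1 / 2) u := by
          refine lintegral_mono_ae ?_
          filter_upwards [ae_restrict_mem measurableSet_Iic,
            ae_restrict_of_ae (gammaMeasure_ae_pos (1 / 2) u)] with w (hw : w ≤ 1 / 2) hw0
          refine ENNReal.ofReal_le_ofReal ((Real.rpow_le_rpow_of_exponent_ge (by linarith)
            (by linarith) (neg_abs_le _)).trans ?_)
          exact Real.rpow_le_rpow_of_nonpos (by norm_num) (by linarith)
            (neg_nonpos.2 (abs_nonneg _))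
      _ ≤ ENNReal.ofReal A := 
          (setLIntegral_le_lintegral _ _).trans_eq (by rw [lintegral_const, measure_univ, mul_one])
  have h_near_one : ∫⁻ w in Set.Ioo (1 / 2) 1, ENNReal.ofReal ((1 - w) ^ (ν - 1 / 2))
      ∂gammaMeasure (1 / 2) u ≤ 2 * J := by
    rw [gammaMeasure, setLIntegral_withDensity_eq_setLIntegral_mul_non_measurable _
      (f := gammaPDF (1 / 2) u) (measurable_gammaPDFReal _ _).ennreal_ofReal _ measurableSet_Ioo
      (Eventually.of_forall fun _ => ENNReal.ofReal_lt_top),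
      ← lintegral_const_mul' _ _ ENNReal.ofNat_ne_top]
    refine setLIntegral_mono' measurableSet_Ioo fun w hw => ?_
    exact mul_le_mul_left (gammaPDF_one_half_le hu hw.1) _
  calc massProfile ν u ≤ _ + _ := by
        rw [massProfile, ← Set.Iic_union_Ioo_eq_Iio (by norm_num : (1 / 2 : ℝ) < 1)]
        exact lintegral_union_le _ _ _
    _ ≤ ENNReal.ofReal A + 2 * J := add_le_add h_near_zero h_near_one
    _ = _ := by
        rw [ENNReal.coe_add, ENNReal.coe_mul, ENNReal.coe_toNNReal hJ, ENNReal.coe_ofNat]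
        rfl

theorem one_add_mul_le_rpow {δ w : ℝ} (hδ : 0 ≤ δ) (hw : w < 1) :
    1 + δ * w ≤ (1 - w) ^ (-δ) := by
  have hlog := Real.log_le_sub_one_of_pos (x := 1 - w) (by linarith)
  rw [Real.rpow_def_of_pos (by linarith)]
  nlinarith [Real.add_one_le_exp (Real.log (1 - w) * -δ)]

theorem le_massProfile (hν : ν ≤ 1 / 2) (hu : 0 < u) :
    ENNReal.ofReal (1 + (1 / 2 - ν) / (2 * u) - 3 * (1 + (1 / 2 - ν)) / (4 * u ^ 2)) ≤
      massProfile ν u := by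
  have := isProbabilityMeasure_gammaMeasure one_half_pos hu
  set δ := 1 / 2 - ν with hδ
  have hδ0 : 0 ≤ δ := sub_nonneg.2 hν
  have h_pointwise : ∀ᵐ w ∂gammaMeasure (1 / 2) u,
      1 + ENNReal.ofReal δ * ENNReal.ofReal (w ^ 1) ≤
        (Set.Iio 1).indicator (fun w => ENNReal.ofReal ((1 - w) ^ (ν - 1 / 2))) w +
          ENNReal.ofReal (1 + δ) * ENNReal.ofReal (w ^ 2) := by
    filter_upwards [gammaMeasure_ae_pos (1 / 2) u] with w hw
    rw [← ENNReal.ofReal_one, ← ENNReal.ofReal_mul hδ0, ← ENNReal.ofReal_mul (by positivity),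
      ← ENNReal.ofReal_add one_pos.le (by positivity), pow_one]
    rcases lt_or_ge w 1 with hw1 | hw1
    · rw [Set.indicator_of_mem (Set.mem_Iio.2 hw1), ← neg_sub (1 / 2) ν, ← hδ]
      exact (ENNReal.ofReal_le_ofReal (one_add_mul_le_rpow hδ0 hw1)).trans le_self_add
    · refine (ENNReal.ofReal_le_ofReal ?_).trans le_add_self
      nlinarith [mul_nonneg hδ0 (sub_nonneg.2 hw1)]
  have h_moment_one :
      Real.Gamma (1 / 2 + (1 : ℕ)) / (u ^ 1 * Real.Gamma (1 / 2)) = 1 / (2 * u) := by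
    have hG := (Real.Gamma_pos_of_pos one_half_pos).ne'
    rw [Nat.cast_one, Real.Gamma_add_one one_half_pos.ne']
    field_simp
  have h_moment_two :
      Real.Gamma (1 / 2 + (2 : ℕ)) / (u ^ 2 * Real.Gamma (1 / 2)) = 3 / (4 * u ^ 2) := by
    have hG := (Real.Gamma_pos_of_pos one_half_pos).ne'
    have h_shift : (1 / 2 + (2 : ℕ) : ℝ) = 1 / 2 + 1 + 1 := by norm_num
    rw [h_shift, Real.Gamma_add_one (by norm_num), Real.Gamma_add_one one_half_pos.ne']
    field_simp
    norm_num
  have h_integral := lintegral_mono_ae h_pointwise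
  rw [lintegral_add_left measurable_const, lintegral_const_mul _ (by fun_prop),
    lintegral_add_right _ (by fun_prop), lintegral_const_mul _ (by fun_prop), lintegral_one,
    measure_univ, lintegral_indicator measurableSet_Iio, ← massProfile,
    lintegral_pow_gammaMeasure one_half_pos hu, lintegral_pow_gammaMeasure one_half_pos hu,
    h_moment_one, h_moment_two, ← ENNReal.ofReal_mul hδ0, ← ENNReal.ofReal_mul (by positivity),
    ← ENNReal.ofReal_one, ← ENNReal.ofReal_add one_pos.le (by positivity)] at h_integral
  rw [ENNReal.ofReal_sub _ (by positivity), tsub_le_iff_right]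
  convert h_integral using 2 <;> ring_nf

theorem exists_lt_massProfile (hν : ν < 1 / 2) :
    ∃ u₀ η : ℝ, 0 < u₀ ∧ 0 < η ∧ ∀ u, u₀ ≤ u → u ≤ 2 * u₀ →
      ENNReal.ofReal (1 + η) ≤ massProfile ν u := by
  set δ := 1 / 2 - ν with hδ
  have hδ0 : 0 < δ := sub_pos.2 hν
  obtain ⟨u₀, hu₀⟩ : ∃ u₀, u₀ = 3 * (1 + δ) / δ := ⟨_, rfl⟩
  have hu₀_pos : 0 < u₀ := by rw [hu₀]; positivity
  refine ⟨u₀, δ / (8 * u₀), hu₀_pos, by positivity, fun u h_le h_ge => ?_⟩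
  have hu : 0 < u := hu₀_pos.trans_le h_le
  refine le_trans (ENNReal.ofReal_le_ofReal ?_) (le_massProfile hν.le hu)
  have h_const : 3 * (1 + δ) = δ * u₀ := by rw [hu₀]; field_simp
  have h_quadratic : δ * u₀ / (4 * u ^ 2) ≤ δ / (4 * u) :=
    calc δ * u₀ / (4 * u ^ 2) ≤ δ * u / (4 * u ^ 2) := by gcongr
      _ = δ / (4 * u) := by field_simp
  have h_linear : δ / (8 * u₀) ≤ δ / (2 * u) - δ / (4 * u) :=
    calc δ / (8 * u₀) ≤ δ / (4 * u) :=
        div_le_div_of_nonneg_left hδ0.le (by positivity) (by linarith)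
      _ = δ / (2 * u) - δ / (4 * u) := by field_simp; norm_num
  rw [← hδ, h_const]
  linarith

end MassProfile

section Modified

variable {a ν t : ℝ}

theorem halfMeasure_add_one (a : ℝ) :
    halfMeasure (a + 1) = (halfMeasure a).withDensity fun y => ENNReal.ofReal (y ^ 2) := by
  rw [halfMeasure, halfMeasure, ← withDensity_mul _ (by fun_prop) (by fun_prop)]
  refine withDensity_congr_ae ?_
  filter_upwards [ae_restrict_mem measurableSet_Ioi] with y (hy : 0 < y)
  rw [Pi.mul_apply, ← ENNReal.ofReal_mul (by positivity), ← Real.rpow_two, ← Real.rpow_add hy]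
  ring_nf

theorem lintegral_halfMeasure_add_one (a : ℝ) (f : ℝ → ℝ≥0∞) :
    ∫⁻ y, f y ∂halfMeasure (a + 1) = ∫⁻ y, ENNReal.ofReal (y ^ 2) * f y ∂halfMeasure a := by
  rw [halfMeasure_add_one]
  exact lintegral_withDensity_eq_lintegral_mul_non_measurable _ (by fun_prop)
    (Eventually.of_forall fun _ => ENNReal.ofReal_lt_top) f

/-- The factor of the modified kernel in the distinguished coordinate, on the half-line with the
measure `halfMeasure a`: the heat kernel of order `a + 1` multiplied by `x * y`. The absolute value
makes it nonnegative for all real `x` and `y`. -/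
noncomputable def modHalfKernel (a t x y : ℝ) : ℝ :=
  |x * y| * halfKernel (a + 1) t x y

theorem modHalfKernel_symm (a t x y : ℝ) : modHalfKernel a t x y = modHalfKernel a t y x := by
  rw [modHalfKernel, modHalfKernel, mul_comm x, halfKernel_symm]

theorem modHalfKernel_nonneg (ha : -2 < a) (ht : 0 < t) (x y : ℝ) : 0 ≤ modHalfKernel a t x y :=
  mul_nonneg (abs_nonneg _) (halfKernel_nonneg (by linarith) ht x y)

theorem lintegral_modHalfKernel_mul_modHalfKernel {s : ℝ} (ha : -2 < a) (hs : 0 < s) (ht : 0 < t)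
    (x z : ℝ) :
    ∫⁻ y, ENNReal.ofReal (modHalfKernel a s x y) * ENNReal.ofReal (modHalfKernel a t y z)
      ∂halfMeasure a = ENNReal.ofReal (modHalfKernel a (s + t) x z) := by
  have hν : -1 < a + 1 := by linarith
  rw [modHalfKernel, ENNReal.ofReal_mul (abs_nonneg _),
    ← lintegral_halfKernel_mul_halfKernel hν hs ht, lintegral_halfMeasure_add_one,
    ← lintegral_const_mul' _ _ ENNReal.ofReal_ne_top]
  refine lintegral_congr fun y => ?_
  have h_abs : |x * y| * |y * z| = |x * z| * y ^ 2 := by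
    rw [← sq_abs y, abs_mul, abs_mul, abs_mul]
    ring
  simp only [modHalfKernel, ENNReal.ofReal_mul (abs_nonneg _)]
  rw [mul_mul_mul_comm, ← ENNReal.ofReal_mul (abs_nonneg _), h_abs,
    ENNReal.ofReal_mul (abs_nonneg _), mul_assoc]

theorem lintegral_modHalfKernel_eq_mul (a t x : ℝ) :
    ∫⁻ y, ENNReal.ofReal (modHalfKernel a t x y) ∂halfMeasure a =
      ENNReal.ofReal |x| *
        ∫⁻ y, ENNReal.ofReal (halfKernel (a + 1) t x y) * ENNReal.ofReal y⁻¹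
          ∂halfMeasure (a + 1) := by
  rw [lintegral_halfMeasure_add_one, ← lintegral_const_mul' _ _ ENNReal.ofReal_ne_top]
  refine lintegral_congr_ae ?_
  filter_upwards [halfMeasure_ae_pos a] with y hy
  have h_sq : y = y ^ 2 * y⁻¹ := by field_simp
  calc ENNReal.ofReal (modHalfKernel a t x y)
      = ENNReal.ofReal |x| *
          (ENNReal.ofReal (y ^ 2 * y⁻¹) * ENNReal.ofReal (halfKernel (a + 1) t x y)) := by
        rw [← h_sq, modHalfKernel, abs_mul, abs_of_pos hy, ENNReal.ofReal_mul (by positivity),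
          ENNReal.ofReal_mul (abs_nonneg x), mul_assoc]
    _ = _ := by rw [ENNReal.ofReal_mul (sq_nonneg y)]; ring

theorem ofReal_inv_eq_lintegral {y : ℝ} (hy : 0 < y) :
    ENNReal.ofReal y⁻¹ = ∫⁻ l in Set.Ioi (0 : ℝ),
      ENNReal.ofReal ((√Real.pi)⁻¹ * l ^ (-(1 / 2) : ℝ)) *
        ENNReal.ofReal (Real.exp (-l * y ^ 2)) := by
  have h_gamma := lintegral_rpow_mul_exp_neg_mul one_half_pos (pow_pos hy 2)
  have h_integrand : ∀ l ∈ Set.Ioi (0 : ℝ), ENNReal.ofReal ((√Real.pi)⁻¹ * l ^ (-(1 / 2) : ℝ)) *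
      ENNReal.ofReal (Real.exp (-l * y ^ 2)) = ENNReal.ofReal (√Real.pi)⁻¹ *
        ENNReal.ofReal (l ^ (1 / 2 - 1 : ℝ) * Real.exp (-(y ^ 2 * l))) := by
    intro l (hl : 0 < l)
    rw [← ENNReal.ofReal_mul (by positivity), ← ENNReal.ofReal_mul (by positivity)]
    ring_nf
  rw [setLIntegral_congr_fun measurableSet_Ioi h_integrand,
    lintegral_const_mul' _ _ ENNReal.ofReal_ne_top, h_gamma,
    ← ENNReal.ofReal_mul (by positivity), Real.Gamma_one_half_eq, ← Real.sqrt_eq_rpow, one_div,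
    ← inv_pow, Real.sqrt_sq (by positivity)]
  congr 1
  field_simp

theorem lintegral_halfKernel_mul_inv (hν : -1 < ν) (ht : 0 < t) (x : ℝ) :
    ∫⁻ y, ENNReal.ofReal (halfKernel ν t x y) * ENNReal.ofReal y⁻¹ ∂halfMeasure ν =
      ∫⁻ l in Set.Ioi (0 : ℝ), ENNReal.ofReal ((√Real.pi)⁻¹ * l ^ (-(1 / 2) : ℝ) *
        ((Real.cosh (2 * t) + 2 * l * Real.sinh (2 * t)) ^ (-(ν + 1)) *
          Real.exp (-(1 / 2) * x ^ 2 * ((Real.sinh (2 * t) + 2 * l * Real.cosh (2 * t)) /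
            (Real.cosh (2 * t) + 2 * l * Real.sinh (2 * t)))))) := by
  have h_meas : Measurable fun y => ENNReal.ofReal (halfKernel ν t x y) :=
    ((measurable_halfKernel hν t).comp measurable_prodMk_left).ennreal_ofReal
  have h_inv : ∀ᵐ y ∂halfMeasure ν, ENNReal.ofReal (halfKernel ν t x y) * ENNReal.ofReal y⁻¹ =
      ∫⁻ l in Set.Ioi (0 : ℝ), ENNReal.ofReal (halfKernel ν t x y) *
        (ENNReal.ofReal ((√Real.pi)⁻¹ * l ^ (-(1 / 2) : ℝ)) *
          ENNReal.ofReal (Real.exp (-l * y ^ 2))) := by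
    filter_upwards [halfMeasure_ae_pos ν] with y hy
    rw [ofReal_inv_eq_lintegral hy, lintegral_const_mul' _ _ ENNReal.ofReal_ne_top]
  rw [lintegral_congr_ae h_inv, lintegral_lintegral_swap
    ((h_meas.comp measurable_fst).mul (by fun_prop)).aemeasurable]
  refine setLIntegral_congr_fun measurableSet_Ioi fun l (hl : 0 < l) => ?_
  rw [ENNReal.ofReal_mul (p := (√Real.pi)⁻¹ * l ^ (-(1 / 2) : ℝ)) (by positivity),
    ← lintegral_halfKernel_mul_exp hν ht hl.le, ← lintegral_const_mul' _ _ ENNReal.ofReal_ne_top]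
  refine lintegral_congr fun y => ?_
  rw [ENNReal.ofReal_mul (halfKernel_nonneg hν ht x y)]
  ring

theorem image_mul_div_one_sub {c : ℝ} (hc : 0 < c) :
    (fun w : ℝ => c * (w / (1 - w))) '' Set.Ioo 0 1 = Set.Ioi 0 := by
  refine Set.Subset.antisymm ?_ fun l (hl : 0 < l) => ?_
  · rintro _ ⟨w, ⟨hw0, hw1⟩, rfl⟩
    exact mul_pos hc (div_pos hw0 (sub_pos.2 hw1))
  · refine ⟨l / (c + l), ⟨by positivity, (div_lt_one (by positivity)).2 (by linarith)⟩, ?_⟩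
    have h_one_sub : 1 - l / (c + l) = c / (c + l) := by field_simp; ring
    simp only [h_one_sub]
    field_simp

theorem lintegral_Ioi_eq_lintegral_Ioo {c : ℝ} (hc : 0 < c) (f : ℝ → ℝ≥0∞) :
    ∫⁻ l in Set.Ioi 0, f l =
      ∫⁻ w in Set.Ioo 0 1, ENNReal.ofReal (c / (1 - w) ^ 2) * f (c * (w / (1 - w))) := by
  have h_inj : Set.InjOn (fun w : ℝ => c * (w / (1 - w))) (Set.Ioo 0 1) := by
    intro w hw w' hw' h_eq
    have h_cross := mul_left_cancel₀ hc.ne' h_eq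
    rw [div_eq_div_iff (sub_pos.2 hw.2).ne' (sub_pos.2 hw'.2).ne'] at h_cross
    linarith
  have h_deriv : ∀ w ∈ Set.Ioo (0 : ℝ) 1, HasDerivWithinAt (fun w : ℝ => c * (w / (1 - w)))
      (c / (1 - w) ^ 2) (Set.Ioo 0 1) w := by
    intro w hw
    have h := ((hasDerivAt_id w).div ((hasDerivAt_id w).const_sub 1)
      (sub_pos.2 hw.2).ne').const_mul c
    refine (h.congr_deriv ?_).hasDerivWithinAt
    simp only [id]
    ring
  rw [← image_mul_div_one_sub hc,
    lintegral_image_eq_lintegral_abs_deriv_mul measurableSet_Ioo h_deriv h_inj]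
  refine setLIntegral_congr_fun measurableSet_Ioo fun w _ => ?_
  simp only [abs_of_nonneg (div_nonneg hc.le (sq_nonneg (1 - w)))]

theorem abs_mul_sqrt_eq_sqrt {S C : ℝ} (hS : 0 < S) (hC : 0 < C) (x : ℝ) :
    |x| * √(C / (2 * S)) * C⁻¹ = √(x ^ 2 / (2 * S * C)) := by
  rw [eq_comm, Real.sqrt_eq_iff_mul_self_eq (by positivity) (by positivity)]
  calc x ^ 2 / (2 * S * C) = |x| ^ 2 * (√(C / (2 * S)) * √(C / (2 * S))) * C⁻¹ ^ 2 := by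
        rw [sq_abs, Real.mul_self_sqrt (by positivity)]
        field_simp
    _ = |x| * √(C / (2 * S)) * C⁻¹ * (|x| * √(C / (2 * S)) * C⁻¹) := by ring

theorem mass_integrand_eq {S C x w : ℝ} (ν : ℝ) (hS : 0 < S) (hC : 0 < C) (hCS : C ^ 2 = S ^ 2 + 1)
    (hw : w ∈ Set.Ioo 0 1) {l u : ℝ} (hl : l = C / (2 * S) * (w / (1 - w)))
    (hu : u = x ^ 2 / (2 * S * C)) :
    |x| * (C / (2 * S) / (1 - w) ^ 2 * ((√Real.pi)⁻¹ * l ^ (-(1 / 2) : ℝ) *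
      ((C + 2 * l * S) ^ (-(ν + 1)) *
        Real.exp (-(1 / 2) * x ^ 2 * ((S + 2 * l * C) / (C + 2 * l * S)))))) =
    C ^ (-ν) * Real.exp (-(S ^ 2 * u)) * (u ^ (1 / 2 : ℝ) / Real.Gamma (1 / 2) *
      (w ^ (1 / 2 - 1 : ℝ) * Real.exp (-(u * w))) * (1 - w) ^ (ν - 1 / 2)) := by
  obtain ⟨hw0, hw1⟩ := hw
  replace hw1 : 0 < 1 - w := sub_pos.2 hw1
  set c := C / (2 * S) with hc
  have hc0 : 0 < c := by positivity
  have h_denom : C + 2 * l * S = C / (1 - w) := by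
    rw [hl, hc]
    field_simp
    ring
  have h_exp : Real.exp (-(1 / 2) * x ^ 2 * ((S + 2 * l * C) / (C / (1 - w)))) =
      Real.exp (-(S ^ 2 * u)) * Real.exp (-(u * w)) := by
    rw [← Real.exp_add, hu, hl, hc]
    congr 1
    field_simp
    linear_combination (-x ^ 2 * w) * hCS
  have h_l : l ^ (-(1 / 2) : ℝ) =
      c ^ (-(1 / 2) : ℝ) * (w ^ (1 / 2 - 1 : ℝ) * (1 - w) ^ (1 / 2 : ℝ)) := by
    rw [hl, Real.mul_rpow (by positivity) (by positivity), Real.div_rpow hw0.le hw1.le,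
      Real.rpow_neg hw1.le, div_inv_eq_mul]
    norm_num
  have h_denom_pow : (C / (1 - w)) ^ (-(ν + 1)) = C ^ (-ν) * C⁻¹ * (1 - w) ^ (ν + 1) := by
    rw [Real.div_rpow hC.le hw1.le, Real.rpow_neg hw1.le, div_inv_eq_mul, neg_add,
      Real.rpow_add hC, Real.rpow_neg_one]
  have h_pow : (1 - w) ^ (1 / 2 : ℝ) * (1 - w) ^ (ν + 1) = (1 - w) ^ (ν - 1 / 2) * (1 - w) ^ 2 := by
    rw [← Real.rpow_add hw1, ← Real.rpow_two, ← Real.rpow_add hw1]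
    ring_nf
  have h_sqrt : c * c ^ (-(1 / 2) : ℝ) = √c := by
    rw [Real.sqrt_eq_rpow, mul_comm, ← Real.rpow_add_one hc0.ne']
    norm_num
  rw [h_denom, h_exp, h_l, h_denom_pow, Real.Gamma_one_half_eq, ← Real.sqrt_eq_rpow u, hu,
    ← abs_mul_sqrt_eq_sqrt hS hC, ← hu, ← hc, ← h_sqrt]
  calc _ = |x| * (c * c ^ (-(1 / 2) : ℝ)) * C⁻¹ * (√Real.pi)⁻¹ *
        (C ^ (-ν) * Real.exp (-(S ^ 2 * u))) * (w ^ (1 / 2 - 1 : ℝ) * Real.exp (-(u * w))) *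
        ((1 - w) ^ (1 / 2 : ℝ) * (1 - w) ^ (ν + 1) / (1 - w) ^ 2) := by ring
    _ = _ := by
      rw [h_pow]
      field_simp

theorem lintegral_modHalfKernel (ha : -2 < a) (ht : 0 < t) (x : ℝ) :
    ∫⁻ y, ENNReal.ofReal (modHalfKernel a t x y) ∂halfMeasure a =
      ENNReal.ofReal (Real.cosh (2 * t) ^ (-(a + 1)) * Real.exp (-(Real.sinh (2 * t) ^ 2 *
        (x ^ 2 / (2 * Real.sinh (2 * t) * Real.cosh (2 * t)))))) *
      massProfile (a + 1) (x ^ 2 / (2 * Real.sinh (2 * t) * Real.cosh (2 * t))) := by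
  have hS := sinh_two_mul_pos ht
  have hC : 0 < Real.cosh (2 * t) := Real.cosh_pos _
  have hc : 0 < Real.cosh (2 * t) / (2 * Real.sinh (2 * t)) := by positivity
  rw [lintegral_modHalfKernel_eq_mul, lintegral_halfKernel_mul_inv (by linarith) ht,
    lintegral_Ioi_eq_lintegral_Ioo hc, massProfile_eq,
    ← lintegral_const_mul' _ _ ENNReal.ofReal_ne_top,
    ← lintegral_const_mul' _ _ ENNReal.ofReal_ne_top]
  refine setLIntegral_congr_fun measurableSet_Ioo fun w hw => ?_
  have hw0 : 0 < w := hw.1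
  rw [← ENNReal.ofReal_mul (div_nonneg hc.le (sq_nonneg _)), ← ENNReal.ofReal_mul (abs_nonneg _),
    mass_integrand_eq (a + 1) hS hC (Real.cosh_sq _) hw rfl rfl, ENNReal.ofReal_mul (by positivity),
    ENNReal.ofReal_mul (q := (1 - w) ^ (a + 1 - 1 / 2)) (by positivity)]

end Modified

/-! ### Tensor products of kernels -/

section Product

variable {ι : Type*} [Fintype ι] {X : ι → Type*}

/-- The tensor product of the kernels `k i`, which is the integral kernel of the tensor product
of the corresponding operators. -/
def prodKernel (k : ∀ i, X i → X i → ℝ) (x y : ∀ i, X i) : ℝ :=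
  ∏ i, k i (x i) (y i)

variable {k k' k'' : ∀ i, X i → X i → ℝ}

theorem ofReal_prodKernel (hk : ∀ i x y, 0 ≤ k i x y) (x y : ∀ i, X i) :
    ENNReal.ofReal (prodKernel k x y) = ∏ i, ENNReal.ofReal (k i (x i) (y i)) :=
  ENNReal.ofReal_prod_of_nonneg fun i _ => hk i _ _

variable [∀ i, MeasurableSpace (X i)] {μ : ∀ i, Measure (X i)} [∀ i, SigmaFinite (μ i)]

theorem lintegral_pi_prod {f : ∀ i, X i → ℝ≥0∞} (hf : ∀ i, Measurable (f i)) :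
    ∫⁻ x, ∏ i, f i (x i) ∂Measure.pi μ = ∏ i, ∫⁻ y, f i y ∂μ i := by
  classical
  have h_meas (s : Finset ι) : Measurable fun x : ∀ i, X i => ∏ i ∈ s, f i (x i) :=
    Finset.measurable_prod s fun i _ => (hf i).comp (measurable_pi_apply i)
  have h_marginal (s : Finset ι) : (∫⋯∫⁻_s, fun x => ∏ i ∈ s, f i (x i) ∂μ) =
      fun _ => ∏ i ∈ s, ∫⁻ y, f i y ∂μ i := by
    induction s using Finset.induction_on with
    | empty => simp
    | insert i s hi ih =>
      have h_inner (x : ∀ i, X i) : ∫⁻ y, ∏ k ∈ insert i s, f k (Function.update x i y k) ∂μ i =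
          (∫⁻ y, f i y ∂μ i) * ∏ k ∈ s, f k (x k) := by
        rw [← lintegral_mul_const _ (hf i)]
        refine lintegral_congr fun y => ?_
        rw [Finset.prod_insert hi, Function.update_self]
        congr 1
        refine Finset.prod_congr rfl fun k hk => ?_
        rw [Function.update_of_ne (ne_of_mem_of_not_mem hk hi)]
      rw [lmarginal_insert' _ (h_meas _) hi]
      funext x
      rw [Finset.prod_insert hi, ← congrFun ih x]
      simp only [h_inner, lmarginal]
      exact lintegral_const_mul _ ((h_meas s).comp measurable_updateFinset)
  by_cases h_ne : Nonempty (∀ i, X i)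
  · obtain ⟨x⟩ := h_ne
    rw [lintegral_eq_lmarginal_univ x, h_marginal]
  · rw [not_nonempty_iff] at h_ne
    obtain ⟨i, hi⟩ := isEmpty_pi.1 h_ne
    rw [lintegral_of_isEmpty, Finset.prod_eq_zero (Finset.mem_univ i) (lintegral_of_isEmpty _ _)]

theorem pi_withDensity {f : ∀ i, X i → ℝ≥0∞} (hf : ∀ i, Measurable (f i))
    [∀ i, SigmaFinite ((μ i).withDensity (f i))] :
    Measure.pi (fun i => (μ i).withDensity (f i)) =
      (Measure.pi μ).withDensity fun x => ∏ i, f i (x i) := by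
  refine Measure.pi_eq fun s hs => ?_
  have h_indicator (x : ∀ i, X i) : (Set.univ.pi s).indicator (fun x => ∏ i, f i (x i)) x =
      ∏ i, (s i).indicator (f i) (x i) := by
    by_cases hx : x ∈ Set.univ.pi s
    · rw [Set.indicator_of_mem hx]
      exact Finset.prod_congr rfl fun i _ => (Set.indicator_of_mem (hx i trivial) _).symm
    · rw [Set.indicator_of_notMem hx]
      obtain ⟨i, hi⟩ : ∃ i, x i ∉ s i := by simpa using hx
      exact (Finset.prod_eq_zero (Finset.mem_univ i) (Set.indicator_of_notMem hi _)).symm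
  rw [withDensity_apply _ (MeasurableSet.univ_pi hs),
    ← lintegral_indicator (MeasurableSet.univ_pi hs)]
  simp only [h_indicator]
  rw [lintegral_pi_prod fun i => (hf i).indicator (hs i)]
  refine Finset.prod_congr rfl fun i _ => ?_
  rw [lintegral_indicator (hs i), withDensity_apply _ (hs i)]

theorem measurable_prodKernel (hk : ∀ i, Measurable (Function.uncurry (k i))) :
    Measurable (Function.uncurry (prodKernel k)) :=
  Finset.measurable_prod Finset.univ fun i _ => (hk i).comp
    (f := fun z : (∀ i, X i) × (∀ i, X i) => (z.1 i, z.2 i)) (by fun_prop)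

theorem lintegral_prodKernel (hk : ∀ i, Measurable (Function.uncurry (k i)))
    (hk0 : ∀ i x y, 0 ≤ k i x y) (x : ∀ i, X i) :
    ∫⁻ y, ENNReal.ofReal (prodKernel k x y) ∂Measure.pi μ =
      ∏ i, ∫⁻ y, ENNReal.ofReal (k i (x i) y) ∂μ i := by
  simp only [ofReal_prodKernel hk0]
  exact lintegral_pi_prod fun i => ((hk i).comp measurable_prodMk_left).ennreal_ofReal

theorem IsSymmKernel.pi {C : ι → ℝ≥0} (hk : ∀ i, IsSymmKernel (μ i) (k i) (C i)) :
    IsSymmKernel (Measure.pi μ) (prodKernel k) (∏ i, C i) where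
  measurable := measurable_prodKernel fun i => (hk i).measurable
  nonneg x y := Finset.prod_nonneg fun i _ => (hk i).nonneg _ _
  symm x y := Finset.prod_congr rfl fun i _ => (hk i).symm _ _
  bounded x := by
    choose M hM using fun i => (hk i).bounded (x i)
    exact ⟨∏ i, M i, fun y => Finset.prod_le_prod (fun i _ => (hk i).nonneg _ _) fun i _ => hM i _⟩
  lintegral_le x := by
    rw [lintegral_prodKernel (fun i => (hk i).measurable) fun i => (hk i).nonneg]
    push_cast
    exact Finset.prod_le_prod' fun i _ => (hk i).lintegral_le _

theorem lintegral_prodKernel_mul_prodKernel (hk : ∀ i, Measurable (Function.uncurry (k i)))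
    (hk' : ∀ i, Measurable (Function.uncurry (k' i))) (hk0 : ∀ i x y, 0 ≤ k i x y)
    (hk'0 : ∀ i x y, 0 ≤ k' i x y) (hk''0 : ∀ i x y, 0 ≤ k'' i x y)
    (h : ∀ i x z, ∫⁻ y, ENNReal.ofReal (k i x y) * ENNReal.ofReal (k' i y z) ∂μ i =
      ENNReal.ofReal (k'' i x z)) (x z : ∀ i, X i) :
    ∫⁻ y, ENNReal.ofReal (prodKernel k x y) * ENNReal.ofReal (prodKernel k' y z) ∂Measure.pi μ =
      ENNReal.ofReal (prodKernel k'' x z) := by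
  simp only [ofReal_prodKernel hk0, ofReal_prodKernel hk'0, ofReal_prodKernel hk''0,
    ← Finset.prod_mul_distrib, ← h]
  exact lintegral_pi_prod fun i => ((hk i).comp measurable_prodMk_left).ennreal_ofReal.mul
    ((hk' i).comp measurable_prodMk_right).ennreal_ofReal

end Product

/-! ### The modified Laguerre kernel as a tensor product -/

section ModifiedLaguerre

theorem isSymmKernel_halfKernel {ν t : ℝ} (hν : -1 < ν) (ht : 0 < t) :
    IsSymmKernel (halfMeasure ν) (halfKernel ν t) (Real.cosh (2 * t) ^ (-(ν + 1))).toNNReal where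
  measurable := measurable_halfKernel hν t
  nonneg := halfKernel_nonneg hν ht
  symm := halfKernel_symm ν t
  bounded x := by
    obtain ⟨M, hM⟩ := exists_mul_halfKernel_le hν ht x
    refine ⟨M, fun y => le_trans ?_ (hM y)⟩
    exact le_mul_of_one_le_left (halfKernel_nonneg hν ht x y) (by linarith [abs_nonneg y])
  lintegral_le x := by
    rw [lintegral_halfKernel hν ht]
    refine ENNReal.ofReal_le_ofReal (mul_le_of_le_one_right (by positivity) ?_)
    rw [Real.exp_le_one_iff, neg_mul, neg_mul, neg_nonpos]
    positivity

theorem measurable_modHalfKernel {a : ℝ} (ha : -2 < a) (t : ℝ) :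
    Measurable (Function.uncurry (modHalfKernel a t)) :=
  (measurable_fst.mul measurable_snd).norm.mul (measurable_halfKernel (by linarith) t)

theorem lintegral_modHalfKernel_le {a t : ℝ} (ha : -2 < a) (ht : 0 < t) {M : ℝ≥0}
    (hM : ∀ u, 0 < u → massProfile (a + 1) u ≤ M) (x : ℝ) :
    ∫⁻ y, ENNReal.ofReal (modHalfKernel a t x y) ∂halfMeasure a ≤
      (M * (Real.cosh (2 * t) ^ (-(a + 1))).toNNReal : ℝ≥0) := by
  obtain rfl | hx := eq_or_ne x 0
  · simp [modHalfKernel]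
  rw [lintegral_modHalfKernel ha ht, mul_comm, ENNReal.coe_mul]
  refine mul_le_mul' (hM _ (by positivity)) (ENNReal.ofReal_le_ofReal ?_)
  refine mul_le_of_le_one_right (by positivity) ?_
  rw [Real.exp_le_one_iff, neg_nonpos]
  positivity

theorem isSymmKernel_modHalfKernel {a t : ℝ} (ha : -2 < a) (ht : 0 < t) {M : ℝ≥0}
    (hM : ∀ u, 0 < u → massProfile (a + 1) u ≤ M) :
    IsSymmKernel (halfMeasure a) (modHalfKernel a t)
      (M * (Real.cosh (2 * t) ^ (-(a + 1))).toNNReal) where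
  measurable := measurable_modHalfKernel ha t
  nonneg := modHalfKernel_nonneg ha ht
  symm := modHalfKernel_symm a t
  bounded x := by
    obtain ⟨B, hB⟩ := exists_mul_halfKernel_le (ν := a + 1) (by linarith) ht x
    refine ⟨|x| * B, fun y => ?_⟩
    have h0 := halfKernel_nonneg (ν := a + 1) (by linarith) ht x y
    calc modHalfKernel a t x y = |x| * (|y| * halfKernel (a + 1) t x y) := by
          rw [modHalfKernel, abs_mul, mul_assoc]
      _ ≤ |x| * ((1 + |y|) * halfKernel (a + 1) t x y) := by gcongr; linarith
      _ ≤ |x| * B := by gcongr; exact hB y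
  lintegral_le := lintegral_modHalfKernel_le ha ht hM

variable {d : ℕ}

theorem setOf_forall_pos_eq_pi :
    {x : Fin d → ℝ | ∀ i, 0 < x i} = Set.univ.pi fun _ => Set.Ioi 0 := by
  ext x
  simp

theorem muAlpha_eq_pi (α : Fin d → ℝ) : muAlpha α = Measure.pi fun i => halfMeasure (α i) := by
  have h_sigma (i : Fin d) : SigmaFinite (((volume : Measure ℝ).restrict (Set.Ioi 0)).withDensity
      fun y => ENNReal.ofReal (y ^ (2 * α i + 1))) :=
    inferInstanceAs (SigmaFinite (halfMeasure (α i)))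
  refine Eq.trans ?_ (pi_withDensity fun i => by fun_prop).symm
  rw [muAlpha, ← Measure.restrict_pi_pi, ← volume_pi, ← setOf_forall_pos_eq_pi]
  refine withDensity_congr_ae ?_
  have h_meas : MeasurableSet {x : Fin d → ℝ | ∀ i, 0 < x i} := by
    rw [setOf_forall_pos_eq_pi]
    exact MeasurableSet.univ_pi fun _ => measurableSet_Ioi
  filter_upwards [ae_restrict_mem h_meas] with x hx
  exact ENNReal.ofReal_prod_of_nonneg fun i _ => Real.rpow_nonneg (hx i).le _

instance (α : Fin d → ℝ) : SigmaFinite (muAlpha α) := by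
  rw [muAlpha_eq_pi]
  infer_instance

theorem muAlpha_ae_pos (α : Fin d → ℝ) : ∀ᵐ y ∂muAlpha α, ∀ i, 0 < y i := by
  rw [muAlpha_eq_pi, eventually_all]
  exact fun i => (Measure.quasiMeasurePreserving_eval _ i).ae (halfMeasure_ae_pos (α i))

/-- The one-dimensional factors of the kernel of the modified semigroup: the Bessel heat kernel in
the coordinates `i ≠ j`, its modification in the coordinate `j`. -/
noncomputable def factorKernel (α : Fin d → ℝ) (j : Fin d) (t : ℝ) (i : Fin d) : ℝ → ℝ → ℝ :=
  if i = j then modHalfKernel (α i) t else halfKernel (α i) t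

/-- An extension of `modifiedKernel` from the positive orthant to all of `ℝ^d` that stays
nonnegative and symmetric, so that it is an `IsSymmKernel`. -/
noncomputable def modKernel (α : Fin d → ℝ) (j : Fin d) (t : ℝ) (x y : Fin d → ℝ) : ℝ :=
  Real.exp (-2 * t) * prodKernel (factorKernel α j t) x y

/-- The bound `e^{-2t} (cosh 2t)^{-(|α| + d)}` for the operator norms. -/
noncomputable def decayRate (α : Fin d → ℝ) (t : ℝ) : ℝ :=
  Real.exp (-2 * t) * Real.cosh (2 * t) ^ (-((∑ i, α i) + (d : ℝ)))

theorem decayRate_pos (α : Fin d → ℝ) (t : ℝ) : 0 < decayRate α t :=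
  mul_pos (Real.exp_pos _) (Real.rpow_pos_of_pos (Real.cosh_pos _) _)

theorem decayRate_eq_exp_mul_prod (α : Fin d → ℝ) (t : ℝ) :
    decayRate α t = Real.exp (-2 * t) * ∏ i, Real.cosh (2 * t) ^ (-(α i + 1)) := by
  rw [decayRate, ← Real.rpow_sum_of_pos (Real.cosh_pos _), Finset.sum_neg_distrib,
    Finset.sum_add_distrib]
  simp

variable {α : Fin d → ℝ} {j : Fin d} {s t : ℝ}

theorem measurable_factorKernel (hj : -2 < α j) (hα : ∀ i, i ≠ j → -1 < α i) (t : ℝ) (i : Fin d) :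
    Measurable (Function.uncurry (factorKernel α j t i)) := by
  obtain rfl | hij := eq_or_ne i j
  · simpa only [factorKernel, if_pos] using measurable_modHalfKernel hj t
  · simpa only [factorKernel, if_neg hij] using measurable_halfKernel (hα i hij) t

theorem factorKernel_nonneg (hj : -2 < α j) (hα : ∀ i, i ≠ j → -1 < α i) (ht : 0 < t) (i : Fin d)
    (x y : ℝ) : 0 ≤ factorKernel α j t i x y := by
  obtain rfl | hij := eq_or_ne i j
  · simpa only [factorKernel, if_pos] using modHalfKernel_nonneg hj ht x y
  · simpa only [factorKernel, if_neg hij] using halfKernel_nonneg (hα i hij) ht x y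

theorem isSymmKernel_factorKernel (hj : -2 < α j) (hα : ∀ i, i ≠ j → -1 < α i) (ht : 0 < t)
    {M : ℝ≥0} (hM : ∀ u, 0 < u → massProfile (α j + 1) u ≤ M) (i : Fin d) :
    IsSymmKernel (halfMeasure (α i)) (factorKernel α j t i)
      ((if i = j then M else 1) * (Real.cosh (2 * t) ^ (-(α i + 1))).toNNReal) := by
  obtain rfl | hij := eq_or_ne i j
  · simpa only [factorKernel, if_pos] using isSymmKernel_modHalfKernel hj ht hM
  · simpa only [factorKernel, if_neg hij, one_mul] using isSymmKernel_halfKernel (hα i hij) ht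

theorem isSymmKernel_modKernel (hj : -2 < α j) (hα : ∀ i, i ≠ j → -1 < α i) (ht : 0 < t)
    {M : ℝ≥0} (hM : ∀ u, 0 < u → massProfile (α j + 1) u ≤ M) :
    IsSymmKernel (muAlpha α) (modKernel α j t) (M * (decayRate α t).toNNReal) := by
  rw [muAlpha_eq_pi]
  refine (IsSymmKernel.pi (isSymmKernel_factorKernel hj hα ht hM)).const_mul
    (Real.exp_pos (-2 * t)).le ?_
  rw [Finset.prod_mul_distrib, Finset.prod_ite_eq' Finset.univ j, if_pos (Finset.mem_univ j),
    ← Real.toNNReal_prod_of_nonneg fun i _ => by positivity, decayRate_eq_exp_mul_prod,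
    NNReal.coe_mul, NNReal.coe_mul, Real.coe_toNNReal _ (by positivity),
    Real.coe_toNNReal _ (by positivity), mul_left_comm]

theorem lintegral_modKernel_mul_modKernel (hj : -2 < α j) (hα : ∀ i, i ≠ j → -1 < α i)
    (hs : 0 < s) (ht : 0 < t) (x z : Fin d → ℝ) :
    ∫⁻ y, ENNReal.ofReal (modKernel α j s x y) * ENNReal.ofReal (modKernel α j t y z) ∂muAlpha α =
      ENNReal.ofReal (modKernel α j (s + t) x z) := by
  have h_factor (i : Fin d) (x z : ℝ) : ∫⁻ y, ENNReal.ofReal (factorKernel α j s i x y) *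
      ENNReal.ofReal (factorKernel α j t i y z) ∂halfMeasure (α i) =
      ENNReal.ofReal (factorKernel α j (s + t) i x z) := by
    obtain rfl | hij := eq_or_ne i j
    · simpa only [factorKernel, if_pos] using lintegral_modHalfKernel_mul_modHalfKernel hj hs ht x z
    · simpa only [factorKernel, if_neg hij] using
        lintegral_halfKernel_mul_halfKernel (hα i hij) hs ht x z
  have h_exp : Real.exp (-2 * (s + t)) = Real.exp (-2 * s) * Real.exp (-2 * t) := by
    rw [← Real.exp_add, mul_add]
  have h_prod := lintegral_prodKernel_mul_prodKernel (measurable_factorKernel hj hα s)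
    (measurable_factorKernel hj hα t) (factorKernel_nonneg hj hα hs)
    (factorKernel_nonneg hj hα ht) (factorKernel_nonneg hj hα (add_pos hs ht)) h_factor x z
  simp only [modKernel, h_exp, ENNReal.ofReal_mul, (Real.exp_pos _).le, mul_mul_mul_comm,
    mul_nonneg]
  rw [lintegral_const_mul' _ _ (by finiteness), muAlpha_eq_pi, h_prod]

theorem halfKernel_eq_besselI (ν : ℝ) (ht : 0 < t) {x y : ℝ} (hx : 0 < x) (hy : 0 < y) :
    halfKernel ν t x y = (Real.sinh (2 * t))⁻¹ *
      (Real.exp (-(1 / 2) * (Real.cosh (2 * t) / Real.sinh (2 * t)) * (x ^ 2 + y ^ 2))) *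
      ((x * y) ^ (-ν) * besselI ν (x * y / Real.sinh (2 * t))) := by
  have hS := sinh_two_mul_pos ht
  rw [halfKernel, besselKernel, besselI_eq ν (by positivity)]
  set S := Real.sinh (2 * t)
  have h_exponent : -(Real.cosh (2 * t) / (2 * S)) * (x ^ 2 + y ^ 2) =
      -(1 / 2) * (Real.cosh (2 * t) / S) * (x ^ 2 + y ^ 2) := by
    field_simp
  have h_arg : 1 / (2 * S) * x * y = x * y / S / 2 := by field_simp
  have h_pow : (x * y) ^ (-ν) * (x * y / S / 2) ^ ν = (1 / (2 * S)) ^ ν := by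
    rw [Real.rpow_neg (by positivity), ← Real.inv_rpow (by positivity),
      ← Real.mul_rpow (by positivity) (by positivity)]
    congr 1
    field_simp
  rw [h_exponent, h_arg, Real.rpow_add_one (by positivity), ← h_pow]
  field_simp

theorem heatKernel_eq_prodKernel (β : Fin d → ℝ) (ht : 0 < t) {x y : Fin d → ℝ}
    (hx : ∀ i, 0 < x i) (hy : ∀ i, 0 < y i) :
    heatKernel β t x y = prodKernel (fun i => halfKernel (β i) t) x y := by
  rw [heatKernel, prodKernel,
    Finset.prod_congr rfl fun i _ => halfKernel_eq_besselI (β i) ht (hx i) (hy i)]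
  simp only [Finset.prod_mul_distrib]
  rw [← Real.exp_sum, Finset.prod_const,
    Finset.card_univ, Fintype.card_fin, ← Finset.mul_sum, Finset.sum_add_distrib]

theorem prodKernel_factorKernel (α : Fin d → ℝ) (j : Fin d) (t : ℝ) (x y : Fin d → ℝ) :
    prodKernel (factorKernel α j t) x y =
      |x j * y j| * prodKernel (fun i => halfKernel ((α + Pi.single j 1 : Fin d → ℝ) i) t) x y := by
  have h_single : |x j * y j| = ∏ i, if i = j then |x i * y i| else 1 := by
    rw [Finset.prod_ite_eq' Finset.univ j, if_pos (Finset.mem_univ j)]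
  rw [h_single, prodKernel, prodKernel, ← Finset.prod_mul_distrib]
  refine Finset.prod_congr rfl fun i _ => ?_
  obtain rfl | hij := eq_or_ne i j
  · simp [factorKernel, modHalfKernel]
  · simp [factorKernel, hij]

theorem modifiedKernel_eq_modKernel (α : Fin d → ℝ) (j : Fin d) (ht : 0 < t) {x y : Fin d → ℝ}
    (hx : ∀ i, 0 < x i) (hy : ∀ i, 0 < y i) : modifiedKernel α j t x y = modKernel α j t x y := by
  rw [modifiedKernel, modKernel, heatKernel_eq_prodKernel _ ht hx hy, prodKernel_factorKernel,
    abs_of_pos (mul_pos (hx j) (hy j))]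

theorem modifiedSemigroup_eq_kernelOp {𝕜 : Type*} [RCLike 𝕜] (α : Fin d → ℝ) (j : Fin d)
    (ht : 0 < t) (f : (Fin d → ℝ) → 𝕜) {x : Fin d → ℝ} (hx : ∀ i, 0 < x i) :
    modifiedSemigroup α j t f x = kernelOp (muAlpha α) (modKernel α j t) f x := by
  rw [modifiedSemigroup, if_neg ht.ne', kernelOp]
  refine integral_congr_ae ?_
  filter_upwards [muAlpha_ae_pos α] with y hy
  rw [modifiedKernel_eq_modKernel α j ht hx hy]

theorem modifiedSemigroup_ae_eq_kernelOp {𝕜 : Type*} [RCLike 𝕜] (α : Fin d → ℝ) (j : Fin d)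
    (ht : 0 < t) (f : (Fin d → ℝ) → 𝕜) :
    modifiedSemigroup α j t f =ᵐ[muAlpha α] kernelOp (muAlpha α) (modKernel α j t) f := by
  filter_upwards [muAlpha_ae_pos α] with x hx
  exact modifiedSemigroup_eq_kernelOp α j ht f hx

end ModifiedLaguerre

/-! ### Strong continuity from concentration near the diagonal -/

section Concentration

variable {X 𝕜 : Type*} [RCLike 𝕜] [MeasurableSpace X] {μ : Measure X}

theorem IsSymmKernel.norm_kernelOp_le {K : X → X → ℝ} (hK : IsSymmKernel μ K 1) {g : X → 𝕜}
    {B : ℝ} (hB : ∀ y, ‖g y‖ ≤ B) (x : X) : ‖kernelOp μ K g x‖ ≤ B := by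
  have hB0 : 0 ≤ B := (norm_nonneg (g x)).trans (hB x)
  calc ‖kernelOp μ K g x‖ ≤ ∫ y, K x y * B ∂μ := by
        refine norm_integral_le_of_norm_le ((hK.integrable_right x).mul_const B)
          (.of_forall fun y => ?_)
        rw [norm_smul, Real.norm_of_nonneg (hK.nonneg x y)]
        exact mul_le_mul_of_nonneg_left (hB y) (hK.nonneg x y)
    _ = (∫ y, K x y ∂μ) * B := integral_mul_const _ _
    _ ≤ B := mul_le_of_le_one_left hB0 (hK.integral_le x)

theorem IsSymmKernel.norm_kernelOp_sub_le {K : X → X → ℝ} (hK : IsSymmKernel μ K 1) {g : X → 𝕜}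
    (hg : AEStronglyMeasurable g μ) {B ε : ℝ} (hε : 0 ≤ ε) (hB : ∀ y, ‖g y‖ ≤ B) {x : X} {U : Set X}
    (hU : MeasurableSet U) (hgU : ∀ y ∈ U, ‖g y - g x‖ ≤ ε) :
    ‖kernelOp μ K g x - g x‖ ≤ ε + 3 * B * (1 - ∫ y in U, K x y ∂μ) := by
  have hKx := hK.integrable_right x
  have h_mass : ∫ y, K x y ∂μ ≤ 1 := hK.integral_le x
  have h_mass_U : ∫ y in U, K x y ∂μ ≤ ∫ y, K x y ∂μ :=
    setIntegral_le_integral hKx (Eventually.of_forall (hK.nonneg x))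
  have hB0 : 0 ≤ B := (norm_nonneg (g x)).trans (hB x)
  have h_split : kernelOp μ K g x - g x =
      (∫ y, K x y • (g y - g x) ∂μ) - (1 - ∫ y, K x y ∂μ) • g x := by
    have hgK := hK.integrable (.of_memLp_top (memLp_top_of_bound hg B (.of_forall hB))) x
    simp only [smul_sub]
    rw [integral_sub hgK (hKx.smul_const _), integral_smul_const, kernelOp, sub_smul, one_smul]
    abel
  have h_pointwise (y : X) :
      ‖K x y • (g y - g x)‖ ≤ (ε + 2 * B) * K x y - 2 * B * U.indicator (K x) y := by
    rw [norm_smul, Real.norm_of_nonneg (hK.nonneg x y)]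
    have hKxy := hK.nonneg x y
    by_cases hy : y ∈ U
    · rw [Set.indicator_of_mem hy]
      linarith [mul_le_mul_of_nonneg_left (hgU y hy) hKxy]
    · rw [Set.indicator_of_notMem hy]
      have h_diff : ‖g y - g x‖ ≤ ε + 2 * B := by linarith [norm_sub_le (g y) (g x), hB y, hB x]
      linarith [mul_le_mul_of_nonneg_left h_diff hKxy]
  have h_integral : ‖∫ y, K x y • (g y - g x) ∂μ‖ ≤
      (ε + 2 * B) * ∫ y, K x y ∂μ - 2 * B * ∫ y in U, K x y ∂μ := by
    have h_int₁ := hKx.const_mul (ε + 2 * B)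
    have h_int₂ := (hKx.indicator hU).const_mul (2 * B)
    refine (norm_integral_le_of_norm_le (h_int₁.sub h_int₂) (.of_forall h_pointwise)).trans_eq ?_
    rw [integral_sub' h_int₁ h_int₂, integral_const_mul,
      integral_const_mul, integral_indicator hU]
  have h_defect : ‖(1 - ∫ y, K x y ∂μ) • g x‖ ≤ (1 - ∫ y in U, K x y ∂μ) * B := by
    rw [norm_smul, Real.norm_of_nonneg (sub_nonneg.2 h_mass)]
    gcongr
    exacts [by linarith, hB x]
  rw [h_split]
  nlinarith [norm_sub_le (∫ y, K x y • (g y - g x) ∂μ) ((1 - ∫ y, K x y ∂μ) • g x)]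

theorem tendsto_of_norm_le_of_tendsto_inner {E α : Type*} [NormedAddCommGroup E]
    [InnerProductSpace 𝕜 E] {l : Filter α} {u : α → E} {v : E} (hu : ∀ᶠ t in l, ‖u t‖ ≤ ‖v‖)
    (hinner : Tendsto (fun t => inner 𝕜 v (u t)) l (𝓝 (inner 𝕜 v v))) : Tendsto u l (𝓝 v) := by
  have h_re : Tendsto (fun t => 2 * (‖v‖ ^ 2 - RCLike.re (inner 𝕜 v (u t)))) l (𝓝 0) := by
    have h := (((RCLike.continuous_re.tendsto _).comp hinner).const_sub (‖v‖ ^ 2)).const_mul 2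
    simpa [← norm_sq_eq_re_inner (𝕜 := 𝕜) v] using h
  have h_sq : Tendsto (fun t => ‖u t - v‖ ^ 2) l (𝓝 0) := by
    refine squeeze_zero' (.of_forall fun t => sq_nonneg _) ?_ h_re
    filter_upwards [hu] with t ht
    rw [norm_sub_sq (𝕜 := 𝕜), inner_re_symm]
    linarith [pow_le_pow_left₀ (norm_nonneg _) ht 2]
  rw [tendsto_iff_norm_sub_tendsto_zero]
  simpa [Real.sqrt_sq] using h_sq.sqrt

theorem tendsto_eLpNorm_sub_of_tendsto_integral {α : Type*} {l : Filter α} {u : α → X → 𝕜}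
    {v : X → 𝕜} (hu : ∀ t, MemLp (u t) 2 μ) (hv : MemLp v 2 μ)
    (hle : ∀ t, eLpNorm (u t) 2 μ ≤ eLpNorm v 2 μ)
    (hint : Tendsto (fun t => ∫ x, u t x * star (v x) ∂μ) l (𝓝 (∫ x, v x * star (v x) ∂μ))) :
    Tendsto (fun t => eLpNorm (u t - v) 2 μ) l (𝓝 0) := by
  have h_inner (w : X → 𝕜) (hw : MemLp w 2 μ) :
      inner 𝕜 (hv.toLp v) (hw.toLp w) = ∫ x, w x * star (v x) ∂μ := by
    rw [L2.inner_def]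
    refine integral_congr_ae ?_
    filter_upwards [hv.coeFn_toLp, hw.coeFn_toLp] with x hvx hwx
    rw [hvx, hwx, RCLike.inner_apply, RCLike.star_def]
  have h_lim : Tendsto (fun t => (hu t).toLp (u t)) l (𝓝 (hv.toLp v)) := by
    refine tendsto_of_norm_le_of_tendsto_inner (𝕜 := 𝕜) (.of_forall fun t => ?_) ?_
    · rw [Lp.norm_toLp, Lp.norm_toLp]
      exact ENNReal.toReal_mono hv.2.ne (hle t)
    · simpa only [h_inner] using hint
  rw [tendsto_iff_edist_tendsto_0] at h_lim
  simpa only [Lp.edist_toLp_toLp] using h_lim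

/-- The mass of `k t x` concentrates at `x` as `t → 0⁺`. For subprobability kernels this is the
approximate identity property at the point `x`. -/
def ConcentratesAt {X : Type*} [TopologicalSpace X] [MeasurableSpace X] (μ : Measure X)
    (k : ℝ → X → X → ℝ) (x : X) : Prop :=
  ∀ U ∈ 𝓝 x, Tendsto (fun t => ∫ y in U, k t x y ∂μ) (𝓝[>] 0) (𝓝 1)

variable [TopologicalSpace X] {k : ℝ → X → X → ℝ}

theorem ConcentratesAt.const_mul {x : X} (hx : ConcentratesAt μ k x) {c : ℝ → ℝ}
    (hc : Tendsto c (𝓝[>] 0) (𝓝 1)) : ConcentratesAt μ (fun t x y => c t * k t x y) x := by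
  intro U hU
  simpa only [integral_const_mul, one_mul] using hc.mul (hx U hU)

variable [BorelSpace X]

theorem tendsto_kernelOp_of_concentratesAt (hk : ∀ t, 0 < t → IsSymmKernel μ (k t) 1) {x : X}
    (hx : ConcentratesAt μ k x) {g : X → 𝕜} (hg : AEStronglyMeasurable g μ) {B : ℝ}
    (hB : ∀ y, ‖g y‖ ≤ B) (hgx : ContinuousAt g x) :
    Tendsto (fun t => kernelOp μ (k t) g x) (𝓝[>] 0) (𝓝 (g x)) := by
  refine Metric.tendsto_nhds.2 fun ε hε => ?_
  obtain ⟨U, hU_sub, hU_open, hxU⟩ :=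
    mem_nhds_iff.1 (hgx.preimage_mem_nhds (Metric.closedBall_mem_nhds (g x) (half_pos hε)))
  have h_defect : Tendsto (fun t => 3 * B * (1 - ∫ y in U, k t x y ∂μ)) (𝓝[>] 0) (𝓝 0) := by
    simpa using ((hx U (hU_open.mem_nhds hxU)).const_sub 1).const_mul (3 * B)
  filter_upwards [h_defect.eventually_lt_const (half_pos hε), self_mem_nhdsWithin] with t h_lt ht
  have h_le := (hk t ht).norm_kernelOp_sub_le hg (half_pos hε).le hB hU_open.measurableSet
    fun y hy => mem_closedBall_iff_norm.1 (hU_sub hy)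
  rw [dist_eq_norm]
  linarith

theorem tendsto_integral_kernelOp_mul_star (hk : ∀ t, 0 < t → IsSymmKernel μ (k t) 1)
    [SFinite μ] [IsFiniteMeasureOnCompacts μ] [SecondCountableTopologyEither X 𝕜]
    (hconc : ∀ᵐ x ∂μ, ConcentratesAt μ k x) {g : X → 𝕜}
    (hg : Continuous g) (hg_supp : HasCompactSupport g) :
    Tendsto (fun t => ∫ x, kernelOp μ (k t) g x * star (g x) ∂μ) (𝓝[>] 0)
      (𝓝 (∫ x, g x * star (g x) ∂μ)) := by
  obtain ⟨B, hB⟩ := hg.bounded_above_of_compact_support hg_supp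
  have hgm : AEStronglyMeasurable g μ := hg.aestronglyMeasurable
  have hg_int : Integrable g μ := hg.integrable_of_hasCompactSupport hg_supp
  refine tendsto_integral_filter_of_dominated_convergence (fun x => B * ‖g x‖) ?_ ?_
    (hg_int.norm.const_mul B) ?_
  · filter_upwards [self_mem_nhdsWithin] with t ht
    exact ((hk t ht).aestronglyMeasurable_kernelOp hgm).mul hgm.star
  · filter_upwards [self_mem_nhdsWithin] with t ht
    refine .of_forall fun x => ?_
    rw [norm_mul, norm_star]
    gcongr
    exact (hk t ht).norm_kernelOp_le hB x
  · filter_upwards [hconc] with x hx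
    exact (tendsto_kernelOp_of_concentratesAt hk hx hgm hB hg.continuousAt).mul_const _

variable [SecondCountableTopologyEither X 𝕜] [SFinite μ]

theorem tendsto_eLpNorm_kernelOp_sub_of_hasCompactSupport [IsFiniteMeasureOnCompacts μ]
    (hk : ∀ t, 0 < t → IsSymmKernel μ (k t) 1) (hconc : ∀ᵐ x ∂μ, ConcentratesAt μ k x)
    {g : X → 𝕜} (hg : Continuous g) (hg_supp : HasCompactSupport g) :
    Tendsto (fun t => eLpNorm (kernelOp μ (k t) g - g) 2 μ) (𝓝[>] 0) (𝓝 0) := by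
  have hgL : MemLp g 2 μ := hg.memLp_of_hasCompactSupport hg_supp
  have h_weak := tendsto_integral_kernelOp_mul_star hk hconc hg hg_supp
  have h_range : Set.range ((↑) : Set.Ioi (0 : ℝ) → ℝ) ∈ 𝓝[>] 0 := by
    simpa only [Subtype.range_coe] using self_mem_nhdsWithin
  rw [← tendsto_comap'_iff h_range] at h_weak ⊢
  exact tendsto_eLpNorm_sub_of_tendsto_integral
    (fun t => (hk t t.2).memLp_kernelOp one_le_two hgL) hgL
    (fun t => by simpa using (hk t t.2).eLpNorm_kernelOp_le one_le_two hgL.1) h_weak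

theorem tendsto_eLpNorm_kernelOp_sub [NormalSpace X] [R1Space X] [WeaklyLocallyCompactSpace X]
    [μ.Regular] (hk : ∀ t, 0 < t → IsSymmKernel μ (k t) 1)
    (hconc : ∀ᵐ x ∂μ, ConcentratesAt μ k x) {f : X → 𝕜} (hf : MemLp f 2 μ) :
    Tendsto (fun t => eLpNorm (kernelOp μ (k t) f - f) 2 μ) (𝓝[>] 0) (𝓝 0) := by
  refine ENNReal.tendsto_nhds_zero.2 fun ε hε => ?_
  have hε3 : 0 < ε / 3 := ENNReal.div_pos hε.ne' (by norm_num)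
  obtain ⟨g, hg_supp, hfg, hg, hgL⟩ :=
    hf.exists_hasCompactSupport_eLpNorm_sub_le (by norm_num) hε3.ne'
  have h_lim := tendsto_eLpNorm_kernelOp_sub_of_hasCompactSupport hk hconc hg hg_supp
  filter_upwards [ENNReal.tendsto_nhds_zero.1 h_lim _ hε3, self_mem_nhdsWithin] with t h_near ht
  have hK := hk t ht
  have hfgL := hf.sub hgL
  have h_split : kernelOp μ (k t) f - f =
      kernelOp μ (k t) (f - g) + (kernelOp μ (k t) g - g) - (f - g) := by
    rw [hK.kernelOp_sub (.of_memLp one_le_two hf) (.of_memLp one_le_two hgL)]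
    abel
  have h_contr : eLpNorm (kernelOp μ (k t) (f - g)) 2 μ ≤ ε / 3 :=
    (hK.eLpNorm_kernelOp_le one_le_two hfgL.1).trans (by simpa using hfg)
  have hm₁ := (hK.memLp_kernelOp one_le_two hfgL).1
  have hm₂ := ((hK.memLp_kernelOp one_le_two hgL).sub hgL).1
  calc eLpNorm (kernelOp μ (k t) f - f) 2 μ
      ≤ eLpNorm (kernelOp μ (k t) (f - g)) 2 μ + eLpNorm (kernelOp μ (k t) g - g) 2 μ
          + eLpNorm (f - g) 2 μ := by
        rw [h_split]
        exact (eLpNorm_sub_le (hm₁.add hm₂) hfgL.1 one_le_two).trans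
          (by gcongr; exact eLpNorm_add_le hm₁ hm₂ one_le_two)
    _ ≤ ε / 3 + ε / 3 + ε / 3 := by gcongr
    _ = ε := ENNReal.add_thirds ε

end Concentration

theorem ConcentratesAt.pi {ι : Type*} [Fintype ι] {X : ι → Type*} [∀ i, TopologicalSpace (X i)]
    [∀ i, MeasurableSpace (X i)] {μ : ∀ i, Measure (X i)} [∀ i, SigmaFinite (μ i)]
    {k : ℝ → ∀ i, X i → X i → ℝ} (hk : ∀ t, 0 < t → ∀ i, IsSymmKernel (μ i) (k t i) 1)
    {x : ∀ i, X i} (hx : ∀ i, ConcentratesAt (μ i) (fun t => k t i) (x i)) :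
    ConcentratesAt (Measure.pi μ) (fun t => prodKernel (k t)) x := by
  intro U hU
  rw [nhds_pi, Filter.mem_pi'] at hU
  obtain ⟨I, V, hV, hVU⟩ := hU
  have h_box_sub : Set.univ.pi V ⊆ U :=
    (Set.pi_mono' (fun _ _ => subset_rfl) (Set.subset_univ _)).trans hVU
  have h_box : Tendsto (fun t => ∫ y in Set.univ.pi V, prodKernel (k t) x y ∂Measure.pi μ) (𝓝[>] 0)
      (𝓝 1) := by
    simp only [prodKernel, Measure.restrict_pi_pi, integral_fintype_prod_eq_prod]
    simpa using tendsto_finsetProd Finset.univ fun i _ => hx i (V i) (hV i)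
  refine tendsto_of_tendsto_of_tendsto_of_le_of_le' h_box tendsto_const_nhds ?_ ?_
  · filter_upwards [self_mem_nhdsWithin] with t ht
    have hK := IsSymmKernel.pi (hk t ht)
    exact setIntegral_mono_set (hK.integrable_right x).integrableOn
      (.of_forall (hK.nonneg x)) h_box_sub.eventuallyLE
  · filter_upwards [self_mem_nhdsWithin] with t ht
    have hK := IsSymmKernel.pi (hk t ht)
    refine (setIntegral_le_integral (hK.integrable_right x) (.of_forall (hK.nonneg x))).trans ?_
    simpa using hK.integral_le x

/-! ### Strong continuity of the modified Laguerre semigroup -/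

section Moments

variable {X : Type*} [MeasurableSpace X] {μ : Measure X} {φ : X → ℝ}

-- Chebyshev's inequality for the density `K x`, applied to the observable `φ`.
theorem IsSymmKernel.integral_sub_le_setIntegral {K : X → X → ℝ} {C : ℝ≥0}
    (hK : IsSymmKernel μ K C) (hφ : Measurable φ) (hφL : MemLp φ ∞ μ) (x : X) {η : ℝ}
    (hη : 0 < η) :
    ∫ y, K x y ∂μ - (η ^ 2)⁻¹ * (∫ y, K x y * φ y ^ 2 ∂μ - 2 * φ x * ∫ y, K x y * φ y ∂μ
      + φ x ^ 2 * ∫ y, K x y ∂μ) ≤ ∫ y in {y | |φ y - φ x| < η}, K x y ∂μ := by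
  have h₀ := hK.integrable_right x
  have h₁ : Integrable (fun y => K x y * φ y) μ := hK.integrable (.of_memLp_top hφL) x
  have h₂ : Integrable (fun y => K x y * φ y ^ 2) μ := by
    have h := hK.integrable (.of_memLp_top (hφL.mul (r := ∞) hφL)) x
    simpa only [pow_two, Pi.mul_apply, smul_eq_mul] using h
  have h_expand (y : X) : K x y * (φ y - φ x) ^ 2 =
      K x y * φ y ^ 2 - 2 * φ x * (K x y * φ y) + φ x ^ 2 * K x y := by ring
  have h_sub := h₂.sub (h₁.const_mul (2 * φ x))
  have h_var : ∫ y, K x y * (φ y - φ x) ^ 2 ∂μ = ∫ y, K x y * φ y ^ 2 ∂μ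
      - 2 * φ x * ∫ y, K x y * φ y ∂μ + φ x ^ 2 * ∫ y, K x y ∂μ := by
    simp only [h_expand]
    rw [integral_add (by exact h_sub) (h₀.const_mul _), integral_sub h₂ (h₁.const_mul _),
      integral_const_mul, integral_const_mul]
  have h_var_int : Integrable (fun y => K x y * (φ y - φ x) ^ 2) μ := by
    simp only [h_expand]
    exact h_sub.add (h₀.const_mul _)
  have hS : MeasurableSet {y | |φ y - φ x| < η} :=
    measurableSet_lt (by simpa using (hφ.sub_const _).norm) measurable_const
  rw [← h_var, ← integral_const_mul, ← integral_sub h₀ (h_var_int.const_mul _),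
    ← integral_indicator hS]
  refine integral_mono (h₀.sub (h_var_int.const_mul _)) (h₀.indicator hS) fun y => ?_
  have hKxy := hK.nonneg x y
  by_cases hy : |φ y - φ x| < η
  · rw [Set.indicator_of_mem (by exact hy)]
    exact sub_le_self _ (by positivity)
  · have h_far : η ^ 2 ≤ (φ y - φ x) ^ 2 := sq_le_sq.2 (by rwa [abs_of_pos hη, ← not_lt])
    rw [Set.indicator_of_notMem (by exact hy), sub_nonpos, inv_mul_eq_div,
      le_div_iff₀ (by positivity)]
    gcongr

theorem tendsto_setIntegral_of_tendsto_moments {k : ℝ → X → X → ℝ}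
    (hk : ∀ t, 0 < t → IsSymmKernel μ (k t) 1) (hφ : Measurable φ) (hφL : MemLp φ ∞ μ) {x : X}
    (h₀ : Tendsto (fun t => ∫ y, k t x y ∂μ) (𝓝[>] 0) (𝓝 1))
    (h₁ : Tendsto (fun t => ∫ y, k t x y * φ y ∂μ) (𝓝[>] 0) (𝓝 (φ x)))
    (h₂ : Tendsto (fun t => ∫ y, k t x y * φ y ^ 2 ∂μ) (𝓝[>] 0) (𝓝 (φ x ^ 2))) {η : ℝ}
    (hη : 0 < η) :
    Tendsto (fun t => ∫ y in {y | |φ y - φ x| < η}, k t x y ∂μ) (𝓝[>] 0) (𝓝 1) := by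
  have h_lower := h₀.sub
    (((h₂.sub (h₁.const_mul (2 * φ x))).add (h₀.const_mul (φ x ^ 2))).const_mul (η ^ 2)⁻¹)
  rw [show 1 - (η ^ 2)⁻¹ * (φ x ^ 2 - 2 * φ x * φ x + φ x ^ 2 * 1) = 1 by ring] at h_lower
  refine tendsto_of_tendsto_of_tendsto_of_le_of_le' h_lower h₀ ?_ ?_
  · filter_upwards [self_mem_nhdsWithin] with t ht
    exact (hk t ht).integral_sub_le_setIntegral hφ hφL x hη
  · filter_upwards [self_mem_nhdsWithin] with t ht
    exact setIntegral_le_integral ((hk t ht).integrable_right x)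
      (.of_forall ((hk t ht).nonneg x))

end Moments

section HalfLine

variable {a ν x : ℝ}

theorem isLocallyFiniteMeasure_halfMeasure (ha : -1 < a) :
    IsLocallyFiniteMeasure (halfMeasure a) := by
  have h_finite : ∫⁻ y, ENNReal.ofReal (Real.exp (-1 * y ^ 2)) ∂halfMeasure a ≠ ∞ := by
    have h := lintegral_pow_mul_exp ha one_pos 0
    simp only [mul_zero, pow_zero, one_mul] at h
    exact h.trans_ne ENNReal.ofReal_ne_top
  refine ⟨fun x => ?_⟩
  have h_exp : Continuous fun y : ℝ => Real.exp (-1 * y ^ 2) := by fun_prop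
  have h_level : ENNReal.ofReal (Real.exp (-1 * x ^ 2) / 2) ≠ 0 := by
    simpa using Real.exp_pos _
  refine ⟨{y | Real.exp (-1 * x ^ 2) / 2 < Real.exp (-1 * y ^ 2)},
    (isOpen_lt continuous_const h_exp).mem_nhds (half_lt_self (Real.exp_pos _)), ?_⟩
  calc halfMeasure a {y | Real.exp (-1 * x ^ 2) / 2 < Real.exp (-1 * y ^ 2)}
      ≤ halfMeasure a {y | ENNReal.ofReal (Real.exp (-1 * x ^ 2) / 2)
          ≤ ENNReal.ofReal (Real.exp (-1 * y ^ 2))} :=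
        measure_mono fun y hy => ENNReal.ofReal_le_ofReal (le_of_lt hy)
    _ ≤ (∫⁻ y, ENNReal.ofReal (Real.exp (-1 * y ^ 2)) ∂halfMeasure a) /
          ENNReal.ofReal (Real.exp (-1 * x ^ 2) / 2) :=
        meas_ge_le_lintegral_div (by fun_prop) h_level ENNReal.ofReal_ne_top
    _ < ∞ := ENNReal.div_lt_top h_finite h_level

theorem tendsto_integral_halfKernel_mul_exp (hν : -1 < ν) {l : ℝ} (hl : 0 ≤ l) (x : ℝ) :
    Tendsto (fun t => ∫ y, halfKernel ν t x y * Real.exp (-l * y ^ 2) ∂halfMeasure ν) (𝓝[>] 0)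
      (𝓝 (Real.exp (-l * x ^ 2))) := by
  have h_cont : ContinuousAt (fun t =>
      (Real.cosh (2 * t) + 2 * l * Real.sinh (2 * t)) ^ (-(ν + 1)) *
        Real.exp (-(1 / 2) * x ^ 2 * ((Real.sinh (2 * t) + 2 * l * Real.cosh (2 * t)) /
          (Real.cosh (2 * t) + 2 * l * Real.sinh (2 * t))))) 0 := by
    refine .mul (.rpow_const (by fun_prop) (.inl (by simp))) ?_
    refine .rexp (.mul continuousAt_const (.div (by fun_prop) (by fun_prop) (by simp)))
  have h_lim := h_cont.tendsto.mono_left (nhdsWithin_le_nhds (s := Set.Ioi 0))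
  simp only [mul_zero, Real.cosh_zero, Real.sinh_zero, add_zero, Real.one_rpow, zero_add, one_mul,
    mul_one, div_one] at h_lim
  rw [show -l * x ^ 2 = -(1 / 2) * x ^ 2 * (2 * l) by ring]
  refine h_lim.congr' ?_
  filter_upwards [self_mem_nhdsWithin] with t (ht : 0 < t)
  rw [integral_eq_lintegral_of_nonneg_ae
    (.of_forall fun y => mul_nonneg (halfKernel_nonneg hν ht x y) (Real.exp_pos _).le)
    (((measurable_halfKernel hν t).of_uncurry_left.mul (by fun_prop)).aestronglyMeasurable),
    lintegral_halfKernel_mul_exp hν ht hl x, ENNReal.toReal_ofReal (by positivity)]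

theorem isSymmKernel_halfKernel_one (hν : -1 < ν) {t : ℝ} (ht : 0 < t) :
    IsSymmKernel (halfMeasure ν) (halfKernel ν t) 1 := by
  refine (isSymmKernel_halfKernel hν ht).mono (Real.toNNReal_le_one.2 ?_)
  exact Real.rpow_le_one_of_one_le_of_nonpos (Real.one_le_cosh _) (by linarith)

theorem exists_forall_abs_exp_sub_lt_mem (hx : 0 < x) {U : Set ℝ} (hU : U ∈ 𝓝 x) :
    ∃ η > 0, ∀ y, 0 < y → |Real.exp (-1 * y ^ 2) - Real.exp (-1 * x ^ 2)| < η → y ∈ U := by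
  have h_inv (y : ℝ) (hy : 0 < y) : √(-Real.log (Real.exp (-1 * y ^ 2))) = y := by
    rw [Real.log_exp, neg_one_mul, neg_neg, Real.sqrt_sq hy.le]
  have h_cont : ContinuousAt (fun z => √(-Real.log z)) (Real.exp (-1 * x ^ 2)) :=
    (Real.continuousAt_log (Real.exp_pos _).ne').neg.sqrt
  obtain ⟨η, hη, h_ball⟩ :=
    Metric.mem_nhds_iff.1 (h_cont.preimage_mem_nhds (by rwa [h_inv x hx]))
  refine ⟨η, hη, fun y hy hyη => ?_⟩
  have hy_mem : √(-Real.log (Real.exp (-1 * y ^ 2))) ∈ U := h_ball (by rwa [Metric.mem_ball])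
  rwa [h_inv y hy] at hy_mem

theorem concentratesAt_halfKernel (hν : -1 < ν) (hx : 0 < x) :
    ConcentratesAt (halfMeasure ν) (halfKernel ν) x := by
  intro U hU
  have hk (t : ℝ) (ht : 0 < t) := isSymmKernel_halfKernel_one hν ht
  obtain ⟨η, hη, h_sub⟩ := exists_forall_abs_exp_sub_lt_mem hx hU
  have h_mass : Tendsto (fun t => ∫ y, halfKernel ν t x y ∂halfMeasure ν) (𝓝[>] 0) (𝓝 1) := by
    simpa using tendsto_integral_halfKernel_mul_exp hν le_rfl x
  have h_moment₂ := tendsto_integral_halfKernel_mul_exp hν zero_le_two x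
  have h_sq (y : ℝ) : Real.exp (-2 * y ^ 2) = Real.exp (-1 * y ^ 2) ^ 2 := by
    rw [← Real.exp_nat_mul]
    ring_nf
  simp only [h_sq] at h_moment₂
  have h_bdd : MemLp (fun y : ℝ => Real.exp (-1 * y ^ 2)) ∞ (halfMeasure ν) := by
    refine memLp_top_of_bound (by fun_prop) 1 (.of_forall fun y => ?_)
    rw [Real.norm_of_nonneg (Real.exp_pos _).le, Real.exp_le_one_iff]
    linarith [sq_nonneg y]
  refine tendsto_of_tendsto_of_tendsto_of_le_of_le'
    (tendsto_setIntegral_of_tendsto_moments hk (by fun_prop) h_bdd h_mass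
      (tendsto_integral_halfKernel_mul_exp hν zero_le_one x) h_moment₂ hη) h_mass ?_ ?_
  · filter_upwards [self_mem_nhdsWithin] with t ht
    refine setIntegral_mono_set ((hk t ht).integrable_right x).integrableOn
      (.of_forall ((hk t ht).nonneg x)) ?_
    filter_upwards [halfMeasure_ae_pos ν] with y hy using h_sub y hy
  · filter_upwards [self_mem_nhdsWithin] with t ht
    exact setIntegral_le_integral ((hk t ht).integrable_right x)
      (.of_forall ((hk t ht).nonneg x))

theorem isSymmKernel_modHalfKernel_one (ha : -(1 / 2) ≤ a) {t : ℝ} (ht : 0 < t) :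
    IsSymmKernel (halfMeasure a) (modHalfKernel a t) 1 := by
  have h_mass (u : ℝ) (hu : 0 < u) : massProfile (a + 1) u ≤ (1 : ℝ≥0) :=
    mod_cast massProfile_le_one (by linarith) hu
  refine (isSymmKernel_modHalfKernel (by linarith) ht h_mass).mono ?_
  rw [one_mul, Real.toNNReal_le_one]
  exact Real.rpow_le_one_of_one_le_of_nonpos (Real.one_le_cosh _) (by linarith)

theorem mul_setIntegral_halfKernel_le (ha : -(1 / 2) ≤ a) {t : ℝ} (ht : 0 < t) (hx : 0 < x)
    {c : ℝ} {V : Set ℝ} (hV : MeasurableSet V) (hcV : ∀ y ∈ V, c * y ≤ x) :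
    c * ∫ y in V, halfKernel (a + 1) t x y ∂halfMeasure (a + 1) ≤
      ∫ y in V, modHalfKernel a t x y ∂halfMeasure a := by
  have h_density (y : ℝ) : (ENNReal.ofReal (y ^ 2)).toReal = y ^ 2 :=
    ENNReal.toReal_ofReal (sq_nonneg y)
  have h_int : Integrable (fun y => y ^ 2 * halfKernel (a + 1) t x y) (halfMeasure a) := by
    have h := (isSymmKernel_halfKernel (ν := a + 1) (by linarith) ht).integrable_right x
    rw [halfMeasure_add_one, integrable_withDensity_iff_integrable_smul' (by fun_prop)
      (.of_forall fun _ => ENNReal.ofReal_lt_top)] at h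
    simpa only [h_density, smul_eq_mul] using h
  rw [halfMeasure_add_one, setIntegral_withDensity_eq_setIntegral_toReal_smul (by fun_prop)
    (.of_forall fun _ => ENNReal.ofReal_lt_top) _ hV, ← integral_const_mul]
  simp only [h_density, smul_eq_mul]
  refine setIntegral_mono_on_ae (h_int.const_mul c).integrableOn
    ((isSymmKernel_modHalfKernel_one ha ht).integrable_right x).integrableOn hV ?_
  filter_upwards [halfMeasure_ae_pos a] with y hy hyV
  have hK := halfKernel_nonneg (ν := a + 1) (by linarith) ht x y
  rw [modHalfKernel, abs_of_pos (mul_pos hx hy)]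
  calc c * (y ^ 2 * halfKernel (a + 1) t x y) = c * y * (y * halfKernel (a + 1) t x y) := by ring
    _ ≤ x * (y * halfKernel (a + 1) t x y) := by gcongr; exact hcV y hyV
    _ = x * y * halfKernel (a + 1) t x y := by ring

-- Near `y = x`, the kernel `x y K(x, y)` against `dμ_a` is close to `K(x, y)` against
-- `y² dμ_a = dμ_{a+1}`.
theorem concentratesAt_modHalfKernel (ha : -(1 / 2) ≤ a) (hx : 0 < x) :
    ConcentratesAt (halfMeasure a) (modHalfKernel a) x := by
  intro U hU
  refine tendsto_order.2 ⟨fun c hc => ?_, fun c hc => ?_⟩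
  · obtain ⟨c', hc_c', hc'⟩ := exists_between hc
    obtain ⟨W, hW_sub, hW_open, hxW⟩ := mem_nhds_iff.1 hU
    have hV_open : IsOpen (W ∩ {y | c' * y < x}) :=
      hW_open.inter (isOpen_lt (by fun_prop) continuous_const)
    have hxV : x ∈ W ∩ {y | c' * y < x} := ⟨hxW, mul_lt_of_lt_one_left hx hc'⟩
    have h_lim := (concentratesAt_halfKernel (ν := a + 1) (by linarith) hx _
      (hV_open.mem_nhds hxV)).const_mul c'
    rw [mul_one] at h_lim
    filter_upwards [h_lim.eventually_const_lt hc_c', self_mem_nhdsWithin] with t h_lt ht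
    have hK := isSymmKernel_modHalfKernel_one ha ht
    refine (h_lt.trans_le (mul_setIntegral_halfKernel_le ha ht hx hV_open.measurableSet
      fun y hy => hy.2.le)).trans_le ?_
    exact setIntegral_mono_set (hK.integrable_right x).integrableOn (.of_forall (hK.nonneg x))
      (Set.inter_subset_left.trans hW_sub).eventuallyLE
  · filter_upwards [self_mem_nhdsWithin] with t ht
    have hK := isSymmKernel_modHalfKernel_one ha ht
    exact (setIntegral_le_integral (hK.integrable_right x) (.of_forall (hK.nonneg x))).trans_lt
      ((hK.integral_le x).trans_lt hc)

end HalfLine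

section Contractive

variable {d : ℕ} {α : Fin d → ℝ} {j : Fin d}

theorem isSymmKernel_factorKernel_one (hj : -(1 / 2) ≤ α j) (hα : ∀ i, i ≠ j → -1 < α i) {t : ℝ}
    (ht : 0 < t) (i : Fin d) : IsSymmKernel (halfMeasure (α i)) (factorKernel α j t i) 1 := by
  obtain rfl | hij := eq_or_ne i j
  · simpa only [factorKernel, if_pos] using isSymmKernel_modHalfKernel_one hj ht
  · simpa only [factorKernel, if_neg hij] using isSymmKernel_halfKernel_one (hα i hij) ht

theorem isSymmKernel_modKernel_one (hj : -(1 / 2) ≤ α j) (hα : ∀ i, i ≠ j → -1 < α i) {t : ℝ}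
    (ht : 0 < t) : IsSymmKernel (muAlpha α) (modKernel α j t) 1 := by
  have h_exp : Real.exp (-2 * t) ≤ 1 := Real.exp_le_one_iff.2 (by linarith)
  rw [muAlpha_eq_pi]
  refine ((IsSymmKernel.pi (isSymmKernel_factorKernel_one hj hα ht)).const_mul
    (Real.exp_pos _).le (D := (Real.exp (-2 * t)).toNNReal) ?_).mono (Real.toNNReal_le_one.2 h_exp)
  simp [Real.exp_nonneg]

theorem concentratesAt_modKernel (hj : -(1 / 2) ≤ α j) (hα : ∀ i, i ≠ j → -1 < α i)
    {x : Fin d → ℝ} (hx : ∀ i, 0 < x i) : ConcentratesAt (muAlpha α) (modKernel α j) x := by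
  have h_factor (i : Fin d) :
      ConcentratesAt (halfMeasure (α i)) (fun t => factorKernel α j t i) (x i) := by
    obtain rfl | hij := eq_or_ne i j
    · simpa only [factorKernel, if_pos] using concentratesAt_modHalfKernel hj (hx i)
    · simpa only [factorKernel, if_neg hij] using concentratesAt_halfKernel (hα i hij) (hx i)
  have h_exp : Tendsto (fun t : ℝ => Real.exp (-2 * t)) (𝓝[>] 0) (𝓝 1) :=
    tendsto_nhdsWithin_of_tendsto_nhds (Continuous.tendsto' (by fun_prop) 0 1 (by simp))
  rw [muAlpha_eq_pi]
  exact (ConcentratesAt.pi (fun t ht => isSymmKernel_factorKernel_one hj hα ht)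
    h_factor).const_mul h_exp

theorem tendsto_eLpNorm_kernelOp_modKernel_sub {𝕜 : Type*} [RCLike 𝕜] (hj : -(1 / 2) ≤ α j)
    (hα : ∀ i, i ≠ j → -1 < α i) {f : (Fin d → ℝ) → 𝕜} (hf : MemLp f 2 (muAlpha α)) :
    Tendsto (fun t => eLpNorm (kernelOp (muAlpha α) (modKernel α j t) f - f) 2 (muAlpha α))
      (𝓝[>] 0) (𝓝 0) := by
  have h_locfin (i : Fin d) : IsLocallyFiniteMeasure (halfMeasure (α i)) := by
    refine isLocallyFiniteMeasure_halfMeasure ?_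
    obtain rfl | hij := eq_or_ne i j
    exacts [by linarith, hα i hij]
  have h_regular : (muAlpha α).Regular := by
    rw [muAlpha_eq_pi]
    infer_instance
  refine tendsto_eLpNorm_kernelOp_sub (fun t ht => isSymmKernel_modKernel_one hj hα ht) ?_ hf
  filter_upwards [muAlpha_ae_pos α] with x hx using concentratesAt_modKernel hj hα hx

end Contractive

/-! ### Contractivity and its failure -/

section MassReaches

variable {X : Type*} [MeasurableSpace X] {μ : Measure X} {k : ℝ → X → X → ℝ} {r : ℝ≥0}

/-- The mass `∫ k_t(x, y) dμ(y)` of the kernel `k_t` exceeds, on a set of positive measure of points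
`x` that may depend on `t`, a lower bound that tends to `r` as `t → 0⁺`. -/
def MassReaches (μ : Measure X) (k : ℝ → X → X → ℝ) (r : ℝ≥0) : Prop :=
  ∃ R : ℝ → ℝ≥0, Tendsto R (𝓝[>] 0) (𝓝 r) ∧
    ∀ t, 0 < t → μ {x | R t ≤ ∫⁻ y, ENNReal.ofReal (k t x y) ∂μ} ≠ 0

theorem MassReaches.const_mul (hk : MassReaches μ k r) {c : ℝ → ℝ} (hc : ∀ t, 0 ≤ c t)
    (hc_lim : Tendsto c (𝓝[>] 0) (𝓝 1)) : MassReaches μ (fun t x y => c t * k t x y) r := by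
  obtain ⟨R, hR, h_ne⟩ := hk
  refine ⟨fun t => (c t).toNNReal * R t, ?_, fun t ht => ?_⟩
  · simpa only [Real.toNNReal_one, one_mul] using (tendsto_real_toNNReal hc_lim).mul hR
  · refine fun h_zero => h_ne t ht (measure_mono_null (fun x hx => ?_) h_zero)
    simp only [Set.mem_ofPred_eq, ENNReal.ofReal_mul (hc t), ENNReal.coe_mul] at hx ⊢
    rw [lintegral_const_mul' _ _ ENNReal.ofReal_ne_top]
    exact mul_le_mul' le_rfl hx

theorem MassReaches.exists_not_ae_le_one (hk : MassReaches μ k r) (hr : 1 < r) :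
    ∃ t, 0 < t ∧ ¬ ∀ᵐ x ∂μ, ∫⁻ y, ENNReal.ofReal (k t x y) ∂μ ≤ 1 := by
  obtain ⟨R, hR, h_ne⟩ := hk
  obtain ⟨t, hRt, ht⟩ := ((hR.eventually_const_lt hr).and self_mem_nhdsWithin).exists
  refine ⟨t, ht, fun h_le => h_ne t ht (measure_mono_null (fun x hx => ?_) (ae_iff.1 h_le))⟩
  exact not_le.2 ((ENNReal.one_lt_coe_iff.2 hRt).trans_le hx)

theorem MassReaches.pi {ι : Type*} [Fintype ι] {X : ι → Type*} [∀ i, MeasurableSpace (X i)]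
    {μ : ∀ i, Measure (X i)} [∀ i, SigmaFinite (μ i)] {k : ℝ → ∀ i, X i → X i → ℝ} {r : ι → ℝ≥0}
    (hk_meas : ∀ t, 0 < t → ∀ i, Measurable (Function.uncurry (k t i)))
    (hk_nonneg : ∀ t, 0 < t → ∀ i x y, 0 ≤ k t i x y)
    (hk : ∀ i, MassReaches (μ i) (fun t => k t i) (r i)) :
    MassReaches (Measure.pi μ) (fun t => prodKernel (k t)) (∏ i, r i) := by
  choose R hR h_ne using hk
  refine ⟨fun t => ∏ i, R i t, tendsto_finsetProd _ fun i _ => hR i, fun t ht h_zero => ?_⟩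
  refine Finset.prod_ne_zero_iff.2 (fun i _ => h_ne i t ht) ((Measure.pi_pi μ _).symm.trans ?_)
  refine measure_mono_null (fun x hx => ?_) h_zero
  rw [Set.mem_ofPred_eq, lintegral_prodKernel (hk_meas t ht) (hk_nonneg t ht),
    ENNReal.ofNNReal_finsetProd]
  exact Finset.prod_le_prod' fun i _ => hx i trivial

end MassReaches

section HalfLine

theorem halfMeasure_Ioo_ne_zero (a : ℝ) {b c : ℝ} (hb : 0 ≤ b) (hbc : b < c) :
    halfMeasure a (Set.Ioo b c) ≠ 0 := by
  have h_density : ∀ᵐ y ∂(volume.restrict (Set.Ioi (0 : ℝ))),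
      ENNReal.ofReal (y ^ (2 * a + 1)) ≠ 0 := by
    filter_upwards [ae_restrict_mem measurableSet_Ioi] with y hy
    exact (ENNReal.ofReal_pos.2 (Real.rpow_pos_of_pos hy _)).ne'
  intro h_zero
  have h_null := withDensity_absolutelyContinuous' (by fun_prop) h_density h_zero
  rw [Measure.restrict_apply measurableSet_Ioo,
    Set.inter_eq_left.2 fun y hy => Set.mem_Ioi.2 (hb.trans_lt hy.1), Real.volume_Ioo,
    ENNReal.ofReal_eq_zero, sub_nonpos] at h_null
  exact h_null.not_gt hbc

theorem massReaches_halfKernel {ν : ℝ} (hν : -1 < ν) :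
    MassReaches (halfMeasure ν) (halfKernel ν) 1 := by
  refine ⟨fun t => (Real.cosh (2 * t) ^ (-(ν + 1)) *
    Real.exp (-(1 / 2) * (Real.sinh (2 * t) / Real.cosh (2 * t)))).toNNReal, ?_, fun t ht => ?_⟩
  · have h_cont : ContinuousAt (fun t => Real.cosh (2 * t) ^ (-(ν + 1)) *
        Real.exp (-(1 / 2) * (Real.sinh (2 * t) / Real.cosh (2 * t)))) 0 := by
      fun_prop (disch := simp)
    rw [← Real.toNNReal_one]
    refine tendsto_real_toNNReal (tendsto_nhdsWithin_of_tendsto_nhds ?_)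
    simpa using h_cont.tendsto
  · have h_ratio : 0 ≤ Real.sinh (2 * t) / Real.cosh (2 * t) :=
      div_nonneg (sinh_two_mul_pos ht).le (Real.cosh_pos _).le
    refine fun h_zero => halfMeasure_Ioo_ne_zero ν le_rfl one_pos
      (measure_mono_null (fun x hx => ?_) h_zero)
    rw [Set.mem_ofPred_eq, lintegral_halfKernel hν ht, mul_assoc (-(1 / 2)) (x ^ 2)]
    refine ENNReal.ofReal_le_ofReal (mul_le_mul_of_nonneg_left (Real.exp_le_exp.2 ?_)
      (Real.rpow_nonneg (Real.cosh_pos _).le _))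
    exact mul_le_mul_of_nonpos_left
      (mul_le_of_le_one_left h_ratio (pow_le_one₀ hx.1.le hx.2.le)) (by norm_num)

theorem exists_massReaches_modHalfKernel {a : ℝ} (ha : -2 < a) (ha' : a < -(1 / 2)) :
    ∃ r, 1 < r ∧ MassReaches (halfMeasure a) (modHalfKernel a) r := by
  obtain ⟨u₀, η, hu₀, hη, h_mass⟩ := exists_lt_massProfile (ν := a + 1) (by linarith)
  refine ⟨(1 + η).toNNReal, Real.one_lt_toNNReal.2 (by linarith), fun t => (Real.cosh (2 * t) ^
    (-(a + 1)) * Real.exp (-(Real.sinh (2 * t) ^ 2 * (2 * u₀))) * (1 + η)).toNNReal, ?_,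
    fun t ht => ?_⟩
  · have h_cont : ContinuousAt (fun t => Real.cosh (2 * t) ^ (-(a + 1)) *
        Real.exp (-(Real.sinh (2 * t) ^ 2 * (2 * u₀))) * (1 + η)) 0 := by
      fun_prop (disch := simp)
    refine tendsto_real_toNNReal (tendsto_nhdsWithin_of_tendsto_nhds ?_)
    simpa using h_cont.tendsto
  · set q := 2 * Real.sinh (2 * t) * Real.cosh (2 * t) with hq
    have hq_pos : 0 < q := by positivity
    have h_sqrt : √(u₀ * q) < √(2 * u₀ * q) := by
      gcongr
      linarith
    refine fun h_zero => halfMeasure_Ioo_ne_zero a (Real.sqrt_nonneg _) h_sqrt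
      (measure_mono_null (fun x hx => ?_) h_zero)
    have hx_pos : 0 < x := (Real.sqrt_nonneg _).trans_lt hx.1
    have h_lower : u₀ ≤ x ^ 2 / q := (le_div_iff₀ hq_pos).2 ((Real.sqrt_lt' hx_pos).1 hx.1).le
    have h_upper : x ^ 2 / q ≤ 2 * u₀ :=
      (div_le_iff₀ hq_pos).2 ((Real.lt_sqrt hx_pos.le).1 hx.2).le
    rw [Set.mem_ofPred_eq, lintegral_modHalfKernel ha ht, ← hq, ENNReal.ofNNReal_toNNReal,
      ENNReal.ofReal_mul (by positivity)]
    refine mul_le_mul' (ENNReal.ofReal_le_ofReal ?_) (h_mass _ h_lower h_upper)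
    gcongr

end HalfLine

section ModifiedSemigroup

variable {d : ℕ} {α : Fin d → ℝ} {j : Fin d} {𝕜 : Type*} [RCLike 𝕜]

theorem exists_massReaches_modKernel (hj : -2 < α j) (hj' : α j < -(1 / 2))
    (hα : ∀ i, i ≠ j → -1 < α i) : ∃ r, 1 < r ∧ MassReaches (muAlpha α) (modKernel α j) r := by
  obtain ⟨r, hr, h_mod⟩ := exists_massReaches_modHalfKernel hj hj'
  have h_factor (i : Fin d) : MassReaches (halfMeasure (α i)) (fun t => factorKernel α j t i)
      (if i = j then r else 1) := by
    obtain rfl | hij := eq_or_ne i j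
    · simpa only [factorKernel, if_pos] using h_mod
    · simpa only [factorKernel, if_neg hij] using massReaches_halfKernel (hα i hij)
  have h_exp : Tendsto (fun t : ℝ => Real.exp (-2 * t)) (𝓝[>] 0) (𝓝 1) :=
    tendsto_nhdsWithin_of_tendsto_nhds (Continuous.tendsto' (by fun_prop) 0 1 (by simp))
  have h_prod := MassReaches.pi (fun t _ => measurable_factorKernel hj hα t)
    (fun t ht => factorKernel_nonneg hj hα ht) h_factor
  rw [Finset.prod_ite_eq' Finset.univ j, if_pos (Finset.mem_univ j), ← muAlpha_eq_pi] at h_prod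
  exact ⟨r, hr, h_prod.const_mul (fun t => (Real.exp_pos _).le) h_exp⟩

theorem modifiedSemigroup_zero (α : Fin d → ℝ) (j : Fin d) (f : (Fin d → ℝ) → 𝕜) :
    modifiedSemigroup α j 0 f = f :=
  funext fun _ => if_pos rfl

theorem mapsLp_modifiedSemigroup {t : ℝ} (ht : 0 < t) {C : ℝ≥0}
    (hK : IsSymmKernel (muAlpha α) (modKernel α j t) C) {p : ℝ≥0∞} (hp : 1 ≤ p) :
    MapsLp (𝕜 := 𝕜) (muAlpha α) p (modifiedSemigroup α j t) := fun f hf =>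
  (hK.memLp_kernelOp hp hf).ae_eq (modifiedSemigroup_ae_eq_kernelOp α j ht f).symm

theorem lpOpNorm_modifiedSemigroup_le {t : ℝ} (ht : 0 < t) {C : ℝ≥0}
    (hK : IsSymmKernel (muAlpha α) (modKernel α j t) C) {p : ℝ≥0∞} (hp : 1 ≤ p) :
    lpOpNorm (𝕜 := 𝕜) (muAlpha α) p (modifiedSemigroup α j t) ≤ C := by
  refine sInf_le fun f hf => ?_
  rw [eLpNorm_congr_ae (modifiedSemigroup_ae_eq_kernelOp α j ht f)]
  exact hK.eLpNorm_kernelOp_le hp hf.1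

theorem isSymmKernel_modKernel_decayRate (hj : -(1 / 2) ≤ α j) (hα : ∀ i, i ≠ j → -1 < α i)
    {t : ℝ} (ht : 0 < t) : IsSymmKernel (muAlpha α) (modKernel α j t) (decayRate α t).toNNReal := by
  simpa only [one_mul] using isSymmKernel_modKernel (M := 1) (by linarith) hα ht
    fun u hu => massProfile_le_one (by linarith) hu

theorem decayRate_lt_one {t : ℝ} (hα : ∀ i, -1 < α i) (ht : 0 < t) : decayRate α t < 1 := by
  rw [decayRate_eq_exp_mul_prod]
  refine mul_lt_one_of_nonneg_of_lt_one_left (Real.exp_pos _).le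
    (Real.exp_lt_one_iff.2 (by linarith))
    (Finset.prod_le_one (fun i _ => by positivity) fun i _ => ?_)
  exact Real.rpow_le_one_of_one_le_of_nonpos (Real.one_le_cosh _) (by linarith [hα i])

theorem isSubmarkovian_modifiedSemigroup (hj : -(1 / 2) ≤ α j) (hα : ∀ i, i ≠ j → -1 < α i) :
    IsSubmarkovian (𝕜 := 𝕜) (muAlpha α) (modifiedSemigroup α j) :=
  isSubmarkovian_of_kernel (fun _ ht => isSymmKernel_modKernel_one hj hα ht)
    (fun _ _ hs ht => lintegral_modKernel_mul_modKernel (by linarith) hα hs ht)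
    (fun _ hf => tendsto_eLpNorm_kernelOp_modKernel_sub hj hα hf)
    (modifiedSemigroup_zero α j) (fun _ ht => modifiedSemigroup_ae_eq_kernelOp α j ht)

theorem muAlpha_ne_zero (α : Fin d → ℝ) : muAlpha α ≠ 0 := by
  rw [muAlpha_eq_pi]
  refine fun h_zero => Finset.prod_ne_zero_iff.2
    (fun i _ => halfMeasure_Ioo_ne_zero (α i) le_rfl one_pos) ((Measure.pi_pi _ _).symm.trans ?_)
  simp [h_zero]

theorem not_isMarkovian_modifiedSemigroup (hj : -(1 / 2) ≤ α j) (hα : ∀ i, i ≠ j → -1 < α i) :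
    ¬ IsMarkovian (𝕜 := 𝕜) (muAlpha α) (modifiedSemigroup α j) := by
  intro h
  have hα' (i : Fin d) : -1 < α i := by
    obtain rfl | hij := eq_or_ne i j
    exacts [by linarith, hα i hij]
  have := ae_neBot.2 (muAlpha_ne_zero α)
  obtain ⟨x, hx_one, hx_eq⟩ := ((h.conservative 1 zero_le_one).and
    (modifiedSemigroup_ae_eq_kernelOp α j one_pos fun _ => (1 : 𝕜))).exists
  have h_mass : ∫ y, modKernel α j 1 x y ∂muAlpha α = 1 := by
    rw [hx_eq, kernelOp_one] at hx_one
    exact_mod_cast hx_one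
  have h_le := (isSymmKernel_modKernel_decayRate hj hα one_pos).integral_le x
  rw [h_mass, Real.coe_toNNReal _ (decayRate_pos α 1).le] at h_le
  exact h_le.not_gt (decayRate_lt_one hα' one_pos)

theorem not_isLpContractive_modifiedSemigroup (hj : -(3 / 2) < α j) (hj' : α j < -(1 / 2))
    (hα : ∀ i, i ≠ j → -1 < α i) :
    ¬ IsLpContractive (𝕜 := 𝕜) (muAlpha α) (modifiedSemigroup α j) := by
  intro h_contr
  obtain ⟨M, hM⟩ := exists_massProfile_le (ν := α j + 1) (by linarith)
  obtain ⟨r, hr, h_reach⟩ := exists_massReaches_modKernel (by linarith) hj' hα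
  obtain ⟨t, ht, h_not_le⟩ := h_reach.exists_not_ae_le_one hr
  refine h_not_le ((isSymmKernel_modKernel (by linarith) hα ht
    hM).lintegral_le_one_of_contractive (𝕜 := 𝕜) fun f hf_two hf_top => ?_)
  rw [← eLpNorm_congr_ae (modifiedSemigroup_ae_eq_kernelOp α j ht f)]
  exact h_contr ∞ le_top t ht.le f hf_two hf_top

end ModifiedSemigroup

end LaguerreSemigroup

theorem mainTheorem7 {𝕜 : Type*} [RCLike 𝕜] {d : ℕ} (j : Fin d) (α : Fin d → ℝ)
    (hj : -(3 / 2 : ℝ) < α j) (hα : ∀ i, i ≠ j → -1 < α i) :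
    (∀ t : ℝ, 0 < t → ∀ f : (Fin d → ℝ) → 𝕜,
      LaguerreSemigroup.MemL1AddLinf (LaguerreSemigroup.muAlpha α) f →
      ∀ x : Fin d → ℝ, (∀ i, 0 < x i) →
        Integrable (fun y => LaguerreSemigroup.modifiedKernel α j t x y • f y)
          (LaguerreSemigroup.muAlpha α)) ∧
    (-(1 / 2 : ℝ) ≤ α j →
      LaguerreSemigroup.IsSubmarkovian (𝕜 := 𝕜) (LaguerreSemigroup.muAlpha α)
        (LaguerreSemigroup.modifiedSemigroup α j) ∧
      ¬ LaguerreSemigroup.IsMarkovian (𝕜 := 𝕜) (LaguerreSemigroup.muAlpha α)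
        (LaguerreSemigroup.modifiedSemigroup α j) ∧
      ∀ p : ℝ≥0∞, 1 ≤ p → ∀ t : ℝ, 0 < t →
        LaguerreSemigroup.MapsLp (𝕜 := 𝕜) (LaguerreSemigroup.muAlpha α) p
          (LaguerreSemigroup.modifiedSemigroup α j t) ∧
        LaguerreSemigroup.lpOpNorm (𝕜 := 𝕜) (LaguerreSemigroup.muAlpha α) p
            (LaguerreSemigroup.modifiedSemigroup α j t) ≤
          ENNReal.ofReal (Real.exp (-2 * t) * Real.cosh (2 * t) ^ (-((∑ i, α i) + (d : ℝ))))) ∧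
    (α j < -(1 / 2 : ℝ) →
      ¬ LaguerreSemigroup.IsLpContractive (𝕜 := 𝕜) (LaguerreSemigroup.muAlpha α)
        (LaguerreSemigroup.modifiedSemigroup α j) ∧
      ∃ c : ℝ, 1 < c ∧ ∀ p : ℝ≥0∞, 1 ≤ p → ∀ t : ℝ, 0 < t →
        LaguerreSemigroup.MapsLp (𝕜 := 𝕜) (LaguerreSemigroup.muAlpha α) p
          (LaguerreSemigroup.modifiedSemigroup α j t) ∧
        LaguerreSemigroup.lpOpNorm (𝕜 := 𝕜) (LaguerreSemigroup.muAlpha α) p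
            (LaguerreSemigroup.modifiedSemigroup α j t) ≤
          ENNReal.ofReal
            (c * (Real.exp (-2 * t) * Real.cosh (2 * t) ^ (-((∑ i, α i) + (d : ℝ)))))) := by
  obtain ⟨M, hM⟩ := LaguerreSemigroup.exists_massProfile_le (ν := α j + 1) (by linarith)
  have h_kernel (t : ℝ) (ht : 0 < t) :=
    LaguerreSemigroup.isSymmKernel_modKernel (by linarith) hα ht hM
  refine ⟨fun t ht f hf x hx => ?_, fun hj' => ⟨?_, ?_, fun p hp t ht => ?_⟩,
    fun hj' => ⟨?_, M + 2, by linarith [M.coe_nonneg], fun p hp t ht => ⟨?_, ?_⟩⟩⟩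
  · refine ((h_kernel t ht).integrable hf x).congr ?_
    filter_upwards [LaguerreSemigroup.muAlpha_ae_pos α] with y hy
    rw [LaguerreSemigroup.modifiedKernel_eq_modKernel α j ht hx hy]
  · exact LaguerreSemigroup.isSubmarkovian_modifiedSemigroup hj' hα
  · exact LaguerreSemigroup.not_isMarkovian_modifiedSemigroup hj' hα
  · have h_decay := LaguerreSemigroup.isSymmKernel_modKernel_decayRate hj' hα ht
    exact ⟨LaguerreSemigroup.mapsLp_modifiedSemigroup ht h_decay hp,
      LaguerreSemigroup.lpOpNorm_modifiedSemigroup_le ht h_decay hp⟩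
  · exact LaguerreSemigroup.not_isLpContractive_modifiedSemigroup hj hj' hα
  · exact LaguerreSemigroup.mapsLp_modifiedSemigroup ht (h_kernel t ht) hp
  · refine (LaguerreSemigroup.lpOpNorm_modifiedSemigroup_le ht (h_kernel t ht) hp).trans ?_
    rw [← LaguerreSemigroup.decayRate, ENNReal.ofReal_mul (by positivity), ENNReal.coe_mul]
    refine mul_le_mul' ?_ le_rfl
    exact ENNReal.ofReal_coe_nnreal.symm.trans_le (ENNReal.ofReal_le_ofReal (by linarith))
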